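/- Let $K$ be a (commutative) field. A \emph{double poset} is a finite set $P$ with two partial orders $\le_1,\le_2$; isomorphic double posets are identified. A double poset is \emph{plane} if any two distinct elements of it are comparable for exactly one of the two orders. It is \emph{WN} (without N) if it is plane and has no double subposet isomorphic to one of the two plane posets on four elements $a,b,c,d$ whose strict first order is $a<_1c$, $a<_1d$, $b<_1d$ (the strict second order being $a<_2b$, $c<_2b$, $c<_2d$ for the one, and the reverse of this for the other). Let $H_{DP}$, $H_{PP}$, $H_{WNP}$ be the $K$-vector spaces whose bases are respectively all double posets, the plane posets and the WN posets. They are Hopf algebras, graded by cardinality, for the following operations: the product $PQ$ of two double posets is their disjoint union, where $P$ and $Q$ keep their orders and, for all $x\in P$ and $y\in Q$, $x\le_2 y$ and $x,y$ are not $\le_1$-comparable; the coproduct is $\Delta(P)=\sum_I (P\setminus I)\otimes I$, the sum being over the subsets $I$ of $P$ that are upwards closed for $\le_1$. Let $H$ be any of these three Hopf algebras. \begin{enumerate} \item $H$ is free (as an associative unital algebra it is isomorphic to a free one $T(V)$) and cofree (as a coalgebra it is isomorphic to a tensor coalgebra $T(W)$ with the deconcatenation coproduct). \item $H$ is self-dual: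 it is isomorphic, as a graded Hopf algebra, to its graded dual. \item If $K$ has characteristic zero, the Lie algebra $\mathrm{Prim}(H)=\{x\in H : \Delta(x)=x\otimes 1+1\otimes x\}$, with the commutator bracket, is a free Lie algebra. \end{enumerate} -/

import Mathlib

open scoped TensorProduct

set_option linter.unusedSectionVars false

/-! ### Double posets -/

/-- A double poset structure on `α`: two partial orders on `α`. -/
structure DoublePoset (α : Type) where
  /-- the first order (`≤_h` for plane posets) -/
  le₁ : α → α → Prop
  /-- the second order (`≤_r` for plane posets) -/
  le₂ : α → α → Prop
  refl₁ : ∀ x, le₁ x x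
  trans₁ : ∀ x y z, le₁ x y → le₁ y z → le₁ x z
  antisymm₁ : ∀ x y, le₁ x y → le₁ y x → x = y
  refl₂ : ∀ x, le₂ x x
  trans₂ : ∀ x y z, le₂ x y → le₂ y z → le₂ x z
  antisymm₂ : ∀ x y, le₂ x y → le₂ y x → x = y

namespace DoublePoset

variable {α β γ δ : Type}

/-- The double poset induced along an injection. -/
def comap (P : DoublePoset α) (f : β ↪ α) : DoublePoset β where
  le₁ x y := P.le₁ (f x) (f y)
  le₂ x y := P.le₂ (f x) (f y)
  refl₁ _ := P.refl₁ _
  trans₁ _ _ _ := P.trans₁ _ _ _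
  antisymm₁ _ _ h h' := f.injective (P.antisymm₁ _ _ h h')
  refl₂ _ := P.refl₂ _
  trans₂ _ _ _ := P.trans₂ _ _ _
  antisymm₂ _ _ h h' := f.injective (P.antisymm₂ _ _ h h')

/-- The double subposet carried by a subset. -/
def restrict (P : DoublePoset α) (s : Set α) : DoublePoset s :=
  P.comap (Function.Embedding.subtype (· ∈ s))

/-- Isomorphism of double posets. -/
def Iso (P : DoublePoset α) (Q : DoublePoset β) : Prop :=
  ∃ e : α ≃ β, (∀ x y, P.le₁ x y ↔ Q.le₁ (e x) (e y)) ∧ (∀ x y, P.le₂ x y ↔ Q.le₂ (e x) (e y))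

theorem Iso.refl (P : DoublePoset α) : P.Iso P :=
  ⟨Equiv.refl _, fun _ _ => Iff.rfl, fun _ _ => Iff.rfl⟩

theorem Iso.symm {P : DoublePoset α} {Q : DoublePoset β} : P.Iso Q → Q.Iso P := by
  rintro ⟨e, h₁, h₂⟩
  exact ⟨e.symm, fun x y => by simp [h₁], fun x y => by simp [h₂]⟩

theorem Iso.trans {P : DoublePoset α} {Q : DoublePoset β} {R : DoublePoset γ} :
    P.Iso Q → Q.Iso R → P.Iso R := by
  rintro ⟨e, h₁, h₂⟩ ⟨f, k₁, k₂⟩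
  exact ⟨e.trans f, fun x y => by simp [h₁, k₁], fun x y => by simp [h₂, k₂]⟩

theorem comap_iso (P : DoublePoset α) (e : β ≃ α) : (P.comap e.toEmbedding).Iso P :=
  ⟨e, fun _ _ => Iff.rfl, fun _ _ => Iff.rfl⟩

/-- The composition of `P` and `Q`: on the disjoint union, every `x ∈ P` and `y ∈ Q` satisfy
`x ≤₂ y` and are not comparable for `≤₁`. -/
def comp (P : DoublePoset α) (Q : DoublePoset β) : DoublePoset (α ⊕ β) where
  le₁ := Sum.LiftRel P.le₁ Q.le₁
  le₂ := Sum.Lex P.le₂ Q.le₂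
  refl₁ := by rintro (x | x) <;> simp [P.refl₁, Q.refl₁]
  trans₁ := by
    rintro (x | x) (y | y) (z | z) <;> simp
    · exact P.trans₁ _ _ _
    · exact Q.trans₁ _ _ _
  antisymm₁ := by
    rintro (x | x) (y | y) <;> simp
    · exact P.antisymm₁ _ _
    · exact Q.antisymm₁ _ _
  refl₂ := by rintro (x | x) <;> simp [P.refl₂, Q.refl₂]
  trans₂ := by
    rintro (x | x) (y | y) (z | z) <;> simp
    · exact P.trans₂ _ _ _
    · exact Q.trans₂ _ _ _
  antisymm₂ := by
    rintro (x | x) (y | y) <;> simp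
    · exact P.antisymm₂ _ _
    · exact Q.antisymm₂ _ _

/-- The empty double poset. -/
def empty : DoublePoset (Fin 0) where
  le₁ _ _ := True
  le₂ _ _ := True
  refl₁ _ := trivial
  trans₁ _ _ _ _ _ := trivial
  antisymm₁ x := x.elim0
  refl₂ _ := trivial
  trans₂ _ _ _ _ _ := trivial
  antisymm₂ x := x.elim0

theorem iso_of_isEmpty [IsEmpty α] [IsEmpty β] (P : DoublePoset α) (Q : DoublePoset β) :
    P.Iso Q :=
  ⟨Equiv.equivOfIsEmpty α β, fun x => isEmptyElim x, fun x => isEmptyElim x⟩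

theorem Iso.comp {P : DoublePoset α} {Q : DoublePoset β} {P' : DoublePoset γ}
    {Q' : DoublePoset δ} (h : P.Iso P') (k : Q.Iso Q') : (P.comp Q).Iso (P'.comp Q') := by
  obtain ⟨e, h₁, h₂⟩ := h
  obtain ⟨f, k₁, k₂⟩ := k
  refine ⟨Equiv.sumCongr e f, ?_, ?_⟩
  · rintro (x | x) (y | y) <;> simp [DoublePoset.comp, h₁, k₁]
  · rintro (x | x) (y | y) <;> simp [DoublePoset.comp, h₂, k₂]

theorem comp_assoc_iso (P : DoublePoset α) (Q : DoublePoset β) (R : DoublePoset γ) :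
    ((P.comp Q).comp R).Iso (P.comp (Q.comp R)) := by
  refine ⟨Equiv.sumAssoc α β γ, ?_, ?_⟩
  · rintro ((x | x) | x) ((y | y) | y) <;> simp [DoublePoset.comp]
  · rintro ((x | x) | x) ((y | y) | y) <;> simp [DoublePoset.comp]

theorem empty_comp_iso [IsEmpty α] (E : DoublePoset α) (P : DoublePoset β) :
    (E.comp P).Iso P := by
  refine ⟨Equiv.emptySum α β, ?_, ?_⟩ <;>
  · rintro (x | x) (y | y)
    all_goals first | exact isEmptyElim x | exact isEmptyElim y | simp [DoublePoset.comp]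

theorem comp_empty_iso [IsEmpty α] (E : DoublePoset α) (P : DoublePoset β) :
    (P.comp E).Iso P := by
  refine ⟨Equiv.sumEmpty β α, ?_, ?_⟩ <;>
  · rintro (x | x) (y | y)
    all_goals first | exact isEmptyElim x | exact isEmptyElim y | simp [DoublePoset.comp]

theorem restrict_restrict_iso (P : DoublePoset α) (s : Set α) (t : Set s) (u : Set α)
    (h : u = Subtype.val '' t) : ((P.restrict s).restrict t).Iso (P.restrict u) := by
  subst h
  refine ⟨Equiv.Set.image _ t Subtype.val_injective, fun _ _ => Iff.rfl, fun _ _ => Iff.rfl⟩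

theorem restrict_univ_iso (P : DoublePoset α) : (P.restrict Set.univ).Iso P :=
  ⟨Equiv.Set.univ α, fun _ _ => Iff.rfl, fun _ _ => Iff.rfl⟩

theorem restrict_comp_iso (P : DoublePoset α) (Q : DoublePoset β) (s : Set (α ⊕ β))
    (t : Set α) (u : Set β) (ht : t = Sum.inl ⁻¹' s) (hu : u = Sum.inr ⁻¹' s) :
    ((P.comp Q).restrict s).Iso ((P.restrict t).comp (Q.restrict u)) := by
  subst ht hu
  refine Iso.symm ⟨⟨Sum.elim (fun x => ⟨.inl x.1, x.2⟩) (fun x => ⟨.inr x.1, x.2⟩),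
    fun x => match x with
      | ⟨.inl a, h⟩ => .inl ⟨a, h⟩
      | ⟨.inr a, h⟩ => .inr ⟨a, h⟩, ?_, ?_⟩, ?_, ?_⟩
  · rintro (x | x) <;> rfl
  · rintro ⟨x | x, h⟩ <;> rfl
  · rintro (x | x) (y | y) <;> simp [DoublePoset.comp, restrict, comap]
  · rintro (x | x) (y | y) <;> simp [DoublePoset.comp, restrict, comap]

/-- (`1`-)ideals: subsets that are upwards closed for `≤₁`. -/
def IsIdeal (P : DoublePoset α) (I : Set α) : Prop :=
  ∀ x ∈ I, ∀ y, P.le₁ x y → y ∈ I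

/-- The type of ideals of `P`. -/
def Ideals (P : DoublePoset α) : Type := {I : Set α // P.IsIdeal I}

noncomputable instance [Finite α] (P : DoublePoset α) : Fintype P.Ideals :=
  @Fintype.ofFinite _ (inferInstanceAs (Finite {I : Set α // P.IsIdeal I}))

/-! ### Plane posets and WN posets -/

/-- Plane: two distinct elements are comparable for exactly one of the two orders. -/
def IsPlane (P : DoublePoset α) : Prop :=
  ∀ x y, x ≠ y → ((P.le₁ x y ∨ P.le₁ y x) ↔ ¬ (P.le₂ x y ∨ P.le₂ y x))

/-- `Q` is isomorphic to a double subposet of `P`. -/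
def Contains (P : DoublePoset α) (Q : DoublePoset β) : Prop :=
  ∃ s : Set α, (P.restrict s).Iso Q

/-- The first plane poset whose Hasse graph is the letter N:
`0 <₁ 2`, `0 <₁ 3`, `1 <₁ 3` and `0 <₂ 1`, `2 <₂ 1`, `2 <₂ 3`. -/
def N₁ : DoublePoset (Fin 4) where
  le₁ i j := i = j ∨ (i, j) ∈ [((0 : Fin 4), (2 : Fin 4)), (0, 3), (1, 3)]
  le₂ i j := i = j ∨ (i, j) ∈ [((0 : Fin 4), (1 : Fin 4)), (2, 1), (2, 3)]
  refl₁ := by decide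
  trans₁ := by decide
  antisymm₁ := by decide
  refl₂ := by decide
  trans₂ := by decide
  antisymm₂ := by decide

/-- The second one, obtained from the first by reversing the second order. -/
def N₂ : DoublePoset (Fin 4) where
  le₁ i j := i = j ∨ (i, j) ∈ [((0 : Fin 4), (2 : Fin 4)), (0, 3), (1, 3)]
  le₂ i j := i = j ∨ (i, j) ∈ [((1 : Fin 4), (0 : Fin 4)), (1, 2), (3, 2)]
  refl₁ := by decide
  trans₁ := by decide
  antisymm₁ := by decide
  refl₂ := by decide
  trans₂ := by decide
  antisymm₂ := by decide

/-- WN ("without N") posets. -/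
def IsWN (P : DoublePoset α) : Prop := P.IsPlane ∧ ¬ P.Contains N₁ ∧ ¬ P.Contains N₂

theorem Iso.isPlane {P : DoublePoset α} {Q : DoublePoset β} (h : P.Iso Q) (hP : P.IsPlane) :
    Q.IsPlane := by
  obtain ⟨e, h₁, h₂⟩ := h.symm
  intro x y hxy
  simpa [h₁, h₂] using hP (e x) (e y) (by simpa using hxy)

theorem IsPlane.restrict {P : DoublePoset α} (h : P.IsPlane) (s : Set α) :
    (P.restrict s).IsPlane := fun x y hxy => h x y (by simpa [Subtype.ext_iff] using hxy)

theorem IsPlane.comp {P : DoublePoset α} {Q : DoublePoset β} (h : P.IsPlane) (k : Q.IsPlane) :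
    (P.comp Q).IsPlane := by
  rintro (x | x) (y | y) hxy
  · simpa [DoublePoset.comp] using h x y (by simpa using hxy)
  · simp [DoublePoset.comp]
  · simp [DoublePoset.comp]
  · simpa [DoublePoset.comp] using k x y (by simpa using hxy)

theorem contains_iff {P : DoublePoset α} {Q : DoublePoset β} : P.Contains Q ↔
    ∃ f : β → α, Function.Injective f ∧ (∀ x y, Q.le₁ x y ↔ P.le₁ (f x) (f y)) ∧
      (∀ x y, Q.le₂ x y ↔ P.le₂ (f x) (f y)) := by
  constructor
  · rintro ⟨s, h⟩
    obtain ⟨e, h₁, h₂⟩ := h.symm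
    exact ⟨fun x => (e x).1, Subtype.val_injective.comp e.injective, h₁, h₂⟩
  · rintro ⟨f, hf, h₁, h₂⟩
    exact ⟨Set.range f, Iso.symm ⟨Equiv.ofInjective f hf, h₁, h₂⟩⟩

theorem Iso.contains {P : DoublePoset α} {Q : DoublePoset β} {R : DoublePoset γ} (h : P.Iso Q)
    (hP : P.Contains R) : Q.Contains R := by
  obtain ⟨e, h₁, h₂⟩ := h
  obtain ⟨f, hf, k₁, k₂⟩ := contains_iff.1 hP
  exact contains_iff.2 ⟨e ∘ f, e.injective.comp hf, fun x y => by simp [k₁, h₁],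
    fun x y => by simp [k₂, h₂]⟩

theorem Contains.of_restrict {P : DoublePoset α} {R : DoublePoset γ} {s : Set α}
    (h : (P.restrict s).Contains R) : P.Contains R := by
  obtain ⟨f, hf, k₁, k₂⟩ := contains_iff.1 h
  exact contains_iff.2 ⟨fun x => (f x).1, Subtype.val_injective.comp hf, k₁, k₂⟩

/-- A double poset on `Fin 4` whose first order contains `0 < 2`, `0 < 3`, `1 < 3` can only be
contained in a composition if it is contained in one of the two factors. -/
theorem Contains.of_comp {P : DoublePoset α} {Q : DoublePoset β} {R : DoublePoset (Fin 4)}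
    (h02 : R.le₁ 0 2) (h03 : R.le₁ 0 3) (h13 : R.le₁ 1 3)
    (h : (P.comp Q).Contains R) : P.Contains R ∨ Q.Contains R := by
  obtain ⟨f, hf, k₁, k₂⟩ := contains_iff.1 h
  have a02 := (k₁ 0 2).1 h02
  have a03 := (k₁ 0 3).1 h03
  have a13 := (k₁ 1 3).1 h13
  rcases h0 : f 0 with x | x
  · left
    have key : ∀ i, ∃ y, f i = Sum.inl y := by
      rw [h0] at a02 a03
      rcases h2 : f 2 with y2 | y2
      · rcases h3 : f 3 with y3 | y3
        · rcases h1 : f 1 with y1 | y1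
          · intro i; fin_cases i
            exacts [⟨_, h0⟩, ⟨_, h1⟩, ⟨_, h2⟩, ⟨_, h3⟩]
          · simp [h1, h3, DoublePoset.comp] at a13
        · simp [h3, DoublePoset.comp] at a03
      · simp [h2, DoublePoset.comp] at a02
    choose g hg using key
    refine contains_iff.2 ⟨g, fun i j hij => hf (by rw [hg, hg, hij]), ?_, ?_⟩
    · intro i j; rw [k₁, hg, hg]; simp [DoublePoset.comp]
    · intro i j; rw [k₂, hg, hg]; simp [DoublePoset.comp]
  · right
    have key : ∀ i, ∃ y, f i = Sum.inr y := by
      rw [h0] at a02 a03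
      rcases h2 : f 2 with y2 | y2
      · simp [h2, DoublePoset.comp] at a02
      · rcases h3 : f 3 with y3 | y3
        · simp [h3, DoublePoset.comp] at a03
        · rcases h1 : f 1 with y1 | y1
          · simp [h1, h3, DoublePoset.comp] at a13
          · intro i; fin_cases i
            exacts [⟨_, h0⟩, ⟨_, h1⟩, ⟨_, h2⟩, ⟨_, h3⟩]
    choose g hg using key
    refine contains_iff.2 ⟨g, fun i j hij => hf (by rw [hg, hg, hij]), ?_, ?_⟩
    · intro i j; rw [k₁, hg, hg]; simp [DoublePoset.comp]
    · intro i j; rw [k₂, hg, hg]; simp [DoublePoset.comp]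

theorem Iso.isWN {P : DoublePoset α} {Q : DoublePoset β} (h : P.Iso Q) (hP : P.IsWN) :
    Q.IsWN :=
  ⟨h.isPlane hP.1, fun k => hP.2.1 (h.symm.contains k), fun k => hP.2.2 (h.symm.contains k)⟩

theorem IsWN.restrict {P : DoublePoset α} (h : P.IsWN) (s : Set α) : (P.restrict s).IsWN :=
  ⟨h.1.restrict s, fun k => h.2.1 k.of_restrict, fun k => h.2.2 k.of_restrict⟩

theorem IsWN.comp {P : DoublePoset α} {Q : DoublePoset β} (h : P.IsWN) (k : Q.IsWN) :
    (P.comp Q).IsWN := by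
  refine ⟨h.1.comp k.1, fun c => ?_, fun c => ?_⟩
  · rcases c.of_comp (by simp [N₁]) (by simp [N₁]) (by simp [N₁]) with c | c
    exacts [h.2.1 c, k.2.1 c]
  · rcases c.of_comp (by simp [N₂]) (by simp [N₂]) (by simp [N₂]) with c | c
    exacts [h.2.2 c, k.2.2 c]

theorem IsPlane.of_isEmpty [IsEmpty α] (P : DoublePoset α) : P.IsPlane :=
  fun x => isEmptyElim x

theorem IsWN.of_isEmpty [IsEmpty α] (P : DoublePoset α) : P.IsWN := by
  refine ⟨.of_isEmpty P, fun c => ?_, fun c => ?_⟩ <;>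
  · obtain ⟨f, -⟩ := contains_iff.1 c
    exact isEmptyElim (f 0)

end DoublePoset

/-! ### Isoclasses of finite double posets -/

/-- Isomorphism, as an equivalence relation on the double posets with underlying set `Fin n`. -/
instance doublePosetSetoid : Setoid (Σ n : ℕ, DoublePoset (Fin n)) where
  r P Q := P.2.Iso Q.2
  iseqv := ⟨fun P => .refl P.2, fun h => h.symm, fun h k => h.trans k⟩

/-- The set of isoclasses of finite double posets. -/
def DP : Type := Quotient doublePosetSetoid

namespace DP

open DoublePoset

variable {α β γ : Type} [Finite α] [Finite β] [Finite γ]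

/-- The isoclass of a finite double poset. -/
noncomputable def cls (P : DoublePoset α) : DP :=
  Quotient.mk _ ⟨Nat.card α, P.comap (Finite.equivFin α).symm.toEmbedding⟩

theorem cls_eq_iff {P : DoublePoset α} {Q : DoublePoset β} : cls P = cls Q ↔ P.Iso Q := by
  constructor
  · intro h
    exact ((comap_iso P _).symm.trans (Quotient.exact h)).trans (comap_iso Q _)
  · intro h
    exact Quotient.sound (((comap_iso P _).trans h).trans (comap_iso Q _).symm)

/-- A representative of an isoclass. -/
noncomputable def rep (x : DP) : DoublePoset (Fin (Quotient.out x).1) := (Quotient.out x).2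

theorem cls_mk {n : ℕ} (P : DoublePoset (Fin n)) :
    cls P = Quotient.mk doublePosetSetoid ⟨n, P⟩ :=
  Quotient.sound (comap_iso P _)

@[simp] theorem cls_rep (x : DP) : cls x.rep = x := by
  rw [cls_mk]
  exact Quotient.out_eq x

theorem rep_cls_iso (P : DoublePoset α) : (cls P).rep.Iso P := cls_eq_iff.1 (cls_rep _)

/-- The cardinality of an isoclass. -/
noncomputable def card (x : DP) : ℕ := (Quotient.out x).1

theorem card_cls (P : DoublePoset α) : (cls P).card = Nat.card α := by
  obtain ⟨e, -⟩ := rep_cls_iso P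
  exact (Nat.card_fin _).symm.trans (Nat.card_congr e)

/-- The composition product on isoclasses, with unit the empty double poset. -/
noncomputable instance : Monoid DP where
  mul x y := cls (x.rep.comp y.rep)
  one := cls DoublePoset.empty
  mul_assoc x y z := cls_eq_iff.2
    ((((rep_cls_iso _).comp (.refl _)).trans (comp_assoc_iso _ _ _)).trans
      ((Iso.refl _).comp (rep_cls_iso _)).symm)
  one_mul x := by
    change cls ((cls DoublePoset.empty).rep.comp x.rep) = x
    conv_rhs => rw [← cls_rep x]
    exact cls_eq_iff.2 (((rep_cls_iso _).comp (.refl _)).trans (empty_comp_iso _ _))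
  mul_one x := by
    change cls (x.rep.comp (cls DoublePoset.empty).rep) = x
    conv_rhs => rw [← cls_rep x]
    exact cls_eq_iff.2 (((Iso.refl _).comp (rep_cls_iso _)).trans (comp_empty_iso _ _))

theorem cls_mul_cls (P : DoublePoset α) (Q : DoublePoset β) : cls P * cls Q = cls (P.comp Q) :=
  cls_eq_iff.2 ((rep_cls_iso P).comp (rep_cls_iso Q))

theorem cls_of_isEmpty [IsEmpty α] (P : DoublePoset α) : cls P = 1 :=
  cls_eq_iff.2 (iso_of_isEmpty _ _)

end DP

/-- A set of isoclasses of double posets that contains the empty one and is stable under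
composition and under taking double subposets. -/
structure PosetFamily extends Submonoid DP where
  restrict_rep_mem : ∀ x ∈ carrier, ∀ s, DP.cls (x.rep.restrict s) ∈ carrier

namespace PosetFamily

open DoublePoset DP

theorem restrict_mem (C : PosetFamily) {α : Type} [Finite α] {P : DoublePoset α}
    (h : cls P ∈ C.toSubmonoid) (s : Set α) : cls (P.restrict s) ∈ C.toSubmonoid := by
  obtain ⟨e, h₁, h₂⟩ := (rep_cls_iso P).symm
  have := C.restrict_rep_mem _ h (e '' s)
  rw [cls_eq_iff.2 (_ : ((cls P).rep.restrict (e '' s)).Iso (P.restrict s))] at this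
  · exact this
  · exact Iso.symm ⟨e.image s, fun x y => h₁ x y, fun x y => h₂ x y⟩

/-- All double posets. -/
noncomputable def all : PosetFamily where
  toSubmonoid := ⊤
  restrict_rep_mem := fun _ _ _ => trivial

/-- The isoclasses of plane posets. -/
noncomputable def plane : PosetFamily where
  carrier := {x | x.rep.IsPlane}
  one_mem' := (rep_cls_iso DoublePoset.empty).symm.isPlane (.of_isEmpty _)
  mul_mem' := fun h k => (rep_cls_iso _).symm.isPlane (IsPlane.comp h k)
  restrict_rep_mem := fun _ h s => (rep_cls_iso _).symm.isPlane (IsPlane.restrict h s)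

/-- The isoclasses of WN posets. -/
noncomputable def wn : PosetFamily where
  carrier := {x | x.rep.IsWN}
  one_mem' := (rep_cls_iso DoublePoset.empty).symm.isWN (.of_isEmpty _)
  mul_mem' := fun h k => (rep_cls_iso _).symm.isWN (IsWN.comp h k)
  restrict_rep_mem := fun _ h s => (rep_cls_iso _).symm.isWN (IsWN.restrict h s)

end PosetFamily

/-! ### The Hopf algebras -/

/-- The vector space with basis the isoclasses in `C`, with the product extending the composition
of double posets. -/
def HopfOf (K : Type*) [Field K] (C : PosetFamily) := MonoidAlgebra K C.toSubmonoid

namespace HopfOf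

open DoublePoset DP

variable (K : Type*) [Field K] (C : PosetFamily)

noncomputable instance : Ring (HopfOf K C) :=
  inferInstanceAs (Ring (MonoidAlgebra K C.toSubmonoid))

noncomputable instance : Algebra K (HopfOf K C) :=
  inferInstanceAs (Algebra K (MonoidAlgebra K C.toSubmonoid))

variable {C}

/-- The basis element given by an isoclass. -/
noncomputable def of (x : C.toSubmonoid) : HopfOf K C := MonoidAlgebra.single x 1

variable {α β γ : Type} [Finite α] [Finite β] [Finite γ]

/-- The basis element given by a double poset. -/
noncomputable def elt (P : DoublePoset α) (h : cls P ∈ C.toSubmonoid) : HopfOf K C :=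
  of K ⟨cls P, h⟩

theorem elt_congr {P : DoublePoset α} {Q : DoublePoset β} (h : cls P ∈ C.toSubmonoid)
    (k : cls Q ∈ C.toSubmonoid) (e : P.Iso Q) : elt K P h = elt K Q k := by
  unfold elt
  congr 2
  exact cls_eq_iff.2 e

/-- The coproduct of a double poset: the sum of `(P \ I) ⊗ I` over the ideals `I` of `P`. -/
noncomputable def coprod (P : DoublePoset α) (h : cls P ∈ C.toSubmonoid) :
    HopfOf K C ⊗[K] HopfOf K C :=
  ∑ I : P.Ideals, elt K (P.restrict I.1ᶜ) (C.restrict_mem h _) ⊗ₜ[K]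
    elt K (P.restrict I.1) (C.restrict_mem h _)

theorem coprod_congr {P : DoublePoset α} {Q : DoublePoset β} (h : cls P ∈ C.toSubmonoid)
    (k : cls Q ∈ C.toSubmonoid) (e : P.Iso Q) : coprod K P h = coprod K Q k := by
  obtain ⟨e, h₁, h₂⟩ := e
  unfold coprod
  let E : P.Ideals ≃ Q.Ideals := (Equiv.Set.congr e).subtypeEquiv (by
    intro I
    constructor
    · rintro hI _ ⟨x, hx, rfl⟩ y hy
      exact ⟨e.symm y, hI x hx _ ((h₁ _ _).2 (by simpa using hy)), by simp⟩
    · intro hI x hx y hxy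
      obtain ⟨z, hz, hzy⟩ := hI (e x) ⟨x, hx, rfl⟩ (e y) ((h₁ _ _).1 hxy)
      rwa [← e.injective hzy])
  have key : ∀ s : Set α, (P.restrict s).Iso (Q.restrict (e '' s)) := fun s =>
    ⟨e.image s, fun x y => h₁ x y, fun x y => h₂ x y⟩
  refine Fintype.sum_equiv E _ _ fun I => ?_
  have hE : (E I).1 = e '' I.1 := rfl
  congr 1
  · apply elt_congr
    rw [hE, ← Set.image_compl_eq e.bijective]
    exact key _
  · apply elt_congr
    rw [hE]
    exact key _

theorem elt_mul_elt {P : DoublePoset α} {Q : DoublePoset β} (h : cls P ∈ C.toSubmonoid)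
    (k : cls Q ∈ C.toSubmonoid) (hk : cls (P.comp Q) ∈ C.toSubmonoid) :
    elt K P h * elt K Q k = elt K (P.comp Q) hk := by
  refine (MonoidAlgebra.single_mul_single ..).trans ?_
  unfold elt of
  congr 1
  · exact Subtype.ext (cls_mul_cls P Q)
  · simp

theorem of_eq_elt (x : C.toSubmonoid) : of K x = elt K x.1.rep (by simp) := by
  unfold elt
  congr 1
  exact Subtype.ext (by simp)

theorem one_eq_elt [IsEmpty α] (P : DoublePoset α) (h : cls P ∈ C.toSubmonoid) :
    (1 : HopfOf K C) = elt K P h := by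
  unfold elt of
  refine MonoidAlgebra.one_def.trans ?_
  congr 1
  exact Subtype.ext (cls_of_isEmpty P).symm

theorem comp_mem {P : DoublePoset α} {Q : DoublePoset β} (h : cls P ∈ C.toSubmonoid)
    (k : cls Q ∈ C.toSubmonoid) : cls (P.comp Q) ∈ C.toSubmonoid :=
  cls_mul_cls P Q ▸ C.toSubmonoid.mul_mem h k

theorem coprod_comp {P : DoublePoset α} {Q : DoublePoset β} (h : cls P ∈ C.toSubmonoid)
    (k : cls Q ∈ C.toSubmonoid) :
    coprod K (P.comp Q) (comp_mem h k) = coprod K P h * coprod K Q k := by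
  unfold coprod
  rw [Finset.sum_mul_sum, ← Fintype.sum_prod_type']
  let E : (P.comp Q).Ideals ≃ P.Ideals × Q.Ideals :=
    { toFun := fun I => (⟨Sum.inl ⁻¹' I.1, fun x hx y hxy => I.2 _ hx _ (by simpa [comp] using hxy)⟩,
        ⟨Sum.inr ⁻¹' I.1, fun x hx y hxy => I.2 _ hx _ (by simpa [comp] using hxy)⟩)
      invFun := fun J => ⟨Sum.inl '' J.1.1 ∪ Sum.inr '' J.2.1, by
        rintro (x | x) hx (y | y) hxy
        · simp [comp] at hx hxy ⊢; exact J.1.2 x hx y hxy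
        · simp [comp] at hxy
        · simp [comp] at hxy
        · simp [comp] at hx hxy ⊢; exact J.2.2 x hx y hxy⟩
      left_inv := fun I => Subtype.ext (by ext (x | x) <;> simp)
      right_inv := fun J => Prod.ext (Subtype.ext (by ext x; simp)) (Subtype.ext (by ext x; simp)) }
  refine Fintype.sum_equiv E _ _ fun I => ?_
  rw [Algebra.TensorProduct.tmul_mul_tmul,
    elt_mul_elt K _ _ (comp_mem (C.restrict_mem h _) (C.restrict_mem k _)),
    elt_mul_elt K _ _ (comp_mem (C.restrict_mem h _) (C.restrict_mem k _))]
  congr 1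
  · exact elt_congr K _ _ (restrict_comp_iso _ _ _ _ _ rfl rfl)
  · exact elt_congr K _ _ (restrict_comp_iso _ _ _ _ _ rfl rfl)

theorem coprod_of_isEmpty [IsEmpty α] (P : DoublePoset α) (h : cls P ∈ C.toSubmonoid) :
    coprod K P h = 1 := by
  unfold coprod
  have : Unique P.Ideals :=
    { default := ⟨∅, fun x => isEmptyElim x⟩
      uniq := fun I => Subtype.ext (Subsingleton.elim _ _) }
  rw [Fintype.sum_unique, ← one_eq_elt, ← one_eq_elt]
  rfl

variable (C)

/-- The coproduct, as a morphism of algebras. -/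
noncomputable def comulHom : HopfOf K C →ₐ[K] HopfOf K C ⊗[K] HopfOf K C :=
  MonoidAlgebra.lift K (HopfOf K C ⊗[K] HopfOf K C) C.toSubmonoid
    { toFun := fun x => coprod K x.1.rep (by simp)
      map_one' := (coprod_congr K _ (by rw [cls_of_isEmpty]; exact one_mem _)
        (rep_cls_iso DoublePoset.empty)).trans (coprod_of_isEmpty K _ _)
      map_mul' := fun x y => (coprod_congr K _ _ (rep_cls_iso _)).trans
        (coprod_comp K (by simp) (by simp)) }

theorem card_mul (x y : DP) : (x * y).card = x.card + y.card := by
  refine (card_cls (x.rep.comp y.rep)).trans ?_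
  rw [Nat.card_sum, Nat.card_fin, Nat.card_fin]
  rfl

theorem card_one : (1 : DP).card = 0 := by
  rw [← cls_of_isEmpty DoublePoset.empty, card_cls]
  simp

open Classical in
/-- The counit, as a morphism of algebras: it is `1` on the empty double poset and `0` on the
other double posets. -/
noncomputable def counitHom : HopfOf K C →ₐ[K] K :=
  MonoidAlgebra.lift K K C.toSubmonoid
    { toFun := fun x => if x.1.card = 0 then 1 else 0
      map_one' := by simp [card_one]
      map_mul' := fun x y => by
        by_cases hx : x.1.card = 0 <;> by_cases hy : y.1.card = 0 <;> simp [card_mul, hx, hy] }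

variable {C}

theorem comulHom_elt (P : DoublePoset α) (h : cls P ∈ C.toSubmonoid) :
    comulHom K C (elt K P h) = coprod K P h := by
  refine (MonoidAlgebra.lift_single ..).trans ?_
  rw [one_smul]
  exact coprod_congr K (by simpa using h) h (rep_cls_iso P)

open Classical in
theorem counitHom_elt (P : DoublePoset α) (h : cls P ∈ C.toSubmonoid) :
    counitHom K C (elt K P h) = if Nat.card α = 0 then 1 else 0 := by
  refine (MonoidAlgebra.lift_single ..).trans ?_
  rw [one_smul]
  simp [card_cls]

theorem linearMap_ext {M : Type*} [AddCommMonoid M] [Module K M] {f g : HopfOf K C →ₗ[K] M}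
    (h : ∀ (n : ℕ) (P : DoublePoset (Fin n)) (hP : cls P ∈ C.toSubmonoid),
      f (elt K P hP) = g (elt K P hP)) : f = g := by
  refine MonoidAlgebra.lhom_ext' fun x => LinearMap.ext_ring ?_
  have := h _ x.1.rep (by simp)
  rw [← of_eq_elt] at this
  exact this

theorem algHom_ext' {M : Type*} [Semiring M] [Algebra K M] {f g : HopfOf K C →ₐ[K] M}
    (h : ∀ (n : ℕ) (P : DoublePoset (Fin n)) (hP : cls P ∈ C.toSubmonoid),
      f (elt K P hP) = g (elt K P hP)) : f = g :=
  AlgHom.toLinearMap_injective (linearMap_ext K h)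

theorem elt_eq_one {P : DoublePoset α} (h : cls P ∈ C.toSubmonoid) (hα : Nat.card α = 0) :
    elt K P h = 1 := by
  have : IsEmpty α := (Nat.card_eq_zero.1 hα).resolve_right (not_infinite_iff_finite.2 ‹_›)
  exact (one_eq_elt K P h).symm

/-- Pairs of ideals `A ⊆ B` of `P`. -/
def IdealPairs (P : DoublePoset α) : Type :=
  {p : Set α × Set α // P.IsIdeal p.1 ∧ P.IsIdeal p.2 ∧ p.1 ⊆ p.2}

noncomputable instance (P : DoublePoset α) : Fintype (IdealPairs P) :=
  @Fintype.ofFinite _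
    (inferInstanceAs (Finite {p : Set α × Set α // P.IsIdeal p.1 ∧ P.IsIdeal p.2 ∧ p.1 ⊆ p.2}))

/-- An ideal `I` of `P` and an ideal `J` of `P \ I` give the pair `I ⊆ I ∪ J`. -/
def pairOfLeft (P : DoublePoset α) (p : Σ I : P.Ideals, (P.restrict I.1ᶜ).Ideals) :
    IdealPairs P :=
  ⟨(p.1.1, p.1.1 ∪ Subtype.val '' p.2.1), p.1.2, by
      intro x hx y hxy
      by_cases hy : y ∈ p.1.1
      · exact Or.inl hy
      · rcases hx with hx | ⟨x, hx, rfl⟩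
        · exact absurd (p.1.2 _ hx _ hxy) hy
        · exact Or.inr ⟨⟨y, hy⟩, p.2.2 x hx ⟨y, hy⟩ hxy, rfl⟩, Set.subset_union_left⟩

/-- An ideal `I` of `P` and an ideal `J` of `I` give the pair `J ⊆ I`. -/
def pairOfRight (P : DoublePoset α) (p : Σ I : P.Ideals, (P.restrict I.1).Ideals) :
    IdealPairs P :=
  ⟨(Subtype.val '' p.2.1, p.1.1), by
      rintro _ ⟨x, hx, rfl⟩ y hxy
      exact ⟨⟨y, p.1.2 _ x.2 _ hxy⟩, p.2.2 x hx ⟨y, _⟩ hxy, rfl⟩, p.1.2, by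
      rintro _ ⟨x, hx, rfl⟩
      exact x.2⟩

theorem pairOfLeft_bijective (P : DoublePoset α) : Function.Bijective (pairOfLeft P) := by
  constructor
  · rintro ⟨⟨I, hI⟩, ⟨J, hJ⟩⟩ ⟨⟨I', hI'⟩, ⟨J', hJ'⟩⟩ h
    have h1 : I = I' := congrArg (fun p => p.1.1) h
    subst h1
    have h2 : I ∪ Subtype.val '' J = I ∪ Subtype.val '' J' := congrArg (fun p => p.1.2) h
    have h3 : J = J' := by
      ext x
      have := Set.ext_iff.1 h2 x.1
      have hx : x.1 ∉ I := x.2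
      simpa [hx] using this
    subst h3
    rfl
  · rintro ⟨⟨A, B⟩, hA, hB, hAB⟩
    refine ⟨⟨⟨A, hA⟩, ⟨Subtype.val ⁻¹' B, fun x hx y hxy => hB _ hx _ hxy⟩⟩,
      Subtype.ext (Prod.ext rfl ?_)⟩
    ext x
    have := @hAB x
    by_cases hx : x ∈ A <;> simp_all [pairOfLeft]

theorem pairOfRight_bijective (P : DoublePoset α) : Function.Bijective (pairOfRight P) := by
  constructor
  · rintro ⟨⟨I, hI⟩, ⟨J, hJ⟩⟩ ⟨⟨I', hI'⟩, ⟨J', hJ'⟩⟩ h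
    have h1 : I = I' := congrArg (fun p => p.1.2) h
    subst h1
    have h2 : Subtype.val '' J = Subtype.val '' J' := congrArg (fun p => p.1.1) h
    have h3 : J = J' := Subtype.val_injective.image_injective h2
    subst h3
    rfl
  · rintro ⟨⟨A, B⟩, hA, hB, hAB⟩
    refine ⟨⟨⟨B, hB⟩, ⟨Subtype.val ⁻¹' A, fun x hx y hxy => hA _ hx _ hxy⟩⟩,
      Subtype.ext (Prod.ext ?_ rfl)⟩
    change Subtype.val '' ((Subtype.val : B → α) ⁻¹' A) = A
    simpa using hAB

theorem left_coassoc (P : DoublePoset α) (h : cls P ∈ C.toSubmonoid) :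
    TensorProduct.assoc K _ _ _ ((comulHom K C).toLinearMap.rTensor _ (coprod K P h)) =
    ∑ p : IdealPairs P, elt K (P.restrict p.1.2ᶜ) (C.restrict_mem h _) ⊗ₜ[K]
      (elt K (P.restrict (p.1.2 \ p.1.1)) (C.restrict_mem h _) ⊗ₜ[K]
        elt K (P.restrict p.1.1) (C.restrict_mem h _)) := by
  simp only [coprod, map_sum, LinearMap.rTensor_tmul, AlgHom.toLinearMap_apply, comulHom_elt,
    TensorProduct.sum_tmul, TensorProduct.assoc_tmul]
  rw [← Fintype.sum_sigma']
  refine Fintype.sum_bijective _ (pairOfLeft_bijective P) _ _ ?_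
  rintro ⟨I, J⟩
  congr 1
  · refine elt_congr K _ _ (restrict_restrict_iso _ _ _ _ ?_)
    ext x; simp [pairOfLeft]
  · congr 1
    refine elt_congr K _ _ (restrict_restrict_iso _ _ _ _ ?_)
    ext x
    simp only [pairOfLeft, Set.mem_sdiff, Set.mem_union, Set.mem_image]
    constructor
    · rintro ⟨h1 | h1, h2⟩
      · exact absurd h1 h2
      · exact h1
    · rintro ⟨y, hy, rfl⟩
      exact ⟨Or.inr ⟨y, hy, rfl⟩, y.2⟩

theorem right_coassoc (P : DoublePoset α) (h : cls P ∈ C.toSubmonoid) :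
    (comulHom K C).toLinearMap.lTensor _ (coprod K P h) =
    ∑ p : IdealPairs P, elt K (P.restrict p.1.2ᶜ) (C.restrict_mem h _) ⊗ₜ[K]
      (elt K (P.restrict (p.1.2 \ p.1.1)) (C.restrict_mem h _) ⊗ₜ[K]
        elt K (P.restrict p.1.1) (C.restrict_mem h _)) := by
  simp only [coprod, map_sum, LinearMap.lTensor_tmul, AlgHom.toLinearMap_apply, comulHom_elt,
    TensorProduct.tmul_sum]
  rw [← Fintype.sum_sigma']
  refine Fintype.sum_bijective _ (pairOfRight_bijective P) _ _ ?_
  rintro ⟨I, J⟩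
  congr 2
  · refine elt_congr K _ _ (restrict_restrict_iso _ _ _ _ ?_)
    ext x; simp [pairOfRight]
  · refine elt_congr K _ _ (restrict_restrict_iso _ _ _ _ rfl)

theorem counit_left (P : DoublePoset α) (h : cls P ∈ C.toSubmonoid) :
    (counitHom K C).toLinearMap.rTensor _ (coprod K P h) = 1 ⊗ₜ[K] elt K P h := by
  simp only [coprod, map_sum, LinearMap.rTensor_tmul, AlgHom.toLinearMap_apply]
  rw [Finset.sum_eq_single_of_mem (show P.Ideals from ⟨Set.univ, fun _ _ _ _ => trivial⟩) (Finset.mem_univ _)]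
  · congr 1
    · rw [counitHom_elt, if_pos]
      simp
    · exact elt_congr K _ _ (restrict_univ_iso P)
  · intro I _ hI
    rw [counitHom_elt, if_neg, TensorProduct.zero_tmul]
    intro h0
    refine hI (Subtype.ext (Set.compl_empty_iff.1 ?_))
    rwa [Nat.card_coe_set_eq, Set.ncard_eq_zero] at h0

theorem counit_right (P : DoublePoset α) (h : cls P ∈ C.toSubmonoid) :
    (counitHom K C).toLinearMap.lTensor _ (coprod K P h) = elt K P h ⊗ₜ[K] 1 := by
  simp only [coprod, map_sum, LinearMap.lTensor_tmul, AlgHom.toLinearMap_apply]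
  rw [Finset.sum_eq_single_of_mem (show P.Ideals from ⟨∅, fun _ h => h.elim⟩) (Finset.mem_univ _)]
  · congr 1
    · refine elt_congr K _ _ (Iso.trans ?_ (restrict_univ_iso P))
      rw [Set.compl_empty]
      exact .refl _
    · rw [counitHom_elt, if_pos]
      simp
  · intro I _ hI
    rw [counitHom_elt, if_neg, TensorProduct.tmul_zero]
    intro h0
    refine hI (Subtype.ext ?_)
    rwa [Nat.card_coe_set_eq, Set.ncard_eq_zero] at h0

variable (C)

/-- The bialgebra structure. -/
noncomputable instance : Bialgebra K (HopfOf K C) :=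
  Bialgebra.ofAlgHom (comulHom K C) (counitHom K C)
    (algHom_ext' K fun n P hP => by
      have h1 := left_coassoc K P hP
      have h2 := right_coassoc K P hP
      rw [← comulHom_elt] at h1 h2
      exact h1.trans h2.symm)
    (algHom_ext' K fun n P hP => by
      have h1 := counit_left K P hP
      rw [← comulHom_elt] at h1
      exact h1)
    (algHom_ext' K fun n P hP => by
      have h1 := counit_right K P hP
      rw [← comulHom_elt] at h1
      exact h1)

variable {C}

theorem comul_elt (P : DoublePoset α) (h : cls P ∈ C.toSubmonoid) :
    Coalgebra.comul (R := K) (elt K P h) = ∑ I : P.Ideals,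
      elt K (P.restrict I.1ᶜ) (C.restrict_mem h _) ⊗ₜ[K]
        elt K (P.restrict I.1) (C.restrict_mem h _) :=
  comulHom_elt K P h

open Classical in
theorem counit_elt (P : DoublePoset α) (h : cls P ∈ C.toSubmonoid) :
    Coalgebra.counit (R := K) (elt K P h) = if Nat.card α = 0 then (1 : K) else 0 :=
  counitHom_elt K P h

/-! The antipode is the (locally finite) sum of the convolution powers of `1 - id`. -/

open WithConv in
theorem conv_elt (f g : WithConv (HopfOf K C →ₗ[K] HopfOf K C)) (P : DoublePoset α)
    (h : cls P ∈ C.toSubmonoid) :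
    (f * g) (elt K P h) = ∑ I : P.Ideals, f (elt K (P.restrict I.1ᶜ) (C.restrict_mem h _)) *
        g (elt K (P.restrict I.1) (C.restrict_mem h _)) := by
  rw [LinearMap.convMul_apply, comul_elt]
  simp

variable (C) in
/-- The map `1 - id` in the convolution algebra. -/
noncomputable def oneSubId : WithConv (HopfOf K C →ₗ[K] HopfOf K C) :=
  1 - WithConv.toConv LinearMap.id

theorem oneSubId_elt_of_card_eq_zero (P : DoublePoset α) (h : cls P ∈ C.toSubmonoid)
    (hα : Nat.card α = 0) : oneSubId K C (elt K P h) = 0 := by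
  rw [elt_eq_one K h hα]
  change (algebraMap K (HopfOf K C)) (Coalgebra.counit 1) - 1 = 0
  simp

theorem oneSubId_pow_elt (k : ℕ) : ∀ {α : Type} [Finite α] (P : DoublePoset α)
    (h : cls P ∈ C.toSubmonoid), Nat.card α < k → (oneSubId K C ^ k) (elt K P h) = 0 := by
  induction k with
  | zero => intro α _ P h hk; omega
  | succ k ih =>
    intro α _ P h hk
    rw [pow_succ', conv_elt]
    refine Finset.sum_eq_zero fun I _ => ?_
    by_cases h0 : Nat.card ↥(I.1ᶜ) = 0
    · rw [oneSubId_elt_of_card_eq_zero K _ _ h0, zero_mul]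
    · rw [ih, mul_zero]
      have := Set.ncard_add_ncard_compl I.1
      rw [Nat.card_coe_set_eq] at h0 ⊢
      omega

variable (C) in
/-- The partial sums of the geometric series. -/
noncomputable def geom (k : ℕ) : WithConv (HopfOf K C →ₗ[K] HopfOf K C) :=
  ∑ i ∈ Finset.range k, oneSubId K C ^ i

theorem geom_elt (P : DoublePoset α) (h : cls P ∈ C.toSubmonoid) (k : ℕ)
    (hk : Nat.card α < k) : geom K C k (elt K P h) = geom K C (Nat.card α + 1) (elt K P h) := by
  obtain ⟨m, rfl⟩ := Nat.exists_eq_add_of_lt hk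
  induction m with
  | zero => rfl
  | succ m ih =>
    have : geom K C (Nat.card α + (m + 1) + 1) =
      geom K C (Nat.card α + m + 1) + oneSubId K C ^ (Nat.card α + m + 1) :=
      Finset.sum_range_succ _ _
    rw [this]
    refine Eq.trans (b := geom K C (Nat.card α + m + 1) (elt K P h) +
      (oneSubId K C ^ (Nat.card α + m + 1)) (elt K P h)) rfl ?_
    rw [oneSubId_pow_elt K _ P h (by omega), add_zero, ih (by omega)]

variable (C) in
/-- The antipode. -/
noncomputable def antipodeMap : HopfOf K C →ₗ[K] HopfOf K C :=
  (MonoidAlgebra.basis C.toSubmonoid K).constr K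
    fun x => geom K C (x.1.card + 1) (of K x)

theorem antipodeMap_elt (P : DoublePoset α) (h : cls P ∈ C.toSubmonoid) (k : ℕ)
    (hk : Nat.card α < k) : antipodeMap K C (elt K P h) = geom K C k (elt K P h) := by
  rw [geom_elt K P h k hk, ← card_cls P]
  refine Eq.trans (congrArg (antipodeMap K C) ?_) 
    (Module.Basis.constr_basis (MonoidAlgebra.basis C.toSubmonoid K) K
      (fun x => geom K C (x.1.card + 1) (of K x)) ⟨cls P, h⟩)
  exact (MonoidAlgebra.basis_apply K _).symm

theorem geom_mul_id (k : ℕ) :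
    geom K C k * WithConv.toConv LinearMap.id = 1 - oneSubId K C ^ k := by
  have h : WithConv.toConv LinearMap.id = 1 - oneSubId K C := (sub_sub_cancel _ _).symm
  rw [h]
  exact geom_sum_mul_neg _ _

theorem id_mul_geom (k : ℕ) :
    WithConv.toConv LinearMap.id * geom K C k = 1 - oneSubId K C ^ k := by
  have h : WithConv.toConv LinearMap.id = 1 - oneSubId K C := (sub_sub_cancel _ _).symm
  rw [h]
  exact mul_neg_geom_sum _ _

theorem one_sub_pow_elt (P : DoublePoset α) (h : cls P ∈ C.toSubmonoid) :
    (1 - oneSubId K C ^ (Nat.card α + 1)) (elt K P h) =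
      algebraMap K _ (Coalgebra.counit (R := K) (elt K P h)) := by
  refine Eq.trans (b := algebraMap K _ (Coalgebra.counit (R := K) (elt K P h)) -
    (oneSubId K C ^ (Nat.card α + 1)) (elt K P h)) rfl ?_
  rw [oneSubId_pow_elt K _ P h (Nat.lt_succ_self _), sub_zero]

variable (C)

/-- The Hopf algebra structure. -/
noncomputable instance : HopfAlgebra K (HopfOf K C) where
  antipode := antipodeMap K C
  mul_antipode_rTensor_comul := linearMap_ext K fun n P hP => by
    refine Eq.trans ?_ (one_sub_pow_elt K P hP)
    rw [← geom_mul_id, conv_elt]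
    simp only [LinearMap.comp_apply, comul_elt, map_sum, LinearMap.rTensor_tmul,
      LinearMap.mul'_apply]
    refine Finset.sum_congr rfl fun I _ => ?_
    rw [antipodeMap_elt K _ _ (Nat.card (Fin n) + 1)
      (Nat.lt_succ_of_le (Finite.card_subtype_le _))]
    rfl
  mul_antipode_lTensor_comul := linearMap_ext K fun n P hP => by
    refine Eq.trans ?_ (one_sub_pow_elt K P hP)
    rw [← id_mul_geom, conv_elt]
    simp only [LinearMap.comp_apply, comul_elt, map_sum, LinearMap.lTensor_tmul,
      LinearMap.mul'_apply]
    refine Finset.sum_congr rfl fun I _ => ?_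
    rw [antipodeMap_elt K _ _ (Nat.card (Fin n) + 1)
      (Nat.lt_succ_of_le (Finite.card_subtype_le _))]
    rfl

/-- The homogeneous component of degree `n`: the span of the double posets of cardinality `n`. -/
noncomputable def degree (n : ℕ) : Submodule K (HopfOf K C) :=
  Submodule.span K {y | ∃ x : C.toSubmonoid, x.1.card = n ∧ y = of K x}

/-- The inclusion in the space generated by all double posets, as a morphism of algebras. -/
noncomputable def inclusionHom : HopfOf K C →ₐ[K] HopfOf K PosetFamily.all :=
  MonoidAlgebra.mapDomainAlgHom K K (M := C.toSubmonoid) (N := PosetFamily.all.toSubmonoid)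
    (Submonoid.inclusion le_top)

variable {C} in
theorem inclusionHom_elt (P : DoublePoset α) (h : cls P ∈ C.toSubmonoid) :
    inclusionHom K C (elt K P h) =
      elt K P (C := PosetFamily.all) trivial :=
  MonoidAlgebra.mapDomain_single

/-- The space generated by `C` is a Hopf subalgebra of the space generated by all double posets:
the inclusion is an injective morphism of bialgebras. -/
noncomputable def inclusion : HopfOf K C →ₐc[K] HopfOf K PosetFamily.all :=
  BialgHom.ofAlgHom (inclusionHom K C)
    (algHom_ext' K fun n P hP => by
      simp only [AlgHom.comp_apply, inclusionHom_elt]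
      exact (counit_elt K P _).trans (counit_elt K P _).symm)
    (algHom_ext' K fun n P hP => by
      simp only [AlgHom.comp_apply, inclusionHom_elt]
      refine (congrArg _ (comul_elt K P hP)).trans ((comul_elt K P _).trans ?_).symm
      simp [inclusionHom_elt])

theorem inclusion_injective : Function.Injective (inclusion K C) :=
  MonoidAlgebra.mapDomain_injective (Submonoid.inclusion_injective le_top)

end HopfOf

/-- The Hopf algebra of double posets. -/
abbrev HDP (K : Type*) [Field K] := HopfOf K PosetFamily.all

/-- The Hopf algebra of plane posets. -/
abbrev HPP (K : Type*) [Field K] := HopfOf K PosetFamily.plane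

/-- The Hopf algebra of WN posets. -/
abbrev HWNP (K : Type*) [Field K] := HopfOf K PosetFamily.wn

/-! ### Free algebras, cofree coalgebras, self-duality, primitive elements -/

universe u v

/-- `A` is isomorphic to a free associative unital algebra. -/
def IsFreeAlgebra (K : Type u) (A : Type v) [Field K] [Ring A] [Algebra K A] : Prop :=
  ∃ X : Type v, Nonempty (A ≃ₐ[K] FreeAlgebra K X)

/-- `L` is isomorphic to a free Lie algebra. -/
def IsFreeLieAlgebra (K : Type u) (L : Type v) [Field K] [LieRing L] [LieAlgebra K L] : Prop :=
  ∃ X : Type v, Nonempty (L ≃ₗ⁅K⁆ FreeLieAlgebra K X)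

/-- The tensor space `T(V)` of the vector space `V` with basis `X`: its basis is the set of the
words `x₁ ⊗ ⋯ ⊗ xₙ` in `X`. -/
def TensorCoalgebra (K : Type u) (X : Type v) [Field K] := List X →₀ K

namespace TensorCoalgebra

variable (K : Type u) (X : Type v) [Field K]

noncomputable instance : AddCommGroup (TensorCoalgebra K X) :=
  inferInstanceAs (AddCommGroup (List X →₀ K))

noncomputable instance : Module K (TensorCoalgebra K X) :=
  inferInstanceAs (Module K (List X →₀ K))

variable {X}

/-- The basis element given by a word. -/
noncomputable def word (w : List X) : TensorCoalgebra K X := Finsupp.single w 1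

variable (X) in
theorem linearMap_ext {M : Type*} [AddCommMonoid M] [Module K M]
    {f g : TensorCoalgebra K X →ₗ[K] M} (h : ∀ w, f (word K w) = g (word K w)) : f = g :=
  Finsupp.lhom_ext' fun w => LinearMap.ext_ring (h w)

variable (X) in
/-- The linear map with prescribed values on words. -/
noncomputable def lift {M : Type*} [AddCommMonoid M] [Module K M] (f : List X → M) :
    TensorCoalgebra K X →ₗ[K] M :=
  Finsupp.linearCombination K f

theorem lift_word {M : Type*} [AddCommMonoid M] [Module K M] (f : List X → M) (w : List X) :
    lift K X f (word K w) = f w := by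
  simp only [lift, word]
  exact (Finsupp.linearCombination_single K 1 w).trans (one_smul K _)

/-- The deconcatenation coproduct of a word. -/
noncomputable def deconc (w : List X) : TensorCoalgebra K X ⊗[K] TensorCoalgebra K X :=
  ∑ i ∈ Finset.range (w.length + 1), word K (w.take i) ⊗ₜ[K] word K (w.drop i)

open Classical in
/-- The tensor coalgebra: the coproduct is deconcatenation, the counit is the projection on the
constants. -/
noncomputable instance : Coalgebra K (TensorCoalgebra K X) where
  comul := lift K X (deconc K)
  counit := lift K X fun w => if w.length = 0 then 1 else 0
  coassoc := linearMap_ext K X fun w => by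
    simp only [LinearMap.comp_apply, lift_word, deconc, map_sum, LinearMap.rTensor_tmul,
      LinearMap.lTensor_tmul, TensorProduct.sum_tmul, TensorProduct.tmul_sum,
      LinearEquiv.coe_coe, TensorProduct.assoc_tmul]
    rw [Finset.sum_sigma', Finset.sum_sigma']
    refine Finset.sum_bij' (fun p _ => ⟨p.2, p.1 - p.2⟩) (fun p _ => ⟨p.1 + p.2, p.1⟩)
      ?_ ?_ ?_ ?_ ?_
    · rintro ⟨i, j⟩ h
      simp at h ⊢
      omega
    · rintro ⟨i, j⟩ h
      simp at h ⊢
      omega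
    · rintro ⟨i, j⟩ h
      simp at h ⊢
      omega
    · rintro ⟨i, j⟩ h
      simp at h ⊢
    · rintro ⟨i, j⟩ h
      simp at h
      have hji : j ≤ i := by omega
      simp only [List.take_take, List.drop_drop, List.drop_take, min_eq_left hji,
        Nat.add_sub_cancel' hji]
  rTensor_counit_comp_comul := linearMap_ext K X fun w => by
    simp only [LinearMap.comp_apply, lift_word, deconc, map_sum, LinearMap.rTensor_tmul]
    rw [Finset.sum_eq_single_of_mem 0 (by simp)]
    · simp
    · intro i hi h0
      simp at hi
      rw [if_neg, TensorProduct.zero_tmul]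
      simp only [List.length_take]
      omega
  lTensor_counit_comp_comul := linearMap_ext K X fun w => by
    simp only [LinearMap.comp_apply, lift_word, deconc, map_sum, LinearMap.lTensor_tmul]
    rw [Finset.sum_eq_single_of_mem w.length (by simp)]
    · simp
    · intro i hi h0
      simp at hi
      rw [if_neg, TensorProduct.tmul_zero]
      simp only [List.length_drop]
      omega

end TensorCoalgebra

/-- `C` is a cofree (conilpotent) coalgebra: it is isomorphic to the tensor coalgebra of a vector
space, with the deconcatenation coproduct. -/
def IsCofree (K : Type u) (C : Type v) [Field K] [AddCommGroup C] [Module K C] [Coalgebra K C] :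
    Prop :=
  ∃ X : Type v, Nonempty (C ≃ₗc[K] TensorCoalgebra K X)

section Dual

variable {K : Type u} {A : Type v} [Field K] [Ring A]

/-- The graded dual of a graded vector space: the linear forms that vanish on all but finitely
many homogeneous components. -/
def gradedDual [Module K A] (𝒜 : ℕ → Submodule K A) : Submodule K (Module.Dual K A) where
  carrier := {f | ∃ N, ∀ n, N ≤ n → ∀ x ∈ 𝒜 n, f x = 0}
  zero_mem' := ⟨0, fun _ _ _ _ => rfl⟩
  add_mem' := by
    rintro f g ⟨M, hM⟩ ⟨N, hN⟩
    refine ⟨max M N, fun n hn x hx => ?_⟩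
    simp [hM n (le_trans (le_max_left _ _) hn) x hx, hN n (le_trans (le_max_right _ _) hn) x hx]
  smul_mem' := by
    rintro c f ⟨N, hN⟩
    exact ⟨N, fun n hn x hx => by simp [hN n hn x hx]⟩

/-- The graded bialgebra `A` is self-dual: there is an isomorphism `φ` of graded bialgebras from
`A` onto its graded dual. The unit of the dual is the counit of `A`, its product is the transpose
of the coproduct of `A`, its counit is the evaluation at `1`, its coproduct is the transpose of the
product of `A`, and its component of degree `n` is formed by the linear forms that vanish on the
components of `A` of degree `m ≠ n`. -/
def IsSelfDual [Bialgebra K A] (𝒜 : ℕ → Submodule K A) : Prop :=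
  ∃ φ : A ≃ₗ[K] gradedDual 𝒜,
    (∀ m n, m ≠ n → ∀ x ∈ 𝒜 n, ∀ y ∈ 𝒜 m, (φ x).1 y = 0) ∧
    (φ 1).1 = Coalgebra.counit ∧
    (∀ x y, (φ (x * y)).1 =
      LinearMap.mul' K K ∘ₗ TensorProduct.map (φ x).1 (φ y).1 ∘ₗ Coalgebra.comul) ∧
    (∀ x, (φ x).1 1 = Coalgebra.counit x) ∧
    (∀ x y z, (φ x).1 (y * z) =
      LinearMap.mul' K K (TensorProduct.map
        ((Module.Dual.eval K A y) ∘ₗ (gradedDual 𝒜).subtype ∘ₗ φ.toLinearMap)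
        ((Module.Dual.eval K A z) ∘ₗ (gradedDual 𝒜).subtype ∘ₗ φ.toLinearMap)
        (Coalgebra.comul x)))

end Dual

attribute [local instance] LieRing.ofAssociativeRing

/-- The Lie algebra of primitive elements of a bialgebra, for the commutator bracket. -/
def primitives (K : Type u) (A : Type v) [Field K] [Ring A] [Bialgebra K A] :
    LieSubalgebra K A where
  carrier := {x | Coalgebra.comul (R := K) x = x ⊗ₜ[K] 1 + 1 ⊗ₜ[K] x}
  zero_mem' := by simp
  add_mem' := by
    intro x y hx hy
    simp only [Set.mem_ofPred_eq] at hx hy ⊢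
    rw [map_add, hx, hy, TensorProduct.add_tmul, TensorProduct.tmul_add]
    abel
  smul_mem' := by
    intro c x hx
    simp only [Set.mem_ofPred_eq] at hx ⊢
    rw [map_smul, hx, smul_add, TensorProduct.smul_tmul', TensorProduct.tmul_smul]
  lie_mem' := by
    intro x y hx hy
    simp only [Set.mem_ofPred_eq] at hx hy ⊢
    rw [Ring.lie_def, map_sub, Bialgebra.comul_mul, Bialgebra.comul_mul, hx, hy]
    simp only [mul_add, add_mul, Algebra.TensorProduct.tmul_mul_tmul, mul_one, one_mul,
      TensorProduct.sub_tmul, TensorProduct.tmul_sub]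
    abel

/-! ### Graded bialgebras with a free underlying algebra -/

/-! The three families enter only through two features. First, the monoid of isoclasses under
composition is free. A factorization of a double poset T is a subset A that precedes its complement,
and two such subsets are nested by antisymmetry of the second order. This is Levi's property, and
with the cardinality as degree it makes the monoid free on its atoms (`bijective_lift_atoms`). So H
is a connected graded bialgebra whose algebra is free on homogeneous generators, which is what
`FreeGrading` records. Second, each family is stable under the stacking of P below Q for the first
order. An ideal of the stack is either an ideal of Q, or Q together with an ideal of P; only Q
itself is counted twice. Hence stacking, with the same coproduct, is an infinitesimal bialgebra
product (`InfProduct`).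

Self-duality and cofreeness. The infinitesimal product yields a map e with values in the primitive
elements and with x = sum of r(x₁, e(x₂)) on the augmentation ideal (`conv_e`, `comul_e`). Suppose
that a graded form is a nondegenerate Hopf pairing in degrees below n. This formula gives every
linear form on the decomposable elements of degree n as the effect of the coproduct of some element
(`exists_star_eq`). Because the algebra is free, the form can be prescribed at will on the
generators of degree n; by the surjectivity just obtained and linear algebra
(`exists_injective_lift`) the choice can be made both compatible with the structure and
nondegenerate (`IsPairing.exists_succ`). In the limit this is a nondegenerate graded Hopf pairing of
H with itself, so H is isomorphic to its graded dual. The graded dual of a free algebra is a tensor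
coalgebra, so H is cofree. The argument works over any field.

Primitive elements in characteristic zero. The proof uses only `FreeGrading`. Choose homogeneous
primitive elements wᵢ spanning a complement of the primitive elements that lie in Prim(H)·H⁺, where
H⁺ is the augmentation ideal. A Cohn-type argument in the free algebra H shows that the wᵢ are right
independent, so they generate a free associative subalgebra. Since the free Lie algebra embeds in
the free associative algebra, the Lie map from the free Lie algebra on the wᵢ to Prim(H) is
injective. It is surjective as soon as the primitive elements in Prim(H)·H⁺ are sums of commutators.
Contracting the coproduct with forms that vanish on Prim(H)·H shows that such an element is a
combination of products of at least two primitive elements. The convolution square of the identity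
acts on products of k primitives by 2^k up to shorter products and commutators, but on a primitive
element by 2, which leaves only commutators. -/

/-- A structure of connected graded bialgebra on `H`, with finite-dimensional components, whose
underlying algebra is free on homogeneous generators indexed by `X`. -/
structure FreeGrading (K : Type u) (H : Type v) (X : Type*) [Field K] [Ring H]
    [Bialgebra K H] where
  /-- the basis of monomials -/
  basis : Module.Basis (FreeMonoid X) K H
  /-- the degree of a monomial -/
  deg : FreeMonoid X →* Multiplicative ℕ
  deg_of_pos : ∀ x, 0 < (deg (FreeMonoid.of x)).toAdd
  finite_deg : ∀ n, {w | (deg w).toAdd = n}.Finite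
  basis_one : basis 1 = 1
  basis_mul : ∀ u v, basis (u * v) = basis u * basis v
  counit_basis : ∀ w, w ≠ 1 → Coalgebra.counit (R := K) (basis w) = 0
  comul_basis : ∀ w, Coalgebra.comul (R := K) (basis w) ∈ Submodule.span K
    {t | ∃ u v, (deg u).toAdd + (deg v).toAdd = (deg w).toAdd ∧ t = basis u ⊗ₜ[K] basis v}

namespace FreeGrading

open Coalgebra

variable {K : Type u} {H : Type v} {X : Type*} [Field K] [Ring H] [Bialgebra K H]
  (F : FreeGrading K H X)

/-- The degree of a monomial, as a natural number. -/
def d (w : FreeMonoid X) : ℕ := (F.deg w).toAdd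

@[simp] theorem d_one : F.d 1 = 0 := by simp [d]

@[simp] theorem d_mul (u v : FreeMonoid X) : F.d (u * v) = F.d u + F.d v := by simp [d]

theorem d_of_pos (x : X) : 0 < F.d (FreeMonoid.of x) := F.deg_of_pos x

theorem d_eq_zero {w : FreeMonoid X} : F.d w = 0 ↔ w = 1 := by
  refine ⟨fun h => ?_, fun h => by simp [h]⟩
  induction w using FreeMonoid.casesOn with
  | one => rfl
  | of_mul x xs =>
    have := F.d_of_pos x
    rw [d_mul] at h
    omega

theorem d_pos {w : FreeMonoid X} : 0 < F.d w ↔ w ≠ 1 := by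
  rw [Nat.pos_iff_ne_zero, Ne, d_eq_zero]

/-- The homogeneous component of degree `n`. -/
def A (n : ℕ) : Submodule K H := Submodule.span K (F.basis '' {w | F.d w = n})

theorem basis_mem (w : FreeMonoid X) : F.basis w ∈ F.A (F.d w) :=
  Submodule.subset_span ⟨w, rfl, rfl⟩

theorem basis_mem' {w : FreeMonoid X} {n : ℕ} (h : F.d w = n) : F.basis w ∈ F.A n :=
  h ▸ F.basis_mem w

theorem A_induction {n : ℕ} {p : H → Prop} (hb : ∀ w, F.d w = n → p (F.basis w))
    (h0 : p 0) (ha : ∀ x y, p x → p y → p (x + y)) (hs : ∀ (c : K) x, p x → p (c • x))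
    {x : H} (hx : x ∈ F.A n) : p x := by
  refine Submodule.span_induction (p := fun x _ => p x) ?_ h0 (fun x y _ _ => ha x y)
    (fun c x _ => hs c x) hx
  rintro _ ⟨w, hw, rfl⟩
  exact hb w hw

/-- Two linear maps that agree on the monomials of degree `n` agree on the component of degree
`n`. -/
theorem eqOn_A {n : ℕ} {M : Type*} [AddCommGroup M] [Module K M] {f g : H →ₗ[K] M}
    (h : ∀ w, F.d w = n → f (F.basis w) = g (F.basis w)) {x : H} (hx : x ∈ F.A n) :
    f x = g x := by
  refine F.A_induction (p := fun x => f x = g x) h (by simp) (fun x y hx hy => by simp [hx, hy])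
    (fun c x hx => by simp [hx]) hx

instance (n : ℕ) : FiniteDimensional K (F.A n) :=
  FiniteDimensional.span_of_finite K ((F.finite_deg n).image _)

theorem one_mem : (1 : H) ∈ F.A 0 := F.basis_one ▸ F.basis_mem' F.d_one

theorem mul_mem {i j : ℕ} {x y : H} (hx : x ∈ F.A i) (hy : y ∈ F.A j) : x * y ∈ F.A (i + j) := by
  refine F.A_induction (p := fun x => x * y ∈ F.A (i + j)) (fun u hu => ?_) (by simp)
    (fun x z hx hz => by rw [add_mul]; exact add_mem hx hz)
    (fun c x hx => by rw [smul_mul_assoc]; exact Submodule.smul_mem _ _ hx) hx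
  refine F.A_induction (p := fun y => F.basis u * y ∈ F.A (i + j)) (fun v hv => ?_) (by simp)
    (fun x z hx hz => by rw [mul_add]; exact add_mem hx hz)
    (fun c x hx => by rw [mul_smul_comm]; exact Submodule.smul_mem _ _ hx) hy
  rw [← F.basis_mul]
  exact F.basis_mem' (by rw [d_mul, hu, hv])

theorem eq_algebraMap {x : H} (hx : x ∈ F.A 0) : x = algebraMap K H (counit x) := by
  refine F.A_induction (p := fun x => x = algebraMap K H (counit x)) (fun u hu => ?_) (by simp)
    (fun x z hx hz => by rw [map_add, map_add, ← hx, ← hz])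
    (fun c x hx => by
      rw [map_smul, smul_eq_mul, map_mul, ← hx, Algebra.smul_def]) hx
  rw [F.d_eq_zero.1 hu, F.basis_one]
  simp

theorem counit_eq_zero {n : ℕ} (hn : n ≠ 0) {x : H} (hx : x ∈ F.A n) :
    counit (R := K) x = 0 :=
  F.eqOn_A (f := counit) (g := 0) (fun w hw => F.counit_basis w fun h => hn (by simp [← hw, h])) hx

open Classical in
/-- The projection on the component of degree `n`. -/
noncomputable def proj (n : ℕ) : H →ₗ[K] H :=
  F.basis.constr K fun w => if F.d w = n then F.basis w else 0

open Classical in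
theorem proj_basis (n : ℕ) (w : FreeMonoid X) :
    F.proj n (F.basis w) = if F.d w = n then F.basis w else 0 := by
  rw [proj, Module.Basis.constr_basis]

theorem proj_of_mem {n : ℕ} {x : H} (hx : x ∈ F.A n) : F.proj n x = x :=
  F.eqOn_A (g := LinearMap.id) (fun w hw => by simp [proj_basis, hw]) hx

theorem proj_of_mem_ne {m n : ℕ} (h : m ≠ n) {x : H} (hx : x ∈ F.A m) : F.proj n x = 0 :=
  F.eqOn_A (g := 0) (fun w hw => by simp [proj_basis, hw, h]) hx

theorem hom_ext {M : Type*} [AddCommGroup M] [Module K M] {f g : H →ₗ[K] M}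
    (h : ∀ n, ∀ x ∈ F.A n, f x = g x) : f = g :=
  F.basis.ext fun w => h _ _ (F.basis_mem w)

theorem induction {p : H → Prop} (hb : ∀ w, p (F.basis w)) (h0 : p 0)
    (ha : ∀ x y, p x → p y → p (x + y)) (hs : ∀ (c : K) x, p x → p (c • x)) (x : H) : p x := by
  refine Submodule.span_induction (p := fun x _ => p x) ?_ h0 (fun x y _ _ => ha x y)
    (fun c x _ => hs c x) (F.basis.mem_span x)
  rintro _ ⟨w, rfl⟩
  exact hb w

theorem proj_mem (n : ℕ) (x : H) : F.proj n x ∈ F.A n := by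
  refine F.induction (p := fun x => F.proj n x ∈ F.A n) (fun w => ?_) (by simp)
    (fun x y hx hy => by rw [map_add]; exact add_mem hx hy)
    (fun c x hx => by rw [map_smul]; exact Submodule.smul_mem _ _ hx) x
  rw [proj_basis]
  split_ifs with h
  exacts [F.basis_mem' h, zero_mem _]

theorem exists_sum_proj (x : H) : ∃ N, ∀ M, N ≤ M → x = ∑ n ∈ Finset.range M, F.proj n x := by
  refine F.induction (p := fun x => ∃ N, ∀ M, N ≤ M → x = ∑ n ∈ Finset.range M, F.proj n x)
    (fun w => ⟨F.d w + 1, fun M hM => ?_⟩) ⟨0, by simp⟩ ?_ ?_ x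
  · rw [Finset.sum_eq_single_of_mem (F.d w) (by simp; omega)]
    · exact (F.proj_of_mem (F.basis_mem w)).symm
    · exact fun n _ hn => F.proj_of_mem_ne hn.symm (F.basis_mem w)
  · rintro x y ⟨N, hN⟩ ⟨M, hM⟩
    exact ⟨max N M, fun n hn => by
      simp only [map_add, Finset.sum_add_distrib]
      rw [← hN n (le_trans (le_max_left _ _) hn), ← hM n (le_trans (le_max_right _ _) hn)]⟩
  · rintro c x ⟨N, hN⟩
    exact ⟨N, fun n hn => by
      simp only [map_smul, ← Finset.smul_sum]
      rw [← hN n hn]⟩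

theorem eq_of_proj_eq {x y : H} (h : ∀ n, F.proj n x = F.proj n y) : x = y := by
  obtain ⟨N, hN⟩ := F.exists_sum_proj x
  obtain ⟨M, hM⟩ := F.exists_sum_proj y
  rw [hN _ (le_max_left N M), hM _ (le_max_right N M)]
  exact Finset.sum_congr rfl fun n _ => h n

/-! #### The graded coproduct -/

theorem comul_induction {n : ℕ} {p : H ⊗[K] H → Prop}
    (hb : ∀ u v, F.d u + F.d v = n → p (F.basis u ⊗ₜ F.basis v))
    (h0 : p 0) (ha : ∀ x y, p x → p y → p (x + y)) (hs : ∀ (c : K) x, p x → p (c • x))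
    {x : H} (hx : x ∈ F.A n) : p (comul x) := by
  refine F.A_induction (p := fun x => p (comul x)) (fun w hw => ?_) (by simpa)
    (fun x y hx hy => by rw [map_add]; exact ha _ _ hx hy)
    (fun c x hx => by rw [map_smul]; exact hs _ _ hx) hx
  refine Submodule.span_induction (p := fun x _ => p x) ?_ h0 (fun x y _ _ => ha x y)
    (fun c x _ => hs c x) (F.comul_basis w)
  rintro _ ⟨u, v, h, rfl⟩
  exact hb u v (h.trans hw)

/-- Two linear maps on the tensor square that agree on the tensors of degree `n` agree on the
coproduct of an element of degree `n`. -/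
theorem eqOn_comul {n : ℕ} {M : Type*} [AddCommGroup M] [Module K M] {f g : H ⊗[K] H →ₗ[K] M}
    (h : ∀ u v, F.d u + F.d v = n → f (F.basis u ⊗ₜ F.basis v) = g (F.basis u ⊗ₜ F.basis v))
    {x : H} (hx : x ∈ F.A n) : f (comul x) = g (comul x) :=
  F.comul_induction (p := fun x => f x = g x) h (by simp) (fun x y hx hy => by simp [hx, hy])
    (fun c x hx => by simp [hx]) hx

/-- A linear map on the tensor square that vanishes on the tensors of degree `n` whose right
factor has degree less than `n` only sees the term `1 ⊗ x` of the coproduct of `x`. -/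
theorem apply_comul_of_right {n : ℕ} {M : Type*} [AddCommGroup M] [Module K M]
    {f : H ⊗[K] H →ₗ[K] M}
    (h : ∀ u v, F.d u + F.d v = n → F.d v < n → f (F.basis u ⊗ₜ F.basis v) = 0)
    {x : H} (hx : x ∈ F.A n) : f (comul x) = f (1 ⊗ₜ x) := by
  -- Only tensors with left factor 1 survive under `f`, so replacing the left factor by its counit
  -- changes nothing; the counit axiom then collapses the coproduct.
  have h1 : f (comul x) = (f ∘ₗ (LinearMap.toSpanSingleton K H 1 ∘ₗ counit).rTensor H)
      (comul x) := by
    refine F.eqOn_comul (fun u v huv => ?_) hx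
    by_cases hu : u = 1
    · subst hu
      simp [F.basis_one]
    · rw [h u v huv (by have := F.d_pos.2 hu; omega)]
      simp [F.counit_basis u hu]
  rw [h1, LinearMap.comp_apply, LinearMap.rTensor_comp_apply, rTensor_counit_comul]
  simp

end FreeGrading

/-! ### Infinitesimal products -/

namespace FreeGrading

open Coalgebra

variable {K : Type u} {H : Type v} {X : Type*} [Field K] [Ring H] [Bialgebra K H]
  (F : FreeGrading K H X)

/-- A second graded unital product on `H`, that makes the coalgebra `H` an infinitesimal
bialgebra. -/
structure InfProduct where
  /-- the product -/
  r : H →ₗ[K] H →ₗ[K] H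
  one_left : ∀ x, r 1 x = x
  one_right : ∀ x, r x 1 = x
  mem : ∀ {i j : ℕ} {x y : H}, x ∈ F.A i → y ∈ F.A j → r x y ∈ F.A (i + j)
  comul_r : ∀ x y, comul (R := K) (r x y) =
    (r x).rTensor H (comul y) + (r.flip y).lTensor H (comul x) - x ⊗ₜ y

variable {F} (R : F.InfProduct)

namespace InfProduct

/-- The convolution of the identity and of `f`, for the second product. -/
noncomputable def conv (f : H →ₗ[K] H) : H →ₗ[K] H :=
  TensorProduct.lift R.r ∘ₗ f.lTensor H ∘ₗ comul

theorem conv_apply (f : H →ₗ[K] H) (x : H) :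
    R.conv f x = (TensorProduct.lift R.r ∘ₗ f.lTensor H) (comul x) := rfl

theorem conv_congr {n : ℕ} {f g : H →ₗ[K] H} (h : ∀ k ≤ n, ∀ x ∈ F.A k, f x = g x) {x : H}
    (hx : x ∈ F.A n) : R.conv f x = R.conv g x := by
  rw [conv_apply, conv_apply]
  refine F.eqOn_comul (fun u v huv => ?_) hx
  simp [h _ (by omega) _ (F.basis_mem v)]

/-- The difference of the two convolutions sees the right tensor factor only through `f - g`, which
vanishes below degree `n`; what remains is the term `1 ⊗ x`. Convolving with the identity is thus
unipotent in `f` for the degree. -/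
theorem conv_add_of_eqOn {n : ℕ} {f g : H →ₗ[K] H} (h : ∀ k < n, ∀ x ∈ F.A k, f x = g x) {x : H}
    (hx : x ∈ F.A n) : R.conv f x = R.conv g x + (f x - g x) := by
  have h1 : (TensorProduct.lift R.r ∘ₗ f.lTensor H - TensorProduct.lift R.r ∘ₗ g.lTensor H)
      (comul x) = (TensorProduct.lift R.r ∘ₗ f.lTensor H -
        TensorProduct.lift R.r ∘ₗ g.lTensor H) (1 ⊗ₜ x) := by
    refine F.apply_comul_of_right (fun u v huv hv => ?_) hx
    simp [h _ hv _ (F.basis_mem v)]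
  simp only [LinearMap.sub_apply, ← conv_apply] at h1
  simp only [LinearMap.comp_apply, LinearMap.lTensor_tmul, TensorProduct.lift.tmul,
    R.one_left] at h1
  rw [← h1]
  abel

theorem conv_mem {n : ℕ} {f : H →ₗ[K] H} (h : ∀ k ≤ n, ∀ x ∈ F.A k, f x ∈ F.A k) {x : H}
    (hx : x ∈ F.A n) : R.conv f x ∈ F.A n := by
  rw [conv_apply]
  refine F.comul_induction (p := fun t => (TensorProduct.lift R.r ∘ₗ f.lTensor H) t ∈ F.A n)
    (fun u v huv => ?_) (by simp) (fun x y hx hy => by rw [map_add]; exact add_mem hx hy)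
    (fun c x hx => by rw [map_smul]; exact Submodule.smul_mem _ _ hx) hx
  simp only [LinearMap.comp_apply, LinearMap.lTensor_tmul, TensorProduct.lift.tmul]
  rw [← huv]
  exact R.mem (F.basis_mem u) (h _ (by omega) _ (F.basis_mem v))

/-- The approximations, correct up to degree `n`, of the projection on the primitive elements. -/
noncomputable def approx (n : ℕ) : H →ₗ[K] H :=
  -- Successive correction for the equation `conv f = id - ηε`: the error is added to `f`, and each
  -- step settles one more degree because `conv f` is `f` plus terms that use `f` in lower degrees.
  n.rec 0 fun _ f => LinearMap.id - Algebra.linearMap K H ∘ₗ counit - R.conv f + f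

theorem approx_zero : R.approx 0 = 0 := rfl

theorem approx_succ (n : ℕ) : R.approx (n + 1) =
    LinearMap.id - Algebra.linearMap K H ∘ₗ counit - R.conv (R.approx n) + R.approx n := rfl

theorem approx_mem (n : ℕ) : ∀ k, ∀ x ∈ F.A k, R.approx n x ∈ F.A k := by
  induction n with
  | zero => intro k x _; simp [approx_zero]
  | succ n ih =>
    intro k x hx
    rw [approx_succ]
    refine add_mem (sub_mem (sub_mem hx ?_) (R.conv_mem (fun j _ => ih j) hx)) (ih k x hx)
    by_cases hk : k = 0
    · subst hk
      rw [LinearMap.comp_apply, Algebra.linearMap_apply, ← F.eq_algebraMap hx]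
      exact hx
    · rw [LinearMap.comp_apply, F.counit_eq_zero hk hx, map_zero]
      exact zero_mem _

/-- Both facts are proved together: stability of the approximations below degree `n + 1` lets
`conv_add_of_eqOn` compute the next convolution, and a zero error makes the next correction zero. -/
theorem approx_spec (n : ℕ) : ∀ k ≤ n, ∀ x ∈ F.A k,
    R.conv (R.approx n) x = x - algebraMap K H (counit x) ∧
    R.approx (n + 1) x = R.approx n x := by
  induction n with
  | zero =>
    intro k hk x hx
    obtain rfl : k = 0 := by omega
    have h := F.eq_algebraMap hx
    simp [approx_succ, approx_zero, conv, ← h]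
  | succ n ih =>
    intro k hk x hx
    have hconv : R.conv (R.approx (n + 1)) x = x - algebraMap K H (counit x) := by
      rw [R.conv_add_of_eqOn (g := R.approx n) (fun j hj y hy => (ih j (by omega) y hy).2) hx]
      simp [approx_succ]
    refine ⟨hconv, ?_⟩
    rw [approx_succ, LinearMap.add_apply, LinearMap.sub_apply, hconv]
    simp

theorem approx_eq {k n : ℕ} (h : k ≤ n) {x : H} (hx : x ∈ F.A k) :
    R.approx n x = R.approx k x := by
  induction n, h using Nat.le_induction with
  | base => rfl
  | succ n hn ih => rw [(R.approx_spec n k hn x hx).2, ih]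

/-- The projection on the primitive elements. -/
noncomputable def e : H →ₗ[K] H := F.basis.constr K fun w => R.approx (F.d w) (F.basis w)

theorem e_eq_approx {k n : ℕ} (h : k ≤ n) {x : H} (hx : x ∈ F.A k) : R.e x = R.approx n x := by
  rw [R.approx_eq h hx]
  refine F.eqOn_A (fun w hw => ?_) hx
  rw [e, Module.Basis.constr_basis, hw]

theorem e_mem {k : ℕ} {x : H} (hx : x ∈ F.A k) : R.e x ∈ F.A k := by
  rw [R.e_eq_approx le_rfl hx]
  exact R.approx_mem k k x hx

theorem e_of_mem_zero {x : H} (hx : x ∈ F.A 0) : R.e x = 0 := by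
  rw [R.e_eq_approx le_rfl hx, approx_zero, LinearMap.zero_apply]

/-- On the augmentation ideal every `x` is the sum of the `r x₁ (e x₂)`: elements are rebuilt, for
the second product, from primitive elements. All later uses of the infinitesimal product pass
through this identity and `comul_e`. -/
theorem conv_e : R.conv R.e = LinearMap.id - Algebra.linearMap K H ∘ₗ counit := by
  refine F.hom_ext fun n x hx => ?_
  rw [R.conv_congr (fun k hk y hy => R.e_eq_approx hk hy) hx, (R.approx_spec n n le_rfl x hx).1]
  simp

/-- In the infinitesimal relation the term `x ⊗ p` coming from `1 ⊗ p` cancels the correction `- x ⊗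
p`. -/
theorem comul_r_of_primitive {p : H} (hp : comul (R := K) p = p ⊗ₜ 1 + 1 ⊗ₜ p) (x : H) :
    comul (R := K) (R.r x p) = R.r x p ⊗ₜ 1 + (R.r.flip p).lTensor H (comul x) := by
  rw [R.comul_r, hp, map_add, LinearMap.rTensor_tmul, LinearMap.rTensor_tmul, R.one_right]
  abel

/-- The map `u ⊗ v ↦ u₁ ⊗ r u₂ (e v)`. -/
noncomputable def cut : H ⊗[K] H →ₗ[K] H ⊗[K] H :=
  (TensorProduct.lift R.r ∘ₗ R.e.lTensor H).lTensor H ∘ₗ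
    (TensorProduct.assoc K H H H).toLinearMap ∘ₗ comul.rTensor H

theorem cut_tmul (x y : H) : R.cut (x ⊗ₜ y) = (R.r.flip (R.e y)).lTensor H (comul x) := by
  simp only [cut, LinearMap.comp_apply, LinearMap.rTensor_tmul]
  induction (comul x : H ⊗[K] H) with
  | zero => simp
  | tmul a b => simp
  | add a b ha hb => simp only [TensorProduct.add_tmul, map_add, ha, hb]

/-- Coassociativity turns the left side into `conv e` applied to the right tensor factor, and `conv
e` is `id - ηε`. -/
theorem cut_comul (x : H) : R.cut (comul x) = comul x - x ⊗ₜ 1 := by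
  have h : R.cut (comul x) = (R.conv R.e).lTensor H (comul x) := by
    simp only [cut, LinearMap.comp_apply]
    rw [LinearEquiv.coe_coe, coassoc_apply, ← LinearMap.lTensor_comp_apply]
    rfl
  rw [h, R.conv_e, LinearMap.lTensor_sub, LinearMap.lTensor_id, LinearMap.lTensor_comp,
    LinearMap.sub_apply, LinearMap.comp_apply, lTensor_counit_comul]
  simp

/-- Induction on the degree. Once `e` is primitive-valued below degree `n`, comparing the coproduct
of `x = Σ r x₁ (e x₂)` with `cut_comul` cancels every term except those of `1 ⊗ x`, and these say
that `e x` is primitive. -/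
theorem comul_e (x : H) : comul (R := K) (R.e x) = R.e x ⊗ₜ 1 + 1 ⊗ₜ R.e x := by
  have key : ∀ n, ∀ x ∈ F.A n, comul (R := K) (R.e x) = R.e x ⊗ₜ 1 + 1 ⊗ₜ R.e x := by
    intro n
    induction n using Nat.strong_induction_on with
    | _ n ih =>
      intro x hx
      let ρ : H ⊗[K] H →ₗ[K] H := TensorProduct.lift R.r ∘ₗ R.e.lTensor H
      -- This map measures the failure of `comul_r_of_primitive` for `r u (e v)`; by induction it
      -- vanishes whenever `v` has degree less than `n`.
      have h := F.apply_comul_of_right (f := comul ∘ₗ ρ - (TensorProduct.mk K H H).flip 1 ∘ₗ ρ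
        - R.cut) (fun u v huv hv => by
          simp only [ρ, LinearMap.sub_apply, LinearMap.comp_apply, LinearMap.lTensor_tmul,
            TensorProduct.lift.tmul, R.cut_tmul,
            R.comul_r_of_primitive (ih _ hv _ (F.basis_mem v))]
          simp) hx
      have hρ : ρ (comul x) = x - algebraMap K H (counit x) :=
        LinearMap.congr_fun R.conv_e x
      simp only [LinearMap.sub_apply, LinearMap.comp_apply, hρ, R.cut_comul, R.cut_tmul] at h
      simp only [ρ, LinearMap.comp_apply, LinearMap.lTensor_tmul, TensorProduct.lift.tmul,
        R.one_left, Bialgebra.comul_one, Algebra.TensorProduct.one_def, map_sub,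
        Bialgebra.comul_algebraMap, LinearMap.flip_apply, TensorProduct.mk_apply,
        Algebra.TensorProduct.algebraMap_apply] at h
      have h2 : comul (R := K) (R.e x) - R.e x ⊗ₜ[K] 1 - 1 ⊗ₜ[K] R.e x = 0 := by
        rw [← h]; abel
      rw [sub_sub, sub_eq_zero] at h2
      exact h2
  refine LinearMap.congr_fun (f := comul ∘ₗ R.e) (g := (TensorProduct.mk K H H).flip 1 ∘ₗ R.e +
    TensorProduct.mk K H H 1 ∘ₗ R.e) (F.hom_ext fun n x hx => ?_) x
  exact key n x hx

end InfProduct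
end FreeGrading

/-! ### Extension of bilinear forms -/

section LinearAlgebra

variable {K : Type*} [Field K] {V U : Type*} [AddCommGroup V] [Module K V] [AddCommGroup U]
  [Module K U]

/-- A linear map that is injective on a subspace can be modified outside this subspace into an
injective map, if the dimensions allow it. -/
theorem exists_injective_eqOn [FiniteDimensional K V] [FiniteDimensional K U]
    (h : Module.finrank K V ≤ Module.finrank K U) (S : Submodule K V) (g : V →ₗ[K] U)
    (hg : ∀ x ∈ S, g x = 0 → x = 0) :
    ∃ f : V →ₗ[K] U, Function.Injective f ∧ ∀ x ∈ S, f x = g x := by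
  obtain ⟨T, hT⟩ := S.exists_isCompl
  obtain ⟨T', hT'⟩ := (S.map g).exists_isCompl
  have hS : Module.finrank K (S.map g) = Module.finrank K S := by
    have hinj : Function.Injective (g.domRestrict S) := by
      rw [← LinearMap.ker_eq_bot, LinearMap.ker_eq_bot']
      intro x hx
      exact Subtype.ext (hg x x.2 hx)
    rw [← LinearMap.finrank_range_of_inj hinj, LinearMap.range_domRestrict]
  have h1 := Submodule.finrank_add_eq_of_isCompl hT
  have h2 := Submodule.finrank_add_eq_of_isCompl hT'
  have h3 : Module.finrank K T ≤ Module.finrank K T' := by omega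
  obtain ⟨j, hj⟩ := (finrank_le_iff_exists_linearMap).1 h3
  refine ⟨LinearMap.ofIsCompl hT (g.domRestrict S) (T'.subtype ∘ₗ j), ?_, ?_⟩
  · rw [← LinearMap.ker_eq_bot, LinearMap.ker_eq_bot']
    intro x hx
    obtain ⟨s, t, rfl, -⟩ := Submodule.existsUnique_add_of_isCompl hT x
    rw [map_add, LinearMap.ofIsCompl_apply_left, LinearMap.ofIsCompl_apply_right] at hx
    have hd := Submodule.disjoint_def.1 hT'.disjoint (g s) ⟨s, s.2, rfl⟩ (by
      have : g s = - (j t : U) := eq_neg_of_add_eq_zero_left hx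
      rw [this]
      exact neg_mem (j t).2)
    have hs := hg s s.2 hd
    have ht : (j t : U) = 0 := by simpa [hd] using hx
    have : t = 0 := hj (Subtype.ext (by simpa using ht))
    simp [hs, this]
  · intro x hx
    exact LinearMap.ofIsCompl_apply_left hT ⟨x, hx⟩

/-- Extension of a linear map `ψ₀`, that is injective on a subspace `M`, to an injective lift of a
given surjective map `G` that is compatible with it. -/
theorem exists_injective_lift {D E : Type*} [AddCommGroup D] [Module K D] [AddCommGroup E]
    [Module K E] [FiniteDimensional K V] [FiniteDimensional K D]
    (hVD : Module.finrank K V = Module.finrank K D) (ρ : D →ₗ[K] E) (hρ : Function.Surjective ρ)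
    (M : Submodule K V) (ψ₀ : V →ₗ[K] D) (G : V →ₗ[K] E) (hG : Function.Surjective G)
    (h₀ : ∀ m ∈ M, ψ₀ m = 0 → m = 0) (h : ∀ m ∈ M, ρ (ψ₀ m) = G m) :
    ∃ ψ : V →ₗ[K] D, Function.Injective ψ ∧ (∀ m ∈ M, ψ m = ψ₀ m) ∧ ∀ v, ρ (ψ v) = G v := by
  obtain ⟨σ, hσ⟩ := ρ.exists_rightInverse_of_surjective (LinearMap.range_eq_top.2 hρ)
  obtain ⟨N, hN⟩ := M.exists_isCompl
  -- a first lift, perhaps not injective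
  let ψ₁ : V →ₗ[K] D := LinearMap.ofIsCompl hN (ψ₀.domRestrict M) ((σ ∘ₗ G).domRestrict N)
  have hψ₁ : ∀ m ∈ M, ψ₁ m = ψ₀ m := fun m hm => LinearMap.ofIsCompl_apply_left hN ⟨m, hm⟩
  have hψ₁G : ∀ v, ρ (ψ₁ v) = G v := by
    intro v
    obtain ⟨s, t, rfl, -⟩ := Submodule.existsUnique_add_of_isCompl hN v
    rw [map_add, map_add, map_add]
    congr 1
    · rw [hψ₁ s s.2]
      exact h s s.2
    · have : ψ₁ t = σ (G t) := LinearMap.ofIsCompl_apply_right hN t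
      rw [this]
      exact LinearMap.congr_fun hσ _
  have hdim : Module.finrank K (LinearMap.ker G) ≤ Module.finrank K (LinearMap.ker ρ) := by
    have h1 := LinearMap.finrank_range_add_finrank_ker G
    have h2 := LinearMap.finrank_range_add_finrank_ker ρ
    rw [LinearMap.range_eq_top.2 hG] at h1
    rw [LinearMap.range_eq_top.2 hρ] at h2
    omega
  have hmaps : ∀ x ∈ LinearMap.ker G, ψ₁ x ∈ LinearMap.ker ρ := by
    intro x hx
    rw [LinearMap.mem_ker, hψ₁G]
    exact hx
  let ψU : LinearMap.ker G →ₗ[K] LinearMap.ker ρ := LinearMap.restrict ψ₁ hmaps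
  have hψU : ∀ x ∈ M.comap (LinearMap.ker G).subtype, ψU x = 0 → x = 0 := fun x hx h0 =>
    Subtype.ext (h₀ x hx ((hψ₁ x hx).symm.trans (congrArg (LinearMap.ker ρ).subtype h0)))
  obtain ⟨f, hf, hfS⟩ := exists_injective_eqOn hdim (M.comap (LinearMap.ker G).subtype) ψU hψU
  -- the correction vanishes on `M ∩ ker G`, extend it by zero on `M`
  let q : LinearMap.ker G →ₗ[K] V ⧸ M := M.mkQ ∘ₗ (LinearMap.ker G).subtype
  have hq : LinearMap.ker q ≤ LinearMap.ker (f - ψU) := by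
    intro x hx
    have hx' : (x : V) ∈ M := by simpa [q] using hx
    have : f x = ψU x := hfS x hx'
    simp [this]
  obtain ⟨g, hg⟩ := LinearMap.exists_extend (p := LinearMap.range q)
    -- The correction factors through the image of `ker G` in `V ⧸ M`, and any extension from there
    -- to `V ⧸ M` vanishes on `M`.
    ((LinearMap.ker q).liftQ (f - ψU) hq ∘ₗ q.quotKerEquivRange.symm.toLinearMap)
  let θ : V →ₗ[K] LinearMap.ker ρ := g ∘ₗ M.mkQ
  have hθM : ∀ m ∈ M, θ m = 0 := fun m hm => by
    rw [LinearMap.comp_apply, Submodule.mkQ_apply, (Submodule.Quotient.mk_eq_zero M).2 hm, map_zero]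
  have hθU : ∀ u : LinearMap.ker G, θ u = f u - ψU u := fun u => by
    refine Eq.trans (LinearMap.congr_fun hg ⟨q u, u, rfl⟩) ?_
    have h2 : q.quotKerEquivRange.symm ⟨q u, u, rfl⟩ = (LinearMap.ker q).mkQ u := by
      rw [LinearEquiv.symm_apply_eq]
      rfl
    rw [LinearMap.comp_apply, LinearEquiv.coe_coe, h2]
    simp
  have hρθ : ∀ v, ρ (θ v) = 0 := fun v => (θ v).2
  refine ⟨ψ₁ + (LinearMap.ker ρ).subtype ∘ₗ θ, ?_, fun m hm => ?_, fun v => ?_⟩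
  · rw [← LinearMap.ker_eq_bot, LinearMap.ker_eq_bot']
    intro x hx
    have hx' : ψ₁ x + θ x = 0 := hx
    have hxU : x ∈ LinearMap.ker G := by
      have := congrArg ρ hx'
      rw [map_add, hρθ, add_zero, hψ₁G, map_zero] at this
      exact this
    have h1 : f ⟨x, hxU⟩ = 0 := by
      refine Subtype.ext ?_
      have h2 : (θ x : D) = f ⟨x, hxU⟩ - ψ₁ x :=
        congrArg (LinearMap.ker ρ).subtype (hθU ⟨x, hxU⟩)
      rw [h2] at hx'
      simpa using hx'
    exact congrArg Subtype.val (hf (h1.trans (map_zero f).symm))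
  · simp [hθM m hm, hψ₁ m hm]
  · simp [hψ₁G]

end LinearAlgebra

/-! ### Convolution of linear forms, and elements with prescribed coproduct -/

namespace FreeGrading

open Coalgebra

section Conv

variable {K : Type*} {H : Type*} [Field K] [Ring H] [Bialgebra K H]

/-- The convolution of two linear forms. -/
noncomputable def star (f g : H →ₗ[K] K) : H →ₗ[K] K :=
  (WithConv.toConv f * WithConv.toConv g).ofConv

theorem star_apply (f g : H →ₗ[K] K) (x : H) :
    star f g x = (LinearMap.mul' K K ∘ₗ TensorProduct.map f g) (comul x) := rfl

theorem star_assoc (f g h : H →ₗ[K] K) : star (star f g) h = star f (star g h) :=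
  congrArg WithConv.ofConv
    (mul_assoc (WithConv.toConv f) (WithConv.toConv g) (WithConv.toConv h))

theorem counit_star (f : H →ₗ[K] K) : star counit f = f :=
  congrArg WithConv.ofConv (one_mul (WithConv.toConv f))

theorem star_counit (f : H →ₗ[K] K) : star f counit = f :=
  congrArg WithConv.ofConv (mul_one (WithConv.toConv f))

/-- The contraction of the left factor of the coproduct with a linear form. -/
noncomputable def contract (f : H →ₗ[K] K) : H →ₗ[K] H :=
  (TensorProduct.lid K H).toLinearMap ∘ₗ f.rTensor H ∘ₗ comul

theorem contract_apply (f : H →ₗ[K] K) (x : H) :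
    contract f x = ((TensorProduct.lid K H).toLinearMap ∘ₗ f.rTensor H) (comul x) := rfl

theorem apply_contract (f g : H →ₗ[K] K) (x : H) : g (contract f x) = star f g x := by
  rw [contract_apply, star_apply, ← LinearMap.comp_apply]
  congr 1
  ext
  simp

theorem contract_lTensor (f : H →ₗ[K] K) (g : H →ₗ[K] H) (t : H ⊗[K] H) :
    TensorProduct.lid K H (f.rTensor H (g.lTensor H t)) =
      g (TensorProduct.lid K H (f.rTensor H t)) := by
  induction t with
  | zero => simp
  | tmul a b => simp
  | add a b ha hb => simp only [map_add, ha, hb]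

end Conv

variable {K : Type u} {H : Type v} {X : Type*} [Field K] [Ring H] [Bialgebra K H]
  (F : FreeGrading K H X)

/-- The monomials of degree at most `n`. -/
noncomputable def words (n : ℕ) : Finset (FreeMonoid X) :=
  ((Set.finite_Iic n).biUnion fun i _ => F.finite_deg i).toFinset

theorem mem_words {n : ℕ} {w : FreeMonoid X} : w ∈ F.words n ↔ F.d w ≤ n := by
  simp [words, d]

theorem star_congr {n : ℕ} {f g f' g' : H →ₗ[K] K}
    (h : ∀ u v, F.d u + F.d v = n →
      f (F.basis u) * g (F.basis v) = f' (F.basis u) * g' (F.basis v))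
    {x : H} (hx : x ∈ F.A n) : star f g x = star f' g' x := by
  rw [star_apply, star_apply]
  exact F.eqOn_comul (fun u v huv => by simpa using h u v huv) hx

theorem contract_mem {i n : ℕ} {f : H →ₗ[K] K} (hf : ∀ j, j ≠ i → ∀ x ∈ F.A j, f x = 0)
    {x : H} (hx : x ∈ F.A n) : contract f x ∈ F.A (n - i) := by
  rw [contract_apply]
  refine F.comul_induction (p := fun t => ((TensorProduct.lid K H).toLinearMap ∘ₗ f.rTensor H) t ∈
    F.A (n - i)) (fun u v huv => ?_) (by simp)
    (fun x y hx hy => by rw [map_add]; exact add_mem hx hy)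
    (fun c x hx => by rw [map_smul]; exact Submodule.smul_mem _ _ hx) hx
  simp only [LinearMap.comp_apply, LinearMap.rTensor_tmul, LinearEquiv.coe_coe,
    TensorProduct.lid_tmul]
  by_cases hu : F.d u = i
  · exact Submodule.smul_mem _ _ (F.basis_mem' (by omega))
  · rw [hf _ hu _ (F.basis_mem u), zero_smul]
    exact zero_mem _

/-- A linear form on the component of degree `n` is represented by an element, for a bilinear form
that is nondegenerate in degree `n`. -/
theorem exists_representing {n : ℕ} (β : H →ₗ[K] H →ₗ[K] K)
    (h : ∀ x ∈ F.A n, (∀ y ∈ F.A n, β y x = 0) → x = 0) (l : H →ₗ[K] K) :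
    ∃ q ∈ F.A n, ∀ y ∈ F.A n, β y q = l y := by
  let B : F.A n →ₗ[K] Module.Dual K (F.A n) :=
    (β.domRestrict₁₂ (F.A n) (F.A n)).flip
  have hB : Function.Injective B := by
    rw [← LinearMap.ker_eq_bot, LinearMap.ker_eq_bot']
    intro x hx
    exact Subtype.ext (h x x.2 fun y hy => LinearMap.congr_fun hx ⟨y, hy⟩)
  have hB' : Function.Surjective B :=
    (LinearMap.injective_iff_surjective_of_finrank_eq_finrank
      (Subspace.dual_finrank_eq (K := K) (V := F.A n)).symm).1 hB
  obtain ⟨q, hq⟩ := hB' (l ∘ₗ (F.A n).subtype)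
  exact ⟨q, q.2, fun y hy => LinearMap.congr_fun hq ⟨y, hy⟩⟩

/-- The components are finite-dimensional, so nondegeneracy on one side already represents every
linear form, and linear forms separate points. -/
theorem left_nondegenerate {n : ℕ} (β : H →ₗ[K] H →ₗ[K] K)
    (h : ∀ x ∈ F.A n, (∀ y ∈ F.A n, β y x = 0) → x = 0) :
    ∀ x ∈ F.A n, (∀ y ∈ F.A n, β x y = 0) → x = 0 := by
  intro x hx hxy
  refine (Module.forall_dual_apply_eq_zero_iff K x).1 fun l => ?_
  obtain ⟨q, hq, h⟩ := F.exists_representing β h l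
  rw [← h x hx]
  exact hxy q hq

variable {F} in
open Classical in
/-- If a bilinear form is nondegenerate in degrees less than `n`, and its product in the first
variable is there dual to the coproduct, then every linear form on the decomposable elements of
degree `n` is given by the coproduct of an element. -/
theorem exists_star_eq (R : F.InfProduct) (β : H →ₗ[K] H →ₗ[K] K) {n : ℕ}
    (hg : ∀ i j, i ≠ j → ∀ x ∈ F.A i, ∀ y ∈ F.A j, β x y = 0)
    (hm : ∀ k < n, ∀ z ∈ F.A k, ∀ a b, β (a * b) z = star (β a) (β b) z)
    (hnd : ∀ k < n, ∀ x ∈ F.A k, (∀ y ∈ F.A k, β y x = 0) → x = 0) (l : H →ₗ[K] K) :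
    ∃ z ∈ F.A n, ∀ a b, a ≠ 1 → b ≠ 1 → F.d a + F.d b = n →
      star (β (F.basis a)) (β (F.basis b)) z = l (F.basis (a * b)) := by
  -- equality of elements of the same degree, tested on monomials
  have hext : ∀ k < n, ∀ x ∈ F.A k, ∀ y ∈ F.A k,
      (∀ u, F.d u = k → β (F.basis u) x = β (F.basis u) y) → x = y := by
    intro k hk x hx y hy h
    refine sub_eq_zero.1 (hnd k hk _ (sub_mem hx hy) fun z hz => ?_)
    rw [map_sub, sub_eq_zero]
    exact F.eqOn_A (f := β.flip x) (g := β.flip y) h hz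
  have hv : ∀ w, ∃ v ∈ F.A (F.d w), F.d w < n →
      ∀ u, β (F.basis u) v = if u = w then 1 else 0 := by
    intro w
    by_cases hw : F.d w < n
    · obtain ⟨v, hv, h⟩ := F.exists_representing β (hnd _ hw) (F.basis.coord w)
      refine ⟨v, hv, fun _ u => ?_⟩
      by_cases hu : F.d u = F.d w
      · rw [h _ (F.basis_mem' hu)]
        simp [Finsupp.single_apply]
      · rw [hg _ _ hu _ (F.basis_mem u) _ hv, if_neg (ne_of_apply_ne F.d hu)]
    · exact ⟨0, zero_mem _, fun h => absurd h hw⟩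
  choose v hvA hv using hv
  -- `q a` represents the form `y ↦ l (a y)`; the value 0 for `a = 1` or for a degree greater than
  -- `n` is never used.
  have hq : ∀ a, ∃ q ∈ F.A (n - F.d a), a ≠ 1 → F.d a ≤ n →
      ∀ y ∈ F.A (n - F.d a), β y q = l (F.basis a * y) := by
    intro a
    by_cases ha : a ≠ 1 ∧ F.d a ≤ n
    · have := F.d_pos.2 ha.1
      obtain ⟨q, hq, h⟩ := F.exists_representing β (hnd (n - F.d a) (by omega))
        (l ∘ₗ LinearMap.mulLeft K (F.basis a))
      exact ⟨q, hq, fun _ _ y hy => h y hy⟩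
    · exact ⟨0, zero_mem _, fun h1 h2 => absurd ⟨h1, h2⟩ ha⟩
  choose q hqA hq using hq
  -- the element
  let S : Finset (FreeMonoid X) := (F.words n).filter fun w => w ≠ 1 ∧ F.d w < n
  have hterm : ∀ w ∈ S, R.r (v w) (R.e (q w)) ∈ F.A n := by
    intro w hw
    simp only [S, Finset.mem_filter, mem_words] at hw
    have := R.mem (hvA w) (R.e_mem (hqA w))
    rwa [Nat.add_sub_cancel' hw.1] at this
  refine ⟨∑ w ∈ S, R.r (v w) (R.e (q w)), sum_mem hterm, fun a b ha hb hab => ?_⟩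
  have hda := F.d_pos.2 ha
  have hdb := F.d_pos.2 hb
  have hβa : ∀ j, j ≠ F.d a → ∀ x ∈ F.A j, β (F.basis a) x = 0 :=
    fun j hj x hx => hg _ _ hj.symm _ (F.basis_mem a) _ hx
  have hβ : ∀ u j, j ≠ F.d u → ∀ x ∈ F.A j, β (F.basis u) x = 0 :=
    fun u j hj x hx => hg _ _ hj.symm _ (F.basis_mem u) _ hx
  -- contraction of a term
  have h1 : ∀ w ∈ S, contract (β (F.basis a)) (R.r (v w) (R.e (q w))) =
      R.r (contract (β (F.basis a)) (v w)) (R.e (q w)) := by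
    intro w hw
    rw [contract_apply, R.comul_r_of_primitive (R.comul_e _), map_add]
    simp only [LinearMap.comp_apply, LinearMap.rTensor_tmul, LinearEquiv.coe_coe,
      TensorProduct.lid_tmul]
    -- As `e (q w)` is primitive, the only extra term of the coproduct is `r (v w) (e (q w)) ⊗ 1`;
    -- its left factor has degree `n`, greater than that of `a`, and is killed.
    rw [hβa n (by omega) _ (hterm w hw), zero_smul, zero_add, contract_apply,
      contract_lTensor, LinearMap.flip_apply]
    rfl
  -- contraction of the dual basis
  have h2 : ∀ w ∈ S, contract (β (F.basis a)) (v w) =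
      ∑ u ∈ F.words (n - F.d a), (if a * u = w then (1 : K) else 0) • v u := by
    intro w hw
    simp only [S, Finset.mem_filter, mem_words] at hw
    have hmem : ∀ u ∈ F.words (n - F.d a), (if a * u = w then (1 : K) else 0) • v u ∈
        F.A (F.d w - F.d a) := by
      intro u _
      split_ifs with h
      · rw [← h, F.d_mul, Nat.add_sub_cancel_left]
        exact Submodule.smul_mem _ _ (hvA u)
      · rw [zero_smul]
        exact zero_mem _
    refine hext (F.d w - F.d a) (by omega) _ (F.contract_mem hβa (hvA w)) _ (sum_mem hmem)
      fun u hu => ?_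
    rw [apply_contract, ← hm _ hw.2.2 _ (hvA w), ← F.basis_mul, hv w hw.2.2, map_sum]
    rw [Finset.sum_eq_single_of_mem u (F.mem_words.2 (by omega))]
    · rw [map_smul, hv u (by omega), if_pos rfl, smul_eq_mul, mul_one]
    · intro u' hu' hne
      rw [F.mem_words] at hu'
      rw [map_smul, hv u' (by omega), if_neg hne.symm, smul_zero]
  -- contraction of `q a`
  have h3 : ∀ u ∈ F.words (n - F.d a), contract (β (F.basis u)) (q a) = q (a * u) := by
    intro u hu
    rw [F.mem_words] at hu
    have hau : a * u ≠ 1 := F.d_pos.1 (by rw [F.d_mul]; omega)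
    have hqau := hqA (a * u)
    rw [F.d_mul, ← Nat.sub_sub] at hqau
    refine hext (n - F.d a - F.d u) (by omega) _ (F.contract_mem (hβ u) (hqA a)) _ hqau
      fun w hw => ?_
    rw [apply_contract, ← hm _ (by omega) _ (hqA a), ← F.basis_mul,
      hq a ha (by omega) _ (F.basis_mem' (by rw [F.d_mul]; omega)),
      hq (a * u) hau (by rw [F.d_mul]; omega) _ (F.basis_mem' (by rw [F.d_mul]; omega)),
      ← F.basis_mul, ← F.basis_mul, mul_assoc]
  have h4 : q a = ∑ u ∈ F.words (n - F.d a), R.r (v u) (R.e (q (a * u))) := by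
    let ρ : H ⊗[K] H →ₗ[K] H := TensorProduct.lift R.r ∘ₗ R.e.lTensor H
    -- The resolution of the identity by the dual family; inserted in the left tensor factor, it
    -- makes the contractions of `q a` by monomials appear.
    let π : H →ₗ[K] H := ∑ u ∈ F.words (n - F.d a), (β (F.basis u)).smulRight (v u)
    have hπ : ∀ w, F.d w ≤ n - F.d a → π (F.basis w) = F.basis w := by
      intro w hw
      simp only [π, LinearMap.sum_apply, LinearMap.smulRight_apply]
      have hmem : ∀ u ∈ F.words (n - F.d a), β (F.basis u) (F.basis w) • v u ∈ F.A (F.d w) := by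
        intro u _
        by_cases hu : F.d w = F.d u
        · rw [hu]
          exact Submodule.smul_mem _ _ (hvA u)
        · rw [hβ u _ hu _ (F.basis_mem w), zero_smul]
          exact zero_mem _
      refine hext (F.d w) (by omega) _ (sum_mem hmem) _ (F.basis_mem w) fun u hu => ?_
      rw [map_sum, Finset.sum_eq_single_of_mem u (F.mem_words.2 (by omega))]
      · rw [map_smul, hv u (by omega), if_pos rfl, smul_eq_mul, mul_one]
      · intro u' hu' hne
        rw [F.mem_words] at hu'
        rw [map_smul, hv u' (by omega), if_neg hne.symm, smul_zero]
    have e1 : q a = ρ (comul (q a)) := by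
      have := LinearMap.congr_fun R.conv_e (q a)
      rw [LinearMap.sub_apply, LinearMap.comp_apply, F.counit_eq_zero (by omega) (hqA a), map_zero,
        sub_zero] at this
      exact this.symm
    have e2 : ρ (comul (q a)) = (ρ ∘ₗ π.rTensor H) (comul (q a)) := by
      refine F.eqOn_comul (fun u w huw => ?_) (hqA a)
      exact congrArg (fun y => ρ (y ⊗ₜ F.basis w)) (hπ u (by omega)).symm
    have e3 : ∀ t, (ρ ∘ₗ π.rTensor H) t = ∑ u ∈ F.words (n - F.d a),
        R.r (v u) (R.e (TensorProduct.lid K H ((β (F.basis u)).rTensor H t))) := by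
      intro t
      induction t with
      | zero => simp
      | tmul x y => simp [ρ, π]
      | add x y hx hy => simp only [map_add, hx, hy, Finset.sum_add_distrib]
    refine e1.trans (e2.trans ((e3 _).trans (Finset.sum_congr rfl fun u hu => ?_)))
    rw [← h3 u hu]
    rfl
  rw [← apply_contract, map_sum, Finset.sum_congr rfl h1,
    Finset.sum_congr rfl fun w hw => by rw [h2 w hw], F.basis_mul,
    ← hq a ha (by omega) _ (F.basis_mem' (by omega)), h4]
  simp only [map_sum, map_smul, LinearMap.sum_apply, LinearMap.smul_apply]
  rw [Finset.sum_comm]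
  refine Finset.sum_congr rfl fun u hu => ?_
  rw [F.mem_words] at hu
  by_cases hau : F.d (a * u) < n
  · rw [Finset.sum_eq_single_of_mem (a * u)]
    · rw [if_pos rfl, one_smul]
    · simp only [S, Finset.mem_filter, mem_words]
      exact ⟨hau.le, F.d_pos.1 (by rw [F.d_mul]; omega), hau⟩
    · intro w _ hw
      rw [if_neg hw.symm, zero_smul]
  -- The words `a u` of full degree `n` are missing from `S`, but they contribute nothing because
  -- `e` kills degree 0.
  · have h0 : R.e (q (a * u)) = 0 := R.e_of_mem_zero (by
      have := hqA (a * u)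
      rwa [Nat.sub_eq_zero_of_le (by omega)] at this)
    rw [h0, map_zero, map_zero]
    refine Finset.sum_eq_zero fun w hw => ?_
    simp only [S, Finset.mem_filter] at hw
    rw [if_neg (by rintro rfl; exact hau hw.2.2), zero_smul]

end FreeGrading

/-! ### Hopf pairings of a free graded bialgebra with itself -/

namespace FreeGrading

open Coalgebra

section Form

variable {K : Type*} {H : Type*} [Field K] [Ring H] [Bialgebra K H]

/-- The bilinear form given by a morphism to the convolution algebra of linear forms. -/
noncomputable def form (φ : H →ₐ[K] WithConv (H →ₗ[K] K)) : H →ₗ[K] H →ₗ[K] K :=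
  (WithConv.linearEquiv K (H →ₗ[K] K)).toLinearMap ∘ₗ φ.toLinearMap

theorem form_apply (φ : H →ₐ[K] WithConv (H →ₗ[K] K)) (x : H) : form φ x = (φ x).ofConv := rfl

theorem form_mul (φ : H →ₐ[K] WithConv (H →ₗ[K] K)) (x y : H) :
    form φ (x * y) = star (form φ x) (form φ y) := by
  rw [form_apply, map_mul]
  rfl

theorem form_one (φ : H →ₐ[K] WithConv (H →ₗ[K] K)) : form φ 1 = counit := by
  rw [form_apply, map_one]
  rfl

/-- The form on the tensor square deduced from a form. -/
noncomputable def formSq (β : H →ₗ[K] H →ₗ[K] K) : H ⊗[K] H →ₗ[K] H ⊗[K] H →ₗ[K] K :=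
  (LinearMap.llcomp K (H ⊗[K] H) (K ⊗[K] K) K (LinearMap.mul' K K)) ∘ₗ
    TensorProduct.homTensorHomMap (.id K) H H K K ∘ₗ TensorProduct.map β β

theorem formSq_tmul (β : H →ₗ[K] H →ₗ[K] K) (a b : H) :
    formSq β (a ⊗ₜ b) = LinearMap.mul' K K ∘ₗ TensorProduct.map (β a) (β b) := by
  ext
  simp [formSq]

theorem formSq_apply (β : H →ₗ[K] H →ₗ[K] K) (t : H ⊗[K] H) (y z : H) :
    formSq β t (y ⊗ₜ z) =
      (LinearMap.mul' K K ∘ₗ TensorProduct.map (β.flip y) (β.flip z)) t := by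
  induction t with
  | zero => simp
  | tmul a b => simp [formSq_tmul]
  | add a b ha hb => rw [map_add, map_add, LinearMap.add_apply, ha, hb]

theorem star_tmul (f g f' g' : H →ₗ[K] K) :
    star (LinearMap.mul' K K ∘ₗ TensorProduct.map f g)
      (LinearMap.mul' K K ∘ₗ TensorProduct.map f' g') =
    LinearMap.mul' K K ∘ₗ TensorProduct.map (star f f') (star g g') := by
  have h := LinearMap.algHom_comp_convMul_distrib (Algebra.TensorProduct.lmul' K (S := K))
    (WithConv.toConv (TensorProduct.map f g)) (WithConv.toConv (TensorProduct.map f' g'))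
  have h2 := TensorProduct.map_convMul_map (f := WithConv.toConv f) (h := WithConv.toConv f')
    (g := WithConv.toConv g) (k := WithConv.toConv g')
  have h3 := congrArg (fun F => (Algebra.TensorProduct.lmul' K (S := K)).toLinearMap ∘ₗ
    WithConv.ofConv F) h2
  exact h.symm.trans h3

/-- Multiplicativity in the first variable passes to the tensor square, whose coalgebra structure is
the product one. It is applied to the coproducts of two elements. -/
theorem formSq_mul {β : H →ₗ[K] H →ₗ[K] K} (hβ : ∀ x y, β (x * y) = star (β x) (β y))
    (s t : H ⊗[K] H) : formSq β (s * t) = star (formSq β s) (formSq β t) := by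
  have hl : ∀ f : H ⊗[K] H →ₗ[K] K, star 0 f = 0 := fun f =>
    congrArg WithConv.ofConv (zero_mul (WithConv.toConv f))
  have hr : ∀ f : H ⊗[K] H →ₗ[K] K, star f 0 = 0 := fun f =>
    congrArg WithConv.ofConv (mul_zero (WithConv.toConv f))
  have hla : ∀ f g h : H ⊗[K] H →ₗ[K] K, star (f + g) h = star f h + star g h := fun f g h =>
    congrArg WithConv.ofConv (add_mul (WithConv.toConv f) (WithConv.toConv g) (WithConv.toConv h))
  have hra : ∀ f g h : H ⊗[K] H →ₗ[K] K, star f (g + h) = star f g + star f h := fun f g h =>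
    congrArg WithConv.ofConv (mul_add (WithConv.toConv f) (WithConv.toConv g) (WithConv.toConv h))
  induction s with
  | zero => rw [zero_mul, map_zero, hl]
  | add a b ha hb => rw [add_mul, map_add, ha, hb, map_add, hla]
  | tmul a b =>
    induction t with
    | zero => rw [mul_zero, map_zero, hr]
    | add a b ha hb => rw [mul_add, map_add, ha, hb, map_add, hra]
    | tmul c d =>
      rw [Algebra.TensorProduct.tmul_mul_tmul, formSq_tmul, formSq_tmul, formSq_tmul, star_tmul,
        hβ, hβ]

/-- The compatibility of the form with the product in the second variable is stable by product
in the first variable. -/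
theorem form_mul_right_of_mul (φ : H →ₐ[K] WithConv (H →ₗ[K] K)) {x x' : H}
    (h : ∀ y z, form φ x (y * z) = star ((form φ).flip y) ((form φ).flip z) x)
    (h' : ∀ y z, form φ x' (y * z) = star ((form φ).flip y) ((form φ).flip z) x') (y z : H) :
    form φ (x * x') (y * z) = star ((form φ).flip y) ((form φ).flip z) (x * x') := by
  have key : ∀ x : H, (∀ y z, form φ x (y * z) = star ((form φ).flip y) ((form φ).flip z) x) →
      form φ x ∘ₗ LinearMap.mul' K H = formSq (form φ) (comul x) := by
    intro x h
    ext y z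
    simp only [TensorProduct.AlgebraTensorModule.curry_apply, LinearMap.restrictScalars_self,
      TensorProduct.curry_apply, LinearMap.comp_apply, LinearMap.mul'_apply]
    rw [h, formSq_apply]
    rfl
  -- Both sides are multiplicative in `x`: the left one because the product of `H` is a coalgebra
  -- morphism, the right one because its coproduct is an algebra morphism.
  have h1 : form φ (x * x') ∘ₗ LinearMap.mul' K H = formSq (form φ) (comul (x * x')) := by
    rw [Bialgebra.comul_mul, formSq_mul (form_mul φ), ← key x h, ← key x' h', form_mul]
    exact LinearMap.convMul_comp_coalgHom_distrib (WithConv.toConv (form φ x))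
      (WithConv.toConv (form φ x')) (Bialgebra.mulCoalgHom K H)
  have h2 := LinearMap.congr_fun h1 (y ⊗ₜ z)
  rw [formSq_apply] at h2
  refine Eq.trans ?_ h2
  simp

end Form

variable {K : Type u} {H : Type v} {X : Type*} [Field K] [Ring H] [Bialgebra K H]
  (F : FreeGrading K H X)

/-- The morphism of algebras with prescribed values on the generators. -/
noncomputable def lift {B : Type*} [Ring B] [Algebra K B] (f : X → B) : H →ₐ[K] B :=
  AlgHom.ofLinearMap (F.basis.constr K (FreeMonoid.lift f))
    (by rw [← F.basis_one, Module.Basis.constr_basis, map_one])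
    (by
      have : (LinearMap.mul K H).compr₂ (F.basis.constr K (FreeMonoid.lift f)) =
          (LinearMap.mul K B).compl₁₂ (F.basis.constr K (FreeMonoid.lift f))
            (F.basis.constr K (FreeMonoid.lift f)) := by
        refine F.basis.ext fun u => F.basis.ext fun v => ?_
        simp [← F.basis_mul, Module.Basis.constr_basis]
      exact fun x y => LinearMap.congr_fun₂ this x y)

theorem lift_basis {B : Type*} [Ring B] [Algebra K B] (f : X → B) (w : FreeMonoid X) :
    F.lift f (F.basis w) = FreeMonoid.lift f w :=
  Module.Basis.constr_basis F.basis K (FreeMonoid.lift f) w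

theorem lift_basis_of {B : Type*} [Ring B] [Algebra K B] (f : X → B) (x : X) :
    F.lift f (F.basis (FreeMonoid.of x)) = f x := by
  rw [lift_basis, FreeMonoid.lift_eval_of]

/-- Two morphisms of algebras that agree on the generators of degree at most `n` agree in
degrees at most `n`. -/
theorem algHom_eqOn {B : Type*} [Ring B] [Algebra K B] {φ ψ : H →ₐ[K] B} {n : ℕ}
    (h : ∀ x, F.d (FreeMonoid.of x) ≤ n →
      φ (F.basis (FreeMonoid.of x)) = ψ (F.basis (FreeMonoid.of x)))
    {k : ℕ} (hk : k ≤ n) {x : H} (hx : x ∈ F.A k) : φ x = ψ x := by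
  refine F.eqOn_A (f := φ.toLinearMap) (g := ψ.toLinearMap) (fun w hw => ?_) hx
  have hw' : F.d w ≤ n := by omega
  clear hw hx
  induction w using FreeMonoid.recOn with
  | one => simp [F.basis_one]
  | of_mul x w ih =>
    rw [F.d_mul] at hw'
    rw [F.basis_mul]
    have h1 := h x (by omega)
    have h2 := ih (by omega)
    simp only [AlgHom.toLinearMap_apply, map_mul] at h2 ⊢
    rw [h1, h2]

/-- The linear form `f` is concentrated in degree `n`. -/
def IsHomogeneousForm (n : ℕ) (f : H →ₗ[K] K) : Prop := ∀ j, j ≠ n → ∀ x ∈ F.A j, f x = 0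

variable {F} in
theorem IsHomogeneousForm.star {m n : ℕ} {f g : H →ₗ[K] K} (hf : F.IsHomogeneousForm m f)
    (hg : F.IsHomogeneousForm n g) : F.IsHomogeneousForm (m + n) (star f g) := by
  intro j hj x hx
  refine (F.star_congr (f' := 0) (g' := 0) (fun u v huv => ?_) hx).trans ?_
  · by_cases hu : F.d u = m
    · rw [hg (F.d v) (by omega) _ (F.basis_mem v)]
      simp
    · rw [hf _ hu _ (F.basis_mem u)]
      simp
  · rw [star_apply]
    simp

theorem isHomogeneousForm_counit : F.IsHomogeneousForm 0 (counit (R := K)) :=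
  fun _ hj _ hx => F.counit_eq_zero hj hx

theorem isHomogeneousForm_lift {f : X → WithConv (H →ₗ[K] K)}
    (hf : ∀ x, F.IsHomogeneousForm (F.d (FreeMonoid.of x)) (f x).ofConv) {n : ℕ} {x : H}
    (hx : x ∈ F.A n) : F.IsHomogeneousForm n (form (F.lift f) x) := by
  intro j hj y hy
  refine F.eqOn_A (f := (form (F.lift f)).flip y) (g := 0) (fun w hw => ?_) hx
  subst hw
  suffices F.IsHomogeneousForm (F.d w) (form (F.lift f) (F.basis w)) from this j hj y hy
  clear hx hj hy
  induction w using FreeMonoid.recOn with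
  | one => rw [F.basis_one, form_one, d_one]; exact F.isHomogeneousForm_counit
  | of_mul x w ih =>
    rw [F.basis_mul, form_mul, F.d_mul]
    refine IsHomogeneousForm.star ?_ ih
    rw [form_apply, lift_basis_of]
    exact hf x

/-- A graded form, multiplicative in the first variable, is a nondegenerate Hopf pairing in
degrees less than `n`. -/
structure IsPairing (n : ℕ) (φ : H →ₐ[K] WithConv (H →ₗ[K] K)) : Prop where
  graded : ∀ i, ∀ x ∈ F.A i, F.IsHomogeneousForm i (form φ x)
  mul_right : ∀ k < n, ∀ x ∈ F.A k, ∀ y z,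
    form φ x (y * z) = star ((form φ).flip y) ((form φ).flip z) x
  nondegenerate : ∀ k < n, ∀ x ∈ F.A k, (∀ y ∈ F.A k, form φ x y = 0) → x = 0

end FreeGrading

/-! ### Extension of the pairing, degree by degree -/

namespace FreeGrading

open Coalgebra

variable {K : Type u} {H : Type v} {X : Type*} [Field K] [Ring H] [Bialgebra K H]
  (F : FreeGrading K H X)

/-- The projection on the component of degree `n`, as a map to this component. -/
noncomputable def pr (n : ℕ) : H →ₗ[K] F.A n := (F.proj n).codRestrict (F.A n) (F.proj_mem n)

theorem coe_pr (n : ℕ) (x : H) : (F.pr n x : H) = F.proj n x := rfl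

theorem pr_of_mem {n : ℕ} {x : H} (hx : x ∈ F.A n) : F.pr n x = ⟨x, hx⟩ :=
  Subtype.ext (F.proj_of_mem hx)

theorem pr_of_mem_ne {m n : ℕ} (h : m ≠ n) {x : H} (hx : x ∈ F.A m) : F.pr n x = 0 :=
  Subtype.ext (F.proj_of_mem_ne h hx)

variable {F} in
theorem IsHomogeneousForm.apply_proj {n : ℕ} {f : H →ₗ[K] K} (hf : F.IsHomogeneousForm n f)
    (y : H) : f (F.proj n y) = f y := by
  refine LinearMap.congr_fun (f := f ∘ₗ F.proj n) (F.hom_ext fun j x hx => ?_) y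
  by_cases hj : j = n
  · subst hj
    rw [LinearMap.comp_apply, F.proj_of_mem hx]
  · rw [LinearMap.comp_apply, F.proj_of_mem_ne hj hx, hf j hj x hx, map_zero]

/-- The decomposable elements of degree `n`. -/
def dec (n : ℕ) : Submodule K H :=
  Submodule.span K {y | ∃ a b, a ≠ 1 ∧ b ≠ 1 ∧ F.d a + F.d b = n ∧ y = F.basis (a * b)}

theorem eqOn_dec {n : ℕ} {M : Type*} [AddCommGroup M] [Module K M] {f g : H →ₗ[K] M}
    (h : ∀ a b, a ≠ 1 → b ≠ 1 → F.d a + F.d b = n → f (F.basis (a * b)) = g (F.basis (a * b)))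
    {x : H} (hx : x ∈ F.dec n) : f x = g x := by
  refine LinearMap.eqOn_span ?_ hx
  rintro _ ⟨a, b, ha, hb, hab, rfl⟩
  exact h a b ha hb hab

variable {F}

/-- Gradedness leaves only degree 0, which consists of the scalars, and there the form is the
counit. -/
theorem form_flip_one {φ : H →ₐ[K] WithConv (H →ₗ[K] K)}
    (h : ∀ i, ∀ x ∈ F.A i, F.IsHomogeneousForm i (form φ x)) : (form φ).flip 1 = counit := by
  refine F.hom_ext fun j x hx => ?_
  by_cases hj : j = 0
  · subst hj
    rw [F.eq_algebraMap hx, Algebra.algebraMap_eq_smul_one, map_smul, map_smul,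
      LinearMap.flip_apply, form_one]
  · rw [F.counit_eq_zero hj hx]
    exact h j x hx 0 (Ne.symm hj) 1 F.one_mem

/-- The form `γ w` such that `γ (y w) = star (T y) (T w)` for `y` a generator and `w ≠ 1`. -/
noncomputable def split (T : FreeMonoid X → (H →ₗ[K] K)) (w : FreeMonoid X) : H →ₗ[K] K :=
  match w.toList with
  | y :: v :: l => star (T (FreeMonoid.of y)) (T (FreeMonoid.ofList (v :: l)))
  | _ => 0

theorem split_of_mul (T : FreeMonoid X → (H →ₗ[K] K)) (y : X) {w : FreeMonoid X} (hw : w ≠ 1) :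
    split T (FreeMonoid.of y * w) = star (T (FreeMonoid.of y)) (T w) := by
  induction w using FreeMonoid.casesOn with
  | one => exact absurd rfl hw
  | of_mul v l => rfl

/-- The form computed by cutting off the first letter does not depend on the place of the cut. Both
factors have degree less than `n`, so the pairing already respects products there, and
coassociativity of the coproduct does the rest. -/
theorem IsPairing.split_mul {n : ℕ} {φ : H →ₐ[K] WithConv (H →ₗ[K] K)} (h : F.IsPairing n φ)
    {a b : FreeMonoid X} (ha : a ≠ 1) (hb : b ≠ 1) (hab : F.d a + F.d b = n) {x : H}
    (hx : x ∈ F.A n) : split (fun w => (form φ).flip (F.basis w)) (a * b) x =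
      star ((form φ).flip (F.basis a)) ((form φ).flip (F.basis b)) x := by
  induction a using FreeMonoid.casesOn with
  | one => exact absurd rfl ha
  | of_mul y a =>
    by_cases ha' : a = 1
    · subst ha'
      rw [mul_one, split_of_mul _ _ hb]
    · have hab' : a * b ≠ 1 := F.d_pos.1 (by have := F.d_pos.2 hb; rw [F.d_mul]; omega)
      have h1 := F.d_of_pos y
      have h2 := F.d_pos.2 ha'
      have h3 := F.d_pos.2 hb
      rw [F.d_mul] at hab
      rw [mul_assoc, split_of_mul _ _ hab']
      have e1 : star ((form φ).flip (F.basis (FreeMonoid.of y)))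
          ((form φ).flip (F.basis (a * b))) x = star ((form φ).flip (F.basis (FreeMonoid.of y)))
            (star ((form φ).flip (F.basis a)) ((form φ).flip (F.basis b))) x := by
        refine F.star_congr (fun u v huv => ?_) hx
        by_cases hu : F.d u = F.d (FreeMonoid.of y)
        · rw [← h.mul_right (F.d v) (by omega) _ (F.basis_mem v), ← F.basis_mul]
          rfl
        · have : (form φ).flip (F.basis (FreeMonoid.of y)) (F.basis u) = 0 :=
            h.graded _ _ (F.basis_mem u) _ (Ne.symm hu) _ (F.basis_mem _)
          rw [this, zero_mul, zero_mul]
      rw [e1, ← star_assoc]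
      refine F.star_congr (fun u v huv => ?_) hx
      by_cases hv : F.d v = F.d b
      · rw [← h.mul_right (F.d u) (by omega) _ (F.basis_mem u), ← F.basis_mul]
        rfl
      · have : (form φ).flip (F.basis b) (F.basis v) = 0 :=
          h.graded _ _ (F.basis_mem v) _ (Ne.symm hv) _ (F.basis_mem _)
        rw [this, mul_zero, mul_zero]

open Classical in
-- In degree `n` the form is already forced when either argument is decomposable: by
-- multiplicativity in the first variable, by the coproduct in the second. The two prescriptions
-- agree on pairs of decomposables. It remains to fill the free block, generators against a
-- complement, so that the form becomes nondegenerate; `exists_injective_lift` does this, since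
-- `exists_star_eq` supplies injectivity on one side and surjectivity on the other.
theorem IsPairing.exists_succ (R : F.InfProduct) {n : ℕ} (hn : 0 < n)
    {φ : H →ₐ[K] WithConv (H →ₗ[K] K)} (h : F.IsPairing n φ) :
    ∃ φ', F.IsPairing (n + 1) φ' ∧ ∀ k < n, ∀ x ∈ F.A k, φ' x = φ x := by
  let M : Submodule K (F.A n) := (F.dec n).comap (F.A n).subtype
  let ρ : Module.Dual K (F.A n) →ₗ[K] Module.Dual K M := M.dualRestrict
  let T : FreeMonoid X → (H →ₗ[K] K) := fun w => (form φ).flip (F.basis w)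
  -- `γ x` is the value that compatibility with the product in the second variable imposes on words
  -- of at least two letters.
  let γ : H →ₗ[K] H →ₗ[K] K := (F.basis.constr K (split T)).flip
  have hγ : ∀ a b, a ≠ 1 → b ≠ 1 → F.d a + F.d b = n → ∀ x ∈ F.A n,
      γ x (F.basis (a * b)) = star (T a) (T b) x := by
    intro a b ha hb hab x hx
    rw [LinearMap.flip_apply, Module.Basis.constr_basis]
    exact h.split_mul ha hb hab hx
  let ψ₀ : F.A n →ₗ[K] Module.Dual K (F.A n) := (form φ).domRestrict₁₂ (F.A n) (F.A n)
  let G : F.A n →ₗ[K] Module.Dual K M := ρ ∘ₗ γ.domRestrict₁₂ (F.A n) (F.A n)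
  have hgflip : ∀ i j, i ≠ j → ∀ x ∈ F.A i, ∀ y ∈ F.A j, (form φ).flip x y = 0 :=
    fun i j hij x hx y hy => h.graded j y hy i hij x hx
  have hρ : Function.Surjective ρ := Subspace.dualRestrict_surjective
  -- `exists_star_eq` for the flipped form: every linear form on the decomposables comes from the
  -- coproduct of some `z`.
  have hG : Function.Surjective G := by
    intro l
    obtain ⟨l, rfl⟩ := hρ l
    obtain ⟨z, hz, hzl⟩ := exists_star_eq R (form φ).flip hgflip
      (fun k hk z hz a b => h.mul_right k hk z hz a b) h.nondegenerate (l ∘ₗ F.pr n)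
    refine ⟨⟨z, hz⟩, LinearMap.ext fun m => ?_⟩
    have := F.eqOn_dec (f := γ z) (g := l ∘ₗ F.pr n) (fun a b ha hb hab => by
      rw [hγ a b ha hb hab z hz]
      exact hzl a b ha hb hab) m.2
    refine Eq.trans this ?_
    rw [LinearMap.comp_apply]
    exact congrArg l (F.pr_of_mem m.1.2)
  -- `exists_star_eq` for the form itself: on a decomposable `m`, every linear form `l` is pairing
  -- with some `z`, so an `m` orthogonal to degree `n` is killed by all `l`.
  have h₀ : ∀ m ∈ M, ψ₀ m = 0 → m = 0 := by
    intro m hm h0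
    refine Subtype.ext ((Module.forall_dual_apply_eq_zero_iff K (m : H)).1 fun l => ?_)
    obtain ⟨z, hz, hzl⟩ := exists_star_eq R (form φ)
      (fun i j hij x hx y hy => h.graded i x hx j hij.symm y hy)
      (fun k hk z hz a b => LinearMap.congr_fun (form_mul φ a b) z)
      (fun k hk => F.left_nondegenerate (form φ).flip (h.nondegenerate k hk)) l
    have := F.eqOn_dec (f := (form φ).flip z) (g := l) (fun a b ha hb hab => by
      rw [← hzl a b ha hb hab, F.basis_mul, LinearMap.flip_apply, form_mul]) hm
    refine this.symm.trans ?_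
    exact LinearMap.congr_fun h0 ⟨z, hz⟩
  have hcompat : ∀ m ∈ M, ρ (ψ₀ m) = G m := by
    intro m hm
    refine LinearMap.ext fun m' => ?_
    refine F.eqOn_dec (f := form φ m) (g := γ m) (fun c d hc hd hcd => ?_) m'.2
    rw [hγ c d hc hd hcd m m.2, F.basis_mul]
    refine F.eqOn_dec (f := (form φ).flip _) (fun a b ha hb hab => ?_) hm
    have h1 := F.d_pos.2 ha
    have h2 := F.d_pos.2 hb
    rw [F.basis_mul a b]
    exact form_mul_right_of_mul φ (h.mul_right _ (by omega) _ (F.basis_mem a))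
      (h.mul_right _ (by omega) _ (F.basis_mem b)) _ _
  obtain ⟨ψ, hψ, hψM, hψG⟩ := exists_injective_lift
    (Subspace.dual_finrank_eq (K := K) (V := F.A n)).symm ρ hρ M ψ₀ G hG h₀ hcompat
  -- Only the values at generators of degree `n` change, so lower degrees are untouched.
  let f : X → WithConv (H →ₗ[K] K) := fun x => if F.d (FreeMonoid.of x) = n then
    WithConv.toConv (ψ (F.pr n (F.basis (FreeMonoid.of x))) ∘ₗ F.pr n)
    else φ (F.basis (FreeMonoid.of x))
  have hlow : ∀ k < n, ∀ x ∈ F.A k, F.lift f x = φ x := by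
    intro k hk x hx
    refine F.algHom_eqOn (n := k) (fun y hy => ?_) le_rfl hx
    rw [lift_basis_of]
    exact if_neg (by omega)
  have hlow' : ∀ k < n, ∀ x ∈ F.A k, form (F.lift f) x = form φ x := fun k hk x hx =>
    congrArg WithConv.ofConv (hlow k hk x hx)
  have hgraded : ∀ i, ∀ x ∈ F.A i, F.IsHomogeneousForm i (form (F.lift f) x) := by
    intro i x hx
    refine F.isHomogeneousForm_lift (fun y => ?_) hx
    by_cases hy : F.d (FreeMonoid.of y) = n
    · intro j hj z hz
      simp only [f, if_pos hy, LinearMap.comp_apply]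
      rw [F.pr_of_mem_ne (hy ▸ hj) hz, map_zero]
    · simp only [f, if_neg hy]
      exact h.graded _ _ (F.basis_mem _)
  -- On generators this is the definition; on decomposables both sides are convolutions of forms of
  -- lower degree, since `ψ` restricts to `ψ₀` there.
  have htop : ∀ x ∈ F.A n, form (F.lift f) x = ψ (F.pr n x) ∘ₗ F.pr n := by
    intro x hx
    refine F.eqOn_A (g := (LinearMap.lcomp K K (F.pr n)) ∘ₗ ψ ∘ₗ F.pr n) (fun w hw => ?_) hx
    induction w using FreeMonoid.casesOn with
    | one => rw [F.d_one] at hw; omega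
    | of_mul y w =>
      by_cases hw1 : w = 1
      · subst hw1
        rw [mul_one] at hw ⊢
        rw [form_apply, lift_basis_of]
        simp only [f, if_pos hw]
        rfl
      · have h1 := F.d_of_pos y
        have h2 := F.d_pos.2 hw1
        have hM : F.pr n (F.basis (FreeMonoid.of y * w)) ∈ M := by
          rw [F.pr_of_mem (F.basis_mem' hw)]
          rw [F.d_mul] at hw
          exact Submodule.subset_span ⟨FreeMonoid.of y, w, FreeMonoid.of_ne_one y, hw1, hw, rfl⟩
        refine LinearMap.ext fun z => ?_
        have e1 : form (F.lift f) (F.basis (FreeMonoid.of y * w)) =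
            form φ (F.basis (FreeMonoid.of y * w)) := by
          rw [F.d_mul] at hw
          rw [F.basis_mul, form_mul, form_mul, hlow' _ _ _ (F.basis_mem w),
            hlow' _ _ _ (F.basis_mem _)] <;> omega
        have e2 : ψ (F.pr n (F.basis (FreeMonoid.of y * w))) (F.pr n z) =
            form φ (F.pr n (F.basis (FreeMonoid.of y * w))) (F.pr n z) := by
          rw [hψM _ hM]
          rfl
        rw [e1]
        refine Eq.trans ?_ e2.symm
        rw [coe_pr, coe_pr, F.proj_of_mem (F.basis_mem' hw),
          (h.graded n _ (F.basis_mem' hw)).apply_proj]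
  have hmulow : ∀ k < n, ∀ x ∈ F.A k, ∀ y z, form (F.lift f) x (y * z) =
      star ((form (F.lift f)).flip y) ((form (F.lift f)).flip z) x := by
    intro k hk x hx y z
    rw [hlow' k hk x hx, h.mul_right k hk x hx]
    refine F.star_congr (fun u v huv => ?_) hx
    simp only [LinearMap.flip_apply]
    rw [hlow' _ (by omega) _ (F.basis_mem u), hlow' _ (by omega) _ (F.basis_mem v)]
  refine ⟨F.lift f, ⟨hgraded, fun k hk x hx y z => ?_, fun k hk x hx h0 => ?_⟩, hlow⟩
  · rcases Nat.lt_succ_iff_lt_or_eq.1 hk with hk | rfl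
    · exact hmulow k hk x hx y z
    refine F.eqOn_A (f := (form (F.lift f)).flip (y * z)) (fun w hw => ?_) hx
    rw [LinearMap.flip_apply]
    induction w using FreeMonoid.casesOn with
    | one => rw [F.d_one] at hw; omega
    | of_mul x₀ w =>
      by_cases hw1 : w = 1
      · subst hw1
        rw [mul_one] at hw ⊢
        have hx₀ := F.basis_mem' hw
        have key : (LinearMap.mul K H).compr₂ (form (F.lift f) (F.basis (FreeMonoid.of x₀))) =
            TensorProduct.curry
              (formSq (form (F.lift f)) (comul (F.basis (FreeMonoid.of x₀)))) := by
          refine F.basis.ext fun a => F.basis.ext fun b => ?_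
          rw [TensorProduct.curry_apply, formSq_apply, ← star_apply, LinearMap.compr₂_apply,
            LinearMap.mul_apply', ← F.basis_mul]
          by_cases ha : a = 1
          · rw [ha, one_mul, F.basis_one, form_flip_one hgraded, counit_star]
            rfl
          by_cases hb : b = 1
          · rw [hb, mul_one, F.basis_one, form_flip_one hgraded, star_counit]
            rfl
          have hzero : ∀ φ : H →ₐ[K] WithConv (H →ₗ[K] K),
              (∀ i, ∀ x ∈ F.A i, F.IsHomogeneousForm i (form φ x)) → ∀ u v, F.d u ≠ F.d v →
              (form φ).flip (F.basis v) (F.basis u) = 0 := fun φ hφ u v huv =>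
            hφ _ _ (F.basis_mem u) _ huv.symm _ (F.basis_mem v)
          have h1 := F.d_pos.2 ha
          have h2 := F.d_pos.2 hb
          -- In the matching degree the identity is the condition `ρ (ψ x) = G x`; in any other
          -- degree both sides vanish by gradedness.
          by_cases hab : F.d a + F.d b = k
          · rw [htop _ hx₀]
            have hM : F.basis (a * b) ∈ F.A k := F.basis_mem' (by rw [F.d_mul, hab])
            have e1 : ψ (F.pr k (F.basis (FreeMonoid.of x₀))) (F.pr k (F.basis (a * b))) =
                γ (F.basis (FreeMonoid.of x₀)) (F.basis (a * b)) := by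
              have := LinearMap.congr_fun (hψG (F.pr k (F.basis (FreeMonoid.of x₀))))
                ⟨F.pr k (F.basis (a * b)), by
                  rw [F.pr_of_mem hM]
                  exact Submodule.subset_span ⟨a, b, ha, hb, hab, rfl⟩⟩
              refine this.trans ?_
              change γ (F.proj k _) (F.proj k _) = _
              rw [F.proj_of_mem hM, F.proj_of_mem hx₀]
            refine e1.trans ?_
            rw [hγ a b ha hb hab _ hx₀]
            refine F.star_congr (fun u v huv => ?_) hx₀
            by_cases hu : F.d u = F.d a
            · simp only [T, LinearMap.flip_apply]
              rw [hlow' _ (by omega) _ (F.basis_mem u), hlow' _ (by omega) _ (F.basis_mem v)]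
            · rw [hzero φ h.graded u a hu, hzero _ hgraded u a hu, zero_mul, zero_mul]
          · rw [hgraded k _ hx₀ (F.d a + F.d b) hab _ (F.basis_mem' (F.d_mul a b))]
            refine (F.star_congr (f' := 0) (g' := 0) (fun u v huv => ?_) hx₀).trans ?_ |>.symm
            · by_cases hu : F.d u = F.d a
              · rw [hzero _ hgraded v b (by omega)]
                simp
              · rw [hzero _ hgraded u a hu]
                simp
            · simp [star_apply]
        have := LinearMap.congr_fun₂ key y z
        rw [TensorProduct.curry_apply, formSq_apply] at this
        exact this
      · have h1 := F.d_of_pos x₀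
        have h2 := F.d_pos.2 hw1
        rw [F.d_mul] at hw
        rw [F.basis_mul]
        exact form_mul_right_of_mul _ (hmulow _ (by omega) _ (F.basis_mem _))
          (hmulow _ (by omega) _ (F.basis_mem _)) y z
  · rcases Nat.lt_succ_iff_lt_or_eq.1 hk with hk | rfl
    · exact h.nondegenerate k hk x hx fun y hy => by rw [← hlow' k hk x hx, h0 y hy]
    · have : ψ (F.pr k x) = 0 := LinearMap.ext fun y => by
        have := h0 y y.2
        rw [htop x hx, LinearMap.comp_apply, F.pr_of_mem y.2] at this
        exact this
      have := hψ (this.trans (map_zero ψ).symm)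
      rw [F.pr_of_mem hx] at this
      exact congrArg Subtype.val this

/-- The successive pairings stabilize in each degree. Their limit is well defined by freeness: a
generator of degree `m` receives its value under the `m`-th pairing. -/
theorem exists_pairing (R : F.InfProduct) :
    ∃ φ : H →ₐ[K] WithConv (H →ₗ[K] K), ∀ n, F.IsPairing n φ := by
  -- Killing all generators is enough at the start: in degree 0 the form is the product of scalars.
  have base : F.IsPairing 1 (F.lift fun _ => (0 : WithConv (H →ₗ[K] K))) := by
    have hgraded : ∀ i, ∀ x ∈ F.A i, F.IsHomogeneousForm i
        (form (F.lift fun _ => (0 : WithConv (H →ₗ[K] K))) x) := fun i x hx =>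
      F.isHomogeneousForm_lift (fun y j _ z _ => by simp) hx
    refine ⟨hgraded, fun k hk x hx y z => ?_, fun k hk x hx h0 => ?_⟩ <;>
      obtain rfl : k = 0 := by omega
    · rw [F.eq_algebraMap hx, Algebra.algebraMap_eq_smul_one, map_smul, map_smul, form_one,
        LinearMap.smul_apply, star_apply, Bialgebra.comul_one, Algebra.TensorProduct.one_def]
      simp [form_one]
    · have := h0 1 F.one_mem
      rw [F.eq_algebraMap hx, Algebra.algebraMap_eq_smul_one, map_smul, LinearMap.smul_apply,
        form_one, Bialgebra.counit_one, smul_eq_mul, mul_one] at this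
      rw [F.eq_algebraMap hx, this, map_zero]
  choose! next hnext hagree using fun (n : ℕ) (φ : H →ₐ[K] WithConv (H →ₗ[K] K))
    (h : F.IsPairing (n + 1) φ) => h.exists_succ R n.succ_pos
  let s : ℕ → (H →ₐ[K] WithConv (H →ₗ[K] K)) := fun n => n.rec
    (F.lift fun _ => (0 : WithConv (H →ₗ[K] K))) fun n φ => next n φ
  have hs : ∀ n, F.IsPairing (n + 1) (s n) := by
    intro n
    induction n with
    | zero => exact base
    | succ n ih => exact hnext n (s n) ih
  have hstep : ∀ m n, m ≤ n → ∀ k ≤ m, ∀ x ∈ F.A k, s n x = s m x := by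
    intro m n hmn k hk x hx
    induction n, hmn using Nat.le_induction with
    | base => rfl
    | succ n hn ih =>
      rw [← ih]
      exact hagree n (s n) (hs n) k (by omega) x hx
  let φ : H →ₐ[K] WithConv (H →ₗ[K] K) :=
    F.lift fun x => s (F.d (FreeMonoid.of x)) (F.basis (FreeMonoid.of x))
  have hφ : ∀ n, ∀ k ≤ n, ∀ x ∈ F.A k, form φ x = form (s n) x := by
    intro n k hk x hx
    have key : φ x = s n x := F.algHom_eqOn (n := n) (fun y hy => ?_) hk hx
    · exact congrArg WithConv.ofConv key
    rw [F.lift_basis_of]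
    exact (hstep _ n hy _ le_rfl _ (F.basis_mem _)).symm
  refine ⟨φ, fun n => ⟨fun i x hx => ?_, fun k _ x hx y z => ?_, fun k _ x hx h0 => ?_⟩⟩
  · rw [hφ i i le_rfl x hx]
    exact (hs i).graded i x hx
  · rw [hφ k k le_rfl x hx, (hs k).mul_right k k.lt_succ_self x hx]
    refine F.star_congr (fun u v huv => ?_) hx
    simp only [LinearMap.flip_apply]
    rw [hφ k _ (by omega) _ (F.basis_mem u), hφ k _ (by omega) _ (F.basis_mem v)]
  · exact (hs k).nondegenerate k k.lt_succ_self x hx fun y hy => by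
      rw [← hφ k k le_rfl x hx, h0 y hy]

end FreeGrading

/-! ### Self-duality -/

namespace FreeGrading

open Coalgebra

variable {K : Type u} {H : Type v} {X : Type*} [Field K] [Ring H] [Bialgebra K H]
  {F : FreeGrading K H X}

/-- A graded nondegenerate form induces an isomorphism on the graded dual. -/
theorem exists_equiv_gradedDual (β : H →ₗ[K] H →ₗ[K] K)
    (hg : ∀ i, ∀ x ∈ F.A i, F.IsHomogeneousForm i (β x))
    (hnd : ∀ n, ∀ x ∈ F.A n, (∀ y ∈ F.A n, β x y = 0) → x = 0) :
    ∃ φ : H ≃ₗ[K] gradedDual F.A, ∀ x, (φ x).1 = β x := by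
  have hβ : ∀ x n, ∀ y ∈ F.A n, β x y = β (F.proj n x) y := by
    intro x n y hy
    refine LinearMap.congr_fun (f := β.flip y) (g := β.flip y ∘ₗ F.proj n)
      (F.hom_ext fun j z hz => ?_) x
    by_cases hj : j = n
    · subst hj
      rw [LinearMap.comp_apply, F.proj_of_mem hz]
    · rw [LinearMap.comp_apply, F.proj_of_mem_ne hj hz, map_zero]
      exact hg j z hz n (Ne.symm hj) y hy
  have hmem : ∀ x, β x ∈ gradedDual F.A := by
    intro x
    obtain ⟨N, hN⟩ := F.exists_sum_proj x
    refine ⟨N, fun n hn y hy => ?_⟩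
    rw [hN N le_rfl, map_sum, LinearMap.sum_apply]
    refine Finset.sum_eq_zero fun i hi => ?_
    exact hg i _ (F.proj_mem i x) n (by simp at hi; omega) y hy
  let B : H →ₗ[K] gradedDual F.A := β.codRestrict _ hmem
  refine ⟨LinearEquiv.ofBijective B ⟨?_, ?_⟩, fun x => rfl⟩
  · intro x x' hx
    refine F.eq_of_proj_eq fun n => sub_eq_zero.1 ?_
    refine hnd n _ (sub_mem (F.proj_mem n x) (F.proj_mem n x')) fun y hy => ?_
    rw [map_sub, LinearMap.sub_apply, ← hβ x n y hy, ← hβ x' n y hy, sub_eq_zero]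
    exact LinearMap.congr_fun (congrArg Subtype.val hx) y
  · rintro ⟨f, N, hN⟩
    choose q hq hqf using fun n => F.exists_representing β.flip (hnd n) f
    refine ⟨∑ n ∈ Finset.range N, q n, Subtype.ext (F.hom_ext fun n y hy => ?_)⟩
    change β _ y = f y
    rw [hβ _ n y hy, map_sum]
    by_cases hn : n < N
    · rw [Finset.sum_eq_single_of_mem n (by simpa using hn), F.proj_of_mem (hq n)]
      · exact hqf n y hy
      · exact fun i _ hi => F.proj_of_mem_ne hi (hq i)
    · rw [Finset.sum_eq_zero, hN n (by omega) y hy, map_zero, LinearMap.zero_apply]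
      exact fun i hi => F.proj_of_mem_ne (by simp at hi; omega) (hq i)

theorem exists_equiv_pairing (R : F.InfProduct) :
    ∃ (φ : H →ₐ[K] WithConv (H →ₗ[K] K)) (Φ : H ≃ₗ[K] gradedDual F.A),
      (∀ n, F.IsPairing n φ) ∧ ∀ x, (Φ x).1 = form φ x := by
  obtain ⟨φ, hφ⟩ := exists_pairing R
  obtain ⟨Φ, hΦ⟩ := exists_equiv_gradedDual (form φ) (hφ 0).graded
    fun n => (hφ (n + 1)).nondegenerate n n.lt_succ_self
  exact ⟨φ, Φ, hφ, hΦ⟩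

theorem IsPairing.mul_right_all {φ : H →ₐ[K] WithConv (H →ₗ[K] K)} (hφ : ∀ n, F.IsPairing n φ)
    (x y z : H) : form φ x (y * z) = star ((form φ).flip y) ((form φ).flip z) x :=
  LinearMap.congr_fun (f := (form φ).flip (y * z)) (F.hom_ext fun n x hx =>
    (hφ (n + 1)).mul_right n n.lt_succ_self x hx y z) x

/-- A free graded bialgebra that is an infinitesimal bialgebra for another product is
self-dual. -/
theorem isSelfDual (R : F.InfProduct) : IsSelfDual F.A := by
  obtain ⟨φ, Φ, hφ, hΦ⟩ := exists_equiv_pairing R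
  have hflip : ∀ y, Module.Dual.eval K H y ∘ₗ (gradedDual F.A).subtype ∘ₗ Φ.toLinearMap =
      (form φ).flip y := fun y => LinearMap.ext fun x => LinearMap.congr_fun (hΦ x) y
  refine ⟨Φ, fun m n hmn x hx y hy => ?_, ?_, fun x y => ?_, fun x => ?_, fun x y z => ?_⟩
  · rw [hΦ]
    exact (hφ 0).graded n x hx m hmn y hy
  · rw [hΦ, form_one]
  · rw [hΦ, hΦ, hΦ, form_mul]
    rfl
  · rw [hΦ]
    exact LinearMap.congr_fun (form_flip_one (hφ 0).graded) x
  · rw [hΦ, hflip, hflip, IsPairing.mul_right_all hφ]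
    rfl

end FreeGrading

/-! ### Coefficients in the tensor coalgebra -/

namespace TensorCoalgebra

open Coalgebra

variable (K : Type u) {X : Type v} [Field K]

/-- The coefficient of a word. -/
noncomputable def coeff (w : List X) : TensorCoalgebra K X →ₗ[K] K :=
  show (List X →₀ K) →ₗ[K] K from Finsupp.lapply w

open Classical in
theorem coeff_word (u w : List X) : coeff K u (word K w) = if w = u then 1 else 0 :=
  Finsupp.single_apply

theorem ext_coeff {s t : TensorCoalgebra K X} (h : ∀ w, coeff K w s = coeff K w t) : s = t :=
  Finsupp.ext h

/-- The coefficient of a tensor product of words. -/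
noncomputable def coeffTmul (u v : List X) : TensorCoalgebra K X ⊗[K] TensorCoalgebra K X →ₗ[K] K :=
  LinearMap.mul' K K ∘ₗ TensorProduct.map (coeff K u) (coeff K v)

theorem ext_coeffTmul {s t : TensorCoalgebra K X ⊗[K] TensorCoalgebra K X}
    (h : ∀ u v, coeffTmul K u v s = coeffTmul K u v t) : s = t := by
  let E : TensorCoalgebra K X ⊗[K] TensorCoalgebra K X ≃ₗ[K] (List X × List X →₀ K) :=
    finsuppTensorFinsupp' K (List X) (List X)
  have key : ∀ u v s, E s (u, v) = coeffTmul K u v s := by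
    intro u v s
    induction s with
    | zero => simp
    | tmul a b => exact finsuppTensorFinsupp'_apply_apply K (List X) (List X) a b u v
    | add a b ha hb => rw [map_add, map_add, Finsupp.add_apply, ha, hb]
  refine E.injective (Finsupp.ext fun ⟨u, v⟩ => ?_)
  rw [key, key, h]

/-- Deconcatenation is the transpose of concatenation: of all the cuts of a word, only the one at
the length of `u` can give `(u, v)`. -/
theorem coeffTmul_comul (u v : List X) (t : TensorCoalgebra K X) :
    coeffTmul K u v (comul t) = coeff K (u ++ v) t := by
  classical
  refine LinearMap.congr_fun (f := coeffTmul K u v ∘ₗ comul)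
    (linearMap_ext K X fun w => ?_) t
  have h : comul (R := K) (word K w) = deconc K w := lift_word K _ w
  rw [LinearMap.comp_apply, h, deconc, map_sum, coeff_word]
  simp only [coeffTmul, LinearMap.comp_apply, TensorProduct.map_tmul, LinearMap.mul'_apply,
    coeff_word]
  by_cases hw : w = u ++ v
  · subst hw
    rw [Finset.sum_eq_single_of_mem u.length (by simp)]
    · simp
    · intro i hi hne
      rw [if_neg, zero_mul]
      intro h
      have := congrArg List.length h
      simp at hi this
      omega
  · rw [if_neg hw]
    refine Finset.sum_eq_zero fun i _ => ?_
    by_contra h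
    have h1 : w.take i = u := by
      by_contra h1
      exact h (by rw [if_neg h1, zero_mul])
    have h2 : w.drop i = v := by
      by_contra h2
      exact h (by rw [if_neg h2, mul_zero])
    exact hw (by rw [← h1, ← h2, List.take_append_drop])

theorem counit_eq_coeff (t : TensorCoalgebra K X) : counit (R := K) t = coeff K [] t := by
  classical
  refine LinearMap.congr_fun (f := counit) (linearMap_ext K X fun w => ?_) t
  refine (lift_word K _ w).trans ?_
  rw [coeff_word]
  simp

end TensorCoalgebra

/-! ### Cofreeness -/

namespace FreeGrading

open Coalgebra

variable {K : Type u} {H : Type v} [Field K] [Ring H] [Bialgebra K H]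

open Classical in
/-- The dual of the basis of monomials: a free graded bialgebra that is an infinitesimal
bialgebra for another product is cofree. -/
theorem isCofree {X : Type v} {F : FreeGrading K H X} (R : F.InfProduct) : IsCofree K H := by
  obtain ⟨φ, Φ, hφ, hΦ⟩ := exists_equiv_pairing R
  have hfin : ∀ x, (Function.support fun w : List X =>
      form φ x (F.basis (FreeMonoid.ofList w))).Finite := by
    intro x
    obtain ⟨N, hN⟩ := hΦ x ▸ (Φ x).2
    refine (F.words N).finite_toSet.subset fun w hw => ?_
    by_contra h
    refine hw (hN _ ?_ _ (F.basis_mem (FreeMonoid.ofList w)))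
    have : ¬ F.d (FreeMonoid.ofList w) ≤ N := fun h' => h (F.mem_words.2 h')
    omega
  -- `x` is sent to the sum of the words `w` with coefficients `⟨x, w⟩`. Monomials multiply by
  -- concatenation and the pairing makes product and coproduct adjoint, so `θ` carries the coproduct
  -- to deconcatenation.
  let θ : H →ₗ[K] TensorCoalgebra K X :=
    { toFun := fun x => Finsupp.ofSupportFinite _ (hfin x)
      map_add' := fun x y => by
        refine Finsupp.ext fun w => ?_
        change form φ (x + y) _ = form φ x _ + form φ y _
        simp
      map_smul' := fun c x => by
        refine Finsupp.ext fun w => ?_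
        change form φ (c • x) _ = c * form φ x _
        simp }
  have hθ : ∀ w, TensorCoalgebra.coeff K w ∘ₗ θ =
      (form φ).flip (F.basis (FreeMonoid.ofList w)) := fun w => rfl
  have hθ' : ∀ w x, TensorCoalgebra.coeff K w (θ x) =
      form φ x (F.basis (FreeMonoid.ofList w)) := fun w x => rfl
  have hbij : Function.Bijective θ := by
    constructor
    · intro x y hxy
      refine Φ.injective (Subtype.ext ?_)
      rw [hΦ, hΦ]
      refine F.basis.ext fun w => ?_
      exact congrArg (TensorCoalgebra.coeff K w.toList) hxy
    · intro t
      let t' : List X →₀ K := t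
      let f : H →ₗ[K] K := F.basis.constr K fun w => t' w.toList
      -- Finite support of `t` bounds the degree, so the form with coefficients `t` lies in the
      -- graded dual and is represented by an element of `H`.
      have hf : f ∈ gradedDual F.A := by
        refine ⟨t'.support.sup (fun w => F.d (FreeMonoid.ofList w)) + 1, fun n hn x hx => ?_⟩
        refine F.eqOn_A (g := 0) (fun w hw => ?_) hx
        rw [Module.Basis.constr_basis]
        by_contra h0
        have := Finset.le_sup (f := fun w => F.d (FreeMonoid.ofList w))
          (Finsupp.mem_support_iff.2 h0)
        simp only [FreeMonoid.ofList_toList] at this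
        omega
      refine ⟨Φ.symm ⟨f, hf⟩, TensorCoalgebra.ext_coeff K fun w => ?_⟩
      rw [hθ', ← hΦ, LinearEquiv.apply_symm_apply]
      change f _ = _
      rw [Module.Basis.constr_basis]
      rfl
  refine ⟨X, ⟨{ LinearEquiv.ofBijective θ hbij with
    counit_comp := ?_
    map_comp_comul := ?_ }⟩⟩
  · refine LinearMap.ext fun x => ?_
    refine (TensorCoalgebra.counit_eq_coeff K (θ x)).trans ?_
    rw [hθ', ← form_flip_one (hφ 0).graded, ← F.basis_one]
    rfl
  · refine LinearMap.ext fun x => TensorCoalgebra.ext_coeffTmul K fun u v => ?_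
    refine Eq.trans ?_ (TensorCoalgebra.coeffTmul_comul K u v (θ x)).symm
    rw [hθ', FreeMonoid.ofList_append, F.basis_mul, IsPairing.mul_right_all hφ, ← hθ, ← hθ,
      star_apply, TensorProduct.map_comp]
    rfl

end FreeGrading

/-! ### The free Lie algebra embeds in the free associative algebra -/

namespace FreeLieAlgebra

variable {K : Type u} {X : Type v} [Field K]

theorem mem_of_forall_of_mem (S : LieSubalgebra K (FreeLieAlgebra K X)) (h : ∀ x, of K x ∈ S)
    (u : FreeLieAlgebra K X) : u ∈ S := by
  have : S.incl.comp (lift K fun x => (⟨of K x, h x⟩ : S)) = LieHom.id := by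
    ext x
    simp
  have h2 := LieHom.congr_fun this u
  rw [LieHom.comp_apply, LieHom.id_apply] at h2
  rw [← h2]
  exact Subtype.property _

variable (K X) in
/-- The Lie algebra acts on `K × L` by `u • (c, l) = (0, c D u + [u, l])`, where `D` is the
derivation that fixes the generators. -/
noncomputable def act : FreeLieAlgebra K X →ₗ⁅K⁆ Module.End K (K × FreeLieAlgebra K X) :=
  lift K fun x => LinearMap.inr K K (FreeLieAlgebra K X) ∘ₗ
    (LinearMap.coprod (LinearMap.toSpanSingleton K _ (of K x))
      (LieAlgebra.ad K (FreeLieAlgebra K X) (of K x)))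

variable (K X) in
/-- The derivation that fixes the generators. -/
noncomputable def degDer : Module.End K (FreeLieAlgebra K X) :=
  LinearMap.snd K K _ ∘ₗ (LinearMap.applyₗ (1, 0)) ∘ₗ (act K X).toLinearMap

/-- Operators of this shape are stable under linear combinations and commutators, and the generators
have it, so the whole Lie algebra does. The coefficient of `c` is then read off at `(1, 0)`. -/
theorem act_apply (u : FreeLieAlgebra K X) (c : K) (l : FreeLieAlgebra K X) :
    act K X u (c, l) = (0, c • degDer K X u + ⁅u, l⁆) := by
  have key : ∀ u : FreeLieAlgebra K X, ∃ v, ∀ (c : K) (l : FreeLieAlgebra K X),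
      act K X u (c, l) = (0, c • v + ⁅u, l⁆) := by
    intro u
    let S : LieSubalgebra K (FreeLieAlgebra K X) :=
      { carrier := {u | ∃ v, ∀ (c : K) (l : FreeLieAlgebra K X),
          act K X u (c, l) = (0, c • v + ⁅u, l⁆)}
        zero_mem' := ⟨0, fun c l => by simp [Prod.mk_zero_zero]⟩
        add_mem' := by
          rintro a b ⟨v, hv⟩ ⟨w, hw⟩
          refine ⟨v + w, fun c l => ?_⟩
          rw [map_add, LinearMap.add_apply, hv, hw, add_lie]
          ext
          · simp
          · simp only [Prod.mk_add_mk, smul_add]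
            abel
        smul_mem' := by
          rintro k a ⟨v, hv⟩
          refine ⟨k • v, fun c l => ?_⟩
          rw [map_smul, LinearMap.smul_apply, hv, smul_lie]
          ext
          · simp
          · simp only [Prod.smul_mk, smul_add]
            rw [smul_comm]
        lie_mem' := by
          rintro a b ⟨v, hv⟩ ⟨w, hw⟩
          -- With `v = D a` and `w = D b`, this is the derivation rule for `D ⁅a, b⁆`.
          refine ⟨⁅a, w⁆ - ⁅b, v⁆, fun c l => ?_⟩
          rw [LieHom.map_lie, Ring.lie_def, LinearMap.sub_apply, Module.End.mul_apply,
            Module.End.mul_apply, hv c l, hw c l, hv, hw, lie_lie]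
          ext
          · simp
          · simp only [Prod.mk_sub_mk, zero_smul, zero_add, lie_add, lie_smul, smul_sub]
            abel }
    exact mem_of_forall_of_mem S (fun x => ⟨of K x, fun c l => by simp [act]⟩) u
  obtain ⟨v, hv⟩ := key u
  have : degDer K X u = v := by
    change (act K X u (1, 0)).2 = v
    rw [hv]
    simp
  rw [this, hv]

theorem degDer_of (x : X) : degDer K X (of K x) = of K x := by
  change (act K X (of K x) (1, 0)).2 = _
  simp [act]

theorem degDer_lie (u v : FreeLieAlgebra K X) :
    degDer K X ⁅u, v⁆ = ⁅degDer K X u, v⁆ + ⁅u, degDer K X v⁆ := by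
  change (act K X ⁅u, v⁆ (1, 0)).2 = _
  rw [LieHom.map_lie, Ring.lie_def, LinearMap.sub_apply, Module.End.mul_apply,
    Module.End.mul_apply, act_apply u 1, act_apply v 1, act_apply, act_apply]
  simp only [Prod.snd_sub, zero_smul, one_smul, zero_add, lie_zero, add_zero]
  rw [← lie_skew (degDer K X u) v]
  abel

/-- The derivation multiplies a bracket of `n` generators by `n`. Such eigenvectors span, and in
characteristic zero their eigenvalues are nonzero, so independence of eigenspaces excludes a kernel.
-/
theorem degDer_injective [CharZero K] : Function.Injective (degDer K X) := by
  rw [← LinearMap.ker_eq_bot, LinearMap.ker_eq_bot']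
  intro u hu
  let T : Submodule K (FreeLieAlgebra K X) :=
    ⨆ μ : K, ⨆ _ : μ ≠ 0, (degDer K X).eigenspace μ
  have hT' : ∀ {n : ℕ} {x}, 0 < n → degDer K X x = (n : K) • x → x ∈ T := fun {n x} hn hx =>
    Submodule.mem_iSup_of_mem (n : K) (Submodule.mem_iSup_of_mem (by simp; omega)
      (Module.End.mem_eigenspace_iff.2 hx))
  let S : Submodule K (FreeLieAlgebra K X) :=
    Submodule.span K {x | ∃ n : ℕ, 0 < n ∧ degDer K X x = (n : K) • x}
  have hST : S ≤ T := Submodule.span_le.2 fun x ⟨n, hn, hx⟩ => hT' hn hx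
  let S' : LieSubalgebra K (FreeLieAlgebra K X) :=
    { S with
      lie_mem' := by
        intro x y hx hy
        change ⁅x, y⁆ ∈ S
        refine Submodule.span_induction₂ (p := fun x y _ _ => ⁅x, y⁆ ∈ S) ?_ ?_ ?_ ?_ ?_ ?_ ?_ hx hy
        · rintro x y ⟨m, hm, hx⟩ ⟨n, hn, hy⟩
          refine Submodule.subset_span ⟨m + n, by omega, ?_⟩
          rw [degDer_lie, hx, hy, smul_lie, lie_smul, ← add_smul]
          push_cast
          rfl
        · intro y _; simp
        · intro x _; simp
        · intro x y z _ _ _ h k; rw [add_lie]; exact add_mem h k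
        · intro x y z _ _ _ h k; rw [lie_add]; exact add_mem h k
        · intro c x y _ _ h; rw [smul_lie]; exact S.smul_mem _ h
        · intro c x y _ _ h; rw [lie_smul]; exact S.smul_mem _ h }
  have hu' : u ∈ S' := mem_of_forall_of_mem S' (fun x =>
    Submodule.subset_span ⟨1, one_pos, by simp [degDer_of]⟩) u
  have hdisj := (Module.End.eigenspaces_iSupIndep (degDer K X)) 0
  refine Submodule.disjoint_def.1 hdisj u ?_ (hST hu')
  rw [Module.End.mem_eigenspace_iff, zero_smul, hu]

/-- In characteristic zero, the free Lie algebra embeds in the free associative algebra. -/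
theorem lift_ι_injective [CharZero K] :
    Function.Injective (lift K (FreeAlgebra.ι K : X → FreeAlgebra K X)) := by
  refine (injective_iff_map_eq_zero _).2 fun u hu => ?_
  -- The action extends to the free associative algebra, so an element that dies there acts by zero,
  -- and its action on `(1, 0)` is its image under `degDer`.
  let Φ : FreeAlgebra K X →ₐ[K] Module.End K (K × FreeLieAlgebra K X) :=
    FreeAlgebra.lift K fun x => act K X (of K x)
  have : Φ.toLieHom.comp (lift K (FreeAlgebra.ι K : X → FreeAlgebra K X)) = act K X := by
    ext x : 1
    simp [Φ]
  have h := LieHom.congr_fun this u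
  rw [LieHom.comp_apply, hu, map_zero] at h
  refine degDer_injective (K := K) (X := X) ?_
  rw [map_zero]
  change (act K X u (1, 0)).2 = 0
  rw [← h]
  rfl

end FreeLieAlgebra

/-! ### Products of primitive elements -/

namespace Primitives

open Coalgebra

variable {K : Type u} {H : Type v} [Field K] [Ring H] [Bialgebra K H]

theorem mem_iff {x : H} : x ∈ primitives K H ↔ comul (R := K) x = x ⊗ₜ 1 + 1 ⊗ₜ x := Iff.rfl

theorem counit_eq_zero {x : H} (hx : x ∈ primitives K H) : counit (R := K) x = 0 := by
  have h := congrArg (TensorProduct.lid K K ∘ TensorProduct.map counit counit) (mem_iff.1 hx)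
  have h2 : TensorProduct.lid K K (TensorProduct.map counit counit (comul x)) =
      counit (R := K) x := by
    have := congrArg (fun t => TensorProduct.lid K K (counit.lTensor K t))
      (rTensor_counit_comul (R := K) x)
    simp only [LinearMap.lTensor_tmul, TensorProduct.lid_tmul, one_smul] at this
    rw [← this, ← LinearMap.comp_apply (LinearMap.lTensor K counit), LinearMap.lTensor_comp_rTensor]
  rw [Function.comp_apply, h2] at h
  simpa using h

variable (K H) in
/-- The span of the commutators of primitive elements. -/
def commutators : Submodule K H :=
  Submodule.span K {z | ∃ x ∈ primitives K H, ∃ y ∈ primitives K H, z = x * y - y * x}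

variable (K H) in
/-- The span of the commutators of primitive elements and of the products of at least two and at
most `k` primitive elements. -/
def filt (k : ℕ) : Submodule K H := commutators K H ⊔
  Submodule.span K {z | ∃ l : List H, (∀ x ∈ l, x ∈ primitives K H) ∧ 2 ≤ l.length ∧
    l.length ≤ k ∧ z = l.prod}

theorem filt_mono {j k : ℕ} (h : j ≤ k) : filt K H j ≤ filt K H k :=
  sup_le_sup_left (Submodule.span_mono (by
    rintro _ ⟨l, hl, h2, hj, hz⟩
    exact ⟨l, hl, h2, hj.trans h, hz⟩)) _

theorem filt_le_commutators {k : ℕ} (h : k < 2) : filt K H k ≤ commutators K H := by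
  refine sup_le le_rfl (Submodule.span_le.2 ?_)
  rintro _ ⟨l, hl, h2, hk, -⟩
  omega

theorem prod_mem_filt {l : List H} (hl : ∀ x ∈ l, x ∈ primitives K H) (h2 : 2 ≤ l.length) {k : ℕ}
    (hk : l.length ≤ k) : l.prod ∈ filt K H k :=
  Submodule.mem_sup_right (Submodule.subset_span ⟨l, hl, h2, hk, rfl⟩)

theorem commutators_le_primitives : commutators K H ≤ (primitives K H).toSubmodule := by
  refine Submodule.span_le.2 ?_
  rintro _ ⟨x, hx, y, hy, rfl⟩
  exact (primitives K H).lie_mem hx hy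

theorem sub_mem_commutators {x y : H} (hx : x ∈ primitives K H) (hy : y ∈ primitives K H) :
    x * y - y * x ∈ commutators K H :=
  Submodule.subset_span ⟨x, hx, y, hy, rfl⟩

/-- A commutator of primitives is again primitive, so its product with `x` counts as a product of
two primitives; this is why `k` must be at least 1. -/
theorem mul_mem_filt {x : H} (hx : x ∈ primitives K H) {k : ℕ} (hk : 1 ≤ k) {z : H}
    (hz : z ∈ filt K H k) : x * z ∈ filt K H (k + 1) := by
  obtain ⟨c, hc, t, ht, rfl⟩ := Submodule.mem_sup.1 hz
  rw [mul_add]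
  refine add_mem ?_ ?_
  · have := prod_mem_filt (K := K) (l := [x, c]) (k := k + 1) (by
      rintro y hy
      simp only [List.mem_cons, List.not_mem_nil, or_false] at hy
      rcases hy with rfl | rfl
      exacts [hx, commutators_le_primitives hc]) (by simp) (by simpa)
    simpa using this
  · refine Submodule.span_induction (p := fun t _ => x * t ∈ filt K H (k + 1)) ?_ (by simp)
      (fun a b _ _ ha hb => by rw [mul_add]; exact add_mem ha hb)
      (fun r a _ ha => by rw [mul_smul_comm]; exact Submodule.smul_mem _ _ ha) ht
    rintro _ ⟨l, hl, h2, hlk, rfl⟩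
    rw [← List.prod_cons]
    refine prod_mem_filt (fun y hy => ?_) (by simp; omega) (by simpa)
    rcases List.mem_cons.1 hy with rfl | hy
    exacts [hx, hl y hy]

/-- Exchanging two neighbours produces their commutator, a single primitive element, so the error
has one factor fewer; when there are no other factors it is itself a commutator. -/
theorem perm_sub_mem {l l' : List H} (h : l.Perm l') (hl : ∀ x ∈ l, x ∈ primitives K H) :
    l.prod - l'.prod ∈ filt K H (l.length - 1) := by
  induction h with
  | nil => simp
  | cons x h ih =>
    rename_i l₁ l₂
    have hx := hl x (by simp)
    have ih := ih fun y hy => hl y (by simp [hy])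
    rw [List.prod_cons, List.prod_cons, ← mul_sub]
    rcases Nat.lt_or_ge l₁.length 2 with h1 | h1
    · have : l₁ = l₂ := by
        rcases l₁ with _ | ⟨a, _ | ⟨b, l⟩⟩
        · simpa using h
        · exact (List.singleton_perm.1 h)
        · simp at h1
      simp [this]
    · have := mul_mem_filt hx (by omega) ih
      simp only [List.length_cons, Nat.add_sub_cancel]
      rwa [Nat.sub_add_cancel (by omega)] at this
  | swap x y l =>
    have hx := hl x (by simp)
    have hy := hl y (by simp)
    have e : (y :: x :: l).prod - (x :: y :: l).prod = (y * x - x * y) * l.prod := by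
      simp only [List.prod_cons]
      noncomm_ring
    rw [e]
    rcases l with _ | ⟨z, l⟩
    · rw [List.prod_nil, mul_one]
      exact Submodule.mem_sup_left (sub_mem_commutators hy hx)
    · rw [← List.prod_cons]
      refine prod_mem_filt (fun w hw => ?_) (by simp) (by simp)
      rcases List.mem_cons.1 hw with rfl | hw
      · exact commutators_le_primitives (sub_mem_commutators hy hx)
      · exact hl w (List.mem_cons_of_mem _ (List.mem_cons_of_mem _ hw))
  | trans h₁ h₂ ih₁ ih₂ =>
    rename_i l₁ l₂ l₃
    have i1 := ih₁ hl
    have i2 := ih₂ fun x hx => hl x (h₁.mem_iff.2 hx)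
    rw [← h₁.length_eq] at i2
    rw [← sub_add_sub_cancel l₁.prod l₂.prod l₃.prod]
    exact add_mem i1 i2

/-- The coproduct of each factor sends it to the left or to the right, hence the `2 ^ l.length`
pairs of complementary sublists. -/
theorem exists_comul_prod (l : List H) (hl : ∀ x ∈ l, x ∈ primitives K H) :
    ∃ L : List (List H × List H), L.length = 2 ^ l.length ∧ (∀ p ∈ L, l.Perm (p.1 ++ p.2)) ∧
      comul (R := K) l.prod = (L.map fun p => p.1.prod ⊗ₜ[K] p.2.prod).sum := by
  induction l with
  | nil => exact ⟨[([], [])], by simp, by simp, by simp [Algebra.TensorProduct.one_def]⟩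
  | cons x l ih =>
    obtain ⟨L, hL, hp, hs⟩ := ih fun y hy => hl y (List.mem_cons_of_mem _ hy)
    refine ⟨L.map (fun p => (x :: p.1, p.2)) ++ L.map (fun p => (p.1, x :: p.2)), ?_, ?_, ?_⟩
    · simp [hL, pow_succ]
      omega
    · intro p hp'
      simp only [List.mem_append, List.mem_map] at hp'
      rcases hp' with ⟨q, hq, rfl⟩ | ⟨q, hq, rfl⟩
      · exact (hp q hq).cons x
      · exact ((hp q hq).cons x).trans List.perm_middle.symm
    · rw [List.prod_cons, Bialgebra.comul_mul, hs, mem_iff.1 (hl x (by simp)), add_mul,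
        ← List.sum_map_mul_left, ← List.sum_map_mul_left, List.map_append, List.sum_append,
        List.map_map, List.map_map]
      simp [Function.comp_def]

/-- The convolution square of the identity. -/
noncomputable def sq : H →ₗ[K] H := LinearMap.mul' K H ∘ₗ comul

theorem sq_of_primitive {x : H} (hx : x ∈ primitives K H) : sq (K := K) x = (2 : K) • x := by
  rw [sq, LinearMap.comp_apply, mem_iff.1 hx]
  simp [two_smul]

/-- Each of the `2 ^ l.length` terms of the coproduct multiplies to a permutation of the product,
which equals it up to shorter products and commutators. -/
theorem sq_prod_sub_mem {l : List H} (hl : ∀ x ∈ l, x ∈ primitives K H) :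
    sq (K := K) l.prod - (2 ^ l.length : K) • l.prod ∈ filt K H (l.length - 1) := by
  obtain ⟨L, hL, hp, hs⟩ := exists_comul_prod l hl
  have h2 : (2 ^ l.length : K) = (L.length : K) := by rw [hL]; push_cast; rfl
  rw [sq, LinearMap.comp_apply, hs, h2, Nat.cast_smul_eq_nsmul, map_list_sum, List.map_map]
  clear hL hs h2
  induction L with
  | nil => simp
  | cons p L ih =>
    have e := ih fun q hq => hp q (List.mem_cons_of_mem _ hq)
    have := perm_sub_mem (K := K) (hp p (by simp)) hl
    rw [List.prod_append] at this
    simp only [List.map_cons, List.sum_cons, List.length_cons, Function.comp_apply,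
      LinearMap.mul'_apply, succ_nsmul] at e ⊢
    have h3 := sub_mem e this
    convert h3 using 1
    abel

/-- The convolution square is triangular on the filtration: it acts by `2 ^ k` on the top layer.
Commutators belong to every layer and need no eigenvalue, since the square maps them to their
doubles. -/
theorem sq_sub_mem {k : ℕ} (hk : 2 ≤ k) {x : H} (hx : x ∈ filt K H k) :
    sq (K := K) x - (2 ^ k : K) • x ∈ filt K H (k - 1) := by
  obtain ⟨c, hc, t, ht, rfl⟩ := Submodule.mem_sup.1 hx
  have hadd : ∀ a b : H, sq (K := K) (a + b) - (2 ^ k : K) • (a + b) =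
      (sq (K := K) a - (2 ^ k : K) • a) + (sq (K := K) b - (2 ^ k : K) • b) := fun a b => by
    rw [map_add, smul_add]; abel
  rw [hadd]
  refine add_mem ?_ ?_
  · rw [sq_of_primitive (commutators_le_primitives hc)]
    exact Submodule.mem_sup_left (sub_mem (Submodule.smul_mem _ _ hc) (Submodule.smul_mem _ _ hc))
  · refine Submodule.span_induction
      (p := fun t _ => sq (K := K) t - (2 ^ k : K) • t ∈ filt K H (k - 1)) ?_ (by simp)
      (fun a b _ _ ha hb => by rw [hadd]; exact add_mem ha hb)
      (fun r a _ ha => by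
        rw [map_smul, smul_comm, ← smul_sub]; exact Submodule.smul_mem _ _ ha) ht
    rintro _ ⟨l, hl, h2, hlk, rfl⟩
    have h1 := sq_prod_sub_mem hl
    rcases hlk.eq_or_lt with h | h
    · rwa [← h]
    · have h3 := add_mem (filt_mono (by omega : l.length - 1 ≤ k - 1) h1)
        (Submodule.smul_mem _ ((2 : K) ^ l.length - 2 ^ k)
          (prod_mem_filt hl h2 (by omega : l.length ≤ k - 1)))
      convert h3 using 1
      rw [sub_smul]
      abel

/-- In characteristic zero, a primitive element that is a combination of products of at least two
primitive elements is a combination of commutators. -/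
theorem mem_commutators [CharZero K] {k : ℕ} {x : H} (hx : x ∈ primitives K H)
    (hk : x ∈ filt K H k) : x ∈ commutators K H := by
  induction k with
  | zero => exact filt_le_commutators (by omega) hk
  | succ k ih =>
    rcases Nat.lt_or_ge k 1 with h | h
    · exact filt_le_commutators (by omega) hk
    -- On the primitive `x` the square is also multiplication by 2, so `(2 - 2 ^ (k + 1)) x` lies
    -- one step lower in the filtration, with a nonzero scalar.
    · have h1 := sq_sub_mem (by omega) hk
      rw [sq_of_primitive hx, ← sub_smul, Nat.add_sub_cancel] at h1
      refine ih ((Submodule.smul_mem_iff _ ?_).1 h1)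
      have : ((2 : ℕ) : K) ≠ ((2 ^ (k + 1) : ℕ) : K) := by
        rw [Ne, Nat.cast_inj, pow_succ]
        have := Nat.one_lt_two_pow (n := k) (by omega)
        omega
      push_cast at this
      exact sub_ne_zero.2 this

end Primitives

namespace FreeGrading

open Coalgebra

variable {K : Type u} {H : Type v} {X : Type*} [Field K] [Ring H] [Bialgebra K H]
  (F : FreeGrading K H X)

/-! #### Right independence in a free algebra -/

theorem mul_of_injective (x : X) :
    Function.Injective fun w : FreeMonoid X => w * FreeMonoid.of x :=
  fun _ _ h => mul_right_cancel h

/-- The right quotient by a generator. -/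
noncomputable def rd (x : X) : H →ₗ[K] H :=
  F.basis.repr.symm.toLinearMap ∘ₗ Finsupp.lcomapDomain _ (mul_of_injective x) ∘ₗ
    F.basis.repr.toLinearMap

theorem repr_rd (x : X) (h : H) (m : FreeMonoid X) :
    F.basis.repr (F.rd x h) m = F.basis.repr h (m * FreeMonoid.of x) := by
  simp [rd]

theorem rd_one (x : X) : F.rd x 1 = 0 := by
  classical
  refine F.basis.repr.injective (Finsupp.ext fun m => ?_)
  rw [repr_rd, ← F.basis_one, F.basis.repr_self, Finsupp.single_apply, if_neg]
  · simp
  · intro h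
    have := congrArg FreeMonoid.length h
    simp at this

theorem rd_mul_of (x : X) (a : FreeMonoid X) :
    F.rd x (F.basis (a * FreeMonoid.of x)) = F.basis a := by
  classical
  refine F.basis.repr.injective (Finsupp.ext fun m => ?_)
  rw [repr_rd, F.basis.repr_self, F.basis.repr_self, Finsupp.single_apply, Finsupp.single_apply]
  simp

theorem rd_mul_of_ne {x y : X} (h : x ≠ y) (a : FreeMonoid X) :
    F.rd x (F.basis (a * FreeMonoid.of y)) = 0 := by
  classical
  refine F.basis.repr.injective (Finsupp.ext fun m => ?_)
  rw [repr_rd, F.basis.repr_self, Finsupp.single_apply, if_neg]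
  · simp
  · intro h'
    have := congrArg (fun w => w.toList.getLast?) h'
    simp at this
    exact h this.symm

theorem eq_one_or_mul_of (w : FreeMonoid X) : w = 1 ∨ ∃ a y, w = a * FreeMonoid.of y := by
  rcases List.eq_nil_or_concat w.toList with h | ⟨l, y, h⟩
  · exact Or.inl h
  · exact Or.inr ⟨FreeMonoid.ofList l, y, by rw [← FreeMonoid.ofList_toList w, h]; simp⟩

/-- The last letter of a product is the last letter of the second factor, except for the constant
term of that factor, where it is that of the first. -/
theorem rd_mul (x : X) (u v : H) :
    F.rd x (u * v) = u * F.rd x v + counit (R := K) v • F.rd x u := by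
  have key : (LinearMap.mul K H).compr₂ (F.rd x) =
      (LinearMap.mul K H).compl₂ (F.rd x) +
        ((LinearMap.lsmul K H).flip.compl₁₂ (F.rd x) counit) := by
    refine F.basis.ext fun a => F.basis.ext fun b => ?_
    simp only [LinearMap.compr₂_apply, LinearMap.mul_apply', LinearMap.add_apply,
      LinearMap.compl₂_apply, LinearMap.compl₁₂_apply, LinearMap.flip_apply,
      LinearMap.lsmul_apply]
    rcases eq_one_or_mul_of b with rfl | ⟨b, y, rfl⟩
    · simp [F.basis_one, rd_one]
    · have hb : b * FreeMonoid.of y ≠ 1 := F.d_pos.1 (by have := F.d_of_pos y; rw [F.d_mul]; omega)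
      rw [F.counit_basis _ hb, zero_smul, add_zero, ← F.basis_mul, ← mul_assoc]
      by_cases hxy : x = y
      · subst hxy
        rw [rd_mul_of, rd_mul_of, F.basis_mul]
      · rw [rd_mul_of_ne F hxy, rd_mul_of_ne F hxy, mul_zero]
  exact LinearMap.congr_fun₂ key u v

theorem repr_one (h : H) : F.basis.repr h 1 = counit (R := K) h := by
  classical
  refine LinearMap.congr_fun (f := F.basis.coord 1) (F.basis.ext fun w => ?_) h
  rw [Module.Basis.coord_apply, F.basis.repr_self, Finsupp.single_apply]
  by_cases hw : w = 1
  · simp [hw, F.basis_one]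
  · rw [if_neg hw, F.counit_basis w hw]

/-- A family of elements of a free algebra is right independent if it is linearly independent
modulo the products of its elements by elements of the augmentation ideal. -/
theorem right_independent (F : FreeGrading K H X) {I : Type*} (w : I → H)
    (hw : ∀ c : I →₀ K, (c.sum fun i r => r • w i) ∈
      Submodule.span K {z | ∃ i h, counit (R := K) h = 0 ∧ z = w i * h} → c = 0)
    {h : I →₀ H} (h0 : (h.sum fun i y => w i * y) = 0) : h = 0 := by
  suffices ∀ m : FreeMonoid X, ∀ h : I →₀ H, (h.sum fun i y => w i * y) = 0 →
      ∀ i, F.basis.repr (h i) m = 0 from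
    Finsupp.ext fun i => F.basis.repr.injective (Finsupp.ext fun m => by simp [this m h h0 i])
  -- Splitting each coefficient into its constant and its augmentation part turns the relation into
  -- the hypothesis `hw`, so all constants vanish.
  have hcounit : ∀ h : I →₀ H, (h.sum fun i y => w i * y) = 0 → ∀ i, counit (R := K) (h i) = 0 := by
    intro h h0 i
    have := hw (h.mapRange counit (map_zero _)) (by
      rw [Finsupp.sum_mapRange_index (by simp)]
      have e : (h.sum fun i y => counit (R := K) y • w i) =
          - h.sum fun i y => w i * (y - algebraMap K H (counit y)) := by
        simp only [mul_sub, Finsupp.sum_sub, h0, ← Algebra.commutes, ← Algebra.smul_def]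
        simp
      rw [e]
      refine neg_mem (sum_mem fun i _ => Submodule.subset_span ⟨i, _, ?_, rfl⟩)
      simp)
    exact DFunLike.congr_fun this i
  intro m
  have hm : ∀ l : List X, ∀ h : I →₀ H, (h.sum fun i y => w i * y) = 0 →
      ∀ i, F.basis.repr (h i) (FreeMonoid.ofList l) = 0 := by
    intro l
    induction l using List.reverseRecOn with
    | nil =>
      intro h h0 i
      exact (F.repr_one _).trans (hcounit h h0 i)
    | append_singleton l x ih =>
      intro h h0 i
      have := ih (h.mapRange (F.rd x) (map_zero _)) (by
        rw [Finsupp.sum_mapRange_index (by simp)]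
        have e := congrArg (F.rd x) h0
        rw [map_finsuppSum, map_zero] at e
        rw [← e]
        -- As the coefficients have no constant term, `rd` acts on them alone and yields another
        -- relation; by induction, the coefficients are tested on words read from the right.
        refine Finsupp.sum_congr fun i _ => ?_
        rw [rd_mul, hcounit h h0 i, zero_smul, add_zero]) i
      rw [Finsupp.mapRange_apply, repr_rd] at this
      exact this
  exact hm m.toList

end FreeGrading

/-! ### Free subalgebras generated by right independent families -/

section Products

open Coalgebra

variable {K : Type u} {H : Type v} [Field K] [Ring H] [Bialgebra K H]

theorem cons_injective {I : Type*} (i : I) : Function.Injective (List.cons i) :=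
  fun _ _ h => (List.cons.inj h).2

/-- The monomials in a right independent family of elements of the augmentation ideal are
linearly independent. -/
theorem linearIndependent_prod {I : Type*} (w : I → H) (hε : ∀ i, counit (R := K) (w i) = 0)
    (hw : ∀ h : I →₀ H, (h.sum fun i y => w i * y) = 0 → h = 0) :
    LinearIndependent K fun l : List I => (l.map w).prod := by
  classical
  let T : (List I →₀ K) →ₗ[K] H := Finsupp.linearCombination K fun l : List I => (l.map w).prod
  have hT : ∀ l r, T (Finsupp.single l r) = r • (l.map w).prod := fun l r =>
    Finsupp.linearCombination_single K r l
  -- The combination is grouped by first letter. The counit isolates the empty word, and right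
  -- independence forces every group to vanish; each group is a combination of shorter monomials.
  let tails : (List I →₀ K) →ₗ[K] (I →₀ H) := Finsupp.linearCombination K fun l : List I =>
    match l with
    | [] => 0
    | i :: l => Finsupp.single i (l.map w).prod
  have h1 : ∀ c, T c = algebraMap K H (c []) + (tails c).sum fun i y => w i * y := by
    intro c
    induction c using Finsupp.induction_linear with
    | zero => simp
    | add a b ha hb =>
      rw [map_add, map_add, ha, hb, Finsupp.sum_add_index' (by simp) (by simp [mul_add]),
        Finsupp.add_apply, map_add]
      abel
    | single l r =>
      rw [hT]
      rcases l with _ | ⟨i, l⟩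
      · simp [tails, Algebra.smul_def]
      · simp [tails]
  have h2 : ∀ c i, tails c i = T (c.comapDomain (List.cons i) (cons_injective i).injOn) := by
    intro c i
    induction c using Finsupp.induction_linear with
    | zero => simp
    | add a b ha hb =>
      rw [map_add, Finsupp.add_apply, ha, hb, ← map_add]
      exact congrArg T (Finsupp.ext fun m => by simp)
    | single l r =>
      rcases l with _ | ⟨j, l⟩
      · have : (Finsupp.single [] r : List I →₀ K).comapDomain (List.cons i)
            (cons_injective i).injOn = 0 := by
          ext m; simp
        rw [this]
        simp [tails]
      · by_cases hij : j = i
        · subst hij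
          have : (Finsupp.single (j :: l) r : List I →₀ K).comapDomain (List.cons j)
              (cons_injective j).injOn = Finsupp.single l r := by
            ext m; simp [Finsupp.single_apply]
          rw [this, hT]
          simp [tails]
        · have : (Finsupp.single (j :: l) r : List I →₀ K).comapDomain (List.cons i)
              (cons_injective i).injOn = 0 := by
            ext m; simp [hij]
          rw [this]
          simp [tails, hij]
  rw [linearIndependent_iff]
  suffices ∀ m c, T c = 0 → c m = 0 from fun c hc => Finsupp.ext fun m => this m c hc
  have hnil : ∀ c, T c = 0 → c [] = 0 := by
    intro c hc
    have := congrArg (counit (R := K)) ((h1 c).symm.trans hc)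
    rw [map_add, Bialgebra.counit_algebraMap, map_finsuppSum] at this
    simpa [Bialgebra.counit_mul, hε] using this
  intro m
  induction m with
  | nil => exact hnil
  | cons i m ih =>
    intro c hc
    have h3 := h1 c
    rw [hc, hnil c hc, map_zero, zero_add] at h3
    have h4 := h2 c i
    rw [hw _ h3.symm, Finsupp.zero_apply] at h4
    simpa using ih _ h4.symm

/-- The morphism from the free algebra to `H` given by a right independent family of elements of
the augmentation ideal is injective. -/
theorem freeAlgebra_lift_injective {I : Type*} (w : I → H)
    (hε : ∀ i, counit (R := K) (w i) = 0)
    (hw : ∀ h : I →₀ H, (h.sum fun i y => w i * y) = 0 → h = 0) :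
    Function.Injective (FreeAlgebra.lift K w) := by
  have h : LinearIndependent K fun l : FreeMonoid I => (l.toList.map w).prod :=
    linearIndependent_prod w hε hw
  let e := FreeAlgebra.equivMonoidAlgebraFreeMonoid (R := K) (X := I)
  have he : FreeAlgebra.lift K w =
      (MonoidAlgebra.lift K H (FreeMonoid I) (FreeMonoid.lift w)).comp e.toAlgHom := by
    ext i
    simp [e, FreeAlgebra.equivMonoidAlgebraFreeMonoid]
  refine (injective_iff_map_eq_zero _).2 fun x hx => ?_
  rw [he, AlgHom.comp_apply, MonoidAlgebra.lift_apply] at hx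
  have := linearIndependent_iff.1 h (e x).coeff (by
    rw [Finsupp.linearCombination_apply, ← hx]
    simp only [FreeMonoid.lift_apply]
    rfl)
  exact e.injective (MonoidAlgebra.coeff_injective (by rw [this, map_zero]; rfl))

end Products

namespace FreeGrading

open Coalgebra

variable {K : Type u} {H : Type v} {X : Type*} [Field K] [Ring H] [Bialgebra K H]
  (F : FreeGrading K H X)

/-! #### Homogeneous components of primitive elements -/

theorem proj_mul (n : ℕ) (x y : H) :
    F.proj n (x * y) = ∑ p ∈ Finset.HasAntidiagonal.antidiagonal n, F.proj p.1 x * F.proj p.2 y := by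
  classical
  have key : (LinearMap.mul K H).compr₂ (F.proj n) = ∑ p ∈ Finset.HasAntidiagonal.antidiagonal n,
      (LinearMap.mul K H).compl₁₂ (F.proj p.1) (F.proj p.2) := by
    refine F.basis.ext fun a => F.basis.ext fun b => ?_
    simp only [LinearMap.compr₂_apply, LinearMap.mul_apply', LinearMap.sum_apply,
      LinearMap.compl₁₂_apply, proj_basis, ← F.basis_mul, F.d_mul]
    by_cases h : F.d a + F.d b = n
    · rw [if_pos h, Finset.sum_eq_single_of_mem (F.d a, F.d b) (by simpa)]
      · simp [F.basis_mul]
      · rintro ⟨i, j⟩ - hij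
        by_cases hi : F.d a = i
        · rw [if_neg (c := F.d b = j) (by rintro rfl; exact hij (by rw [hi])), mul_zero]
        · rw [if_neg hi, zero_mul]
    · rw [if_neg h, Finset.sum_eq_zero]
      rintro ⟨i, j⟩ hij
      rw [Finset.HasAntidiagonal.mem_antidiagonal] at hij
      by_cases hi : F.d a = i
      · rw [if_neg (c := F.d b = j) (by rintro rfl; exact h (by rw [← hij, hi])), mul_zero]
      · rw [if_neg hi, zero_mul]
  simpa using LinearMap.congr_fun₂ key x y

theorem comul_proj (n : ℕ) (x : H) : comul (R := K) (F.proj n x) =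
    ∑ p ∈ Finset.HasAntidiagonal.antidiagonal n, TensorProduct.map (F.proj p.1) (F.proj p.2) (comul x) := by
  classical
  suffices comul ∘ₗ F.proj n =
      (∑ p ∈ Finset.HasAntidiagonal.antidiagonal n, TensorProduct.map (F.proj p.1) (F.proj p.2)) ∘ₗ comul by
    simpa using LinearMap.congr_fun this x
  refine F.basis.ext fun w => ?_
  simp only [LinearMap.comp_apply, proj_basis]
  have h := F.comul_basis w
  change _ ∈ Submodule.span K {t | ∃ u v, F.d u + F.d v = F.d w ∧ _} at h
  have key : ∀ t ∈ Submodule.span K {t | ∃ u v, F.d u + F.d v = F.d w ∧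
      t = F.basis u ⊗ₜ[K] F.basis v}, (∑ p ∈ Finset.HasAntidiagonal.antidiagonal n,
        TensorProduct.map (F.proj p.1) (F.proj p.2)) t = if F.d w = n then t else 0 := by
    intro t ht
    induction ht using Submodule.span_induction with
    | mem t ht =>
      obtain ⟨a, b, hab, rfl⟩ := ht
      simp only [LinearMap.sum_apply, TensorProduct.map_tmul, proj_basis]
      split_ifs with hn
      · rw [Finset.sum_eq_single_of_mem (F.d a, F.d b) (by simpa [hab])]
        · simp
        · rintro ⟨i, j⟩ - hij
          by_cases hi : F.d a = i
          · rw [if_neg (c := F.d b = j) (by rintro rfl; exact hij (by rw [hi])),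
              TensorProduct.tmul_zero]
          · rw [if_neg hi, TensorProduct.zero_tmul]
      · refine Finset.sum_eq_zero ?_
        rintro ⟨i, j⟩ hij
        rw [Finset.HasAntidiagonal.mem_antidiagonal] at hij
        by_cases hi : F.d a = i
        · rw [if_neg (c := F.d b = j) (by rintro rfl; exact hn (by rw [← hij, ← hab, hi])),
            TensorProduct.tmul_zero]
        · rw [if_neg hi, TensorProduct.zero_tmul]
    | zero => simp
    | add a b _ _ ha hb => rw [map_add, ha, hb]; split_ifs <;> simp
    | smul c a _ ha => rw [map_smul, ha]; split_ifs <;> simp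
  rw [key _ h]
  split_ifs <;> simp

theorem proj_one (n : ℕ) : F.proj n (1 : H) = if n = 0 then 1 else 0 := by
  split_ifs with h
  · rw [h]; exact F.proj_of_mem F.one_mem
  · exact F.proj_of_mem_ne (Ne.symm h) F.one_mem

theorem proj_mem_primitives {x : H} (hx : x ∈ primitives K H) (n : ℕ) :
    F.proj n x ∈ primitives K H := by
  rw [Primitives.mem_iff, comul_proj, Primitives.mem_iff.1 hx]
  simp only [map_add, TensorProduct.map_tmul, Finset.sum_add_distrib, proj_one]
  congr 1
  · rw [Finset.sum_eq_single_of_mem (n, 0) (by simp)]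
    · simp
    · rintro ⟨i, j⟩ hij hne
      rw [if_neg, TensorProduct.tmul_zero]
      rintro rfl
      simp at hij hne
      exact hne hij
  · rw [Finset.sum_eq_single_of_mem (0, n) (by simp)]
    · simp
    · rintro ⟨i, j⟩ hij hne
      rw [if_neg, TensorProduct.zero_tmul]
      rintro rfl
      simp at hij hne
      exact hne hij

/-- The primitive elements of degree `n`. -/
def prim (n : ℕ) : Submodule K H := (primitives K H).toSubmodule ⊓ F.A n

theorem proj_mem_prim {x : H} (hx : x ∈ primitives K H) (n : ℕ) : F.proj n x ∈ F.prim n :=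
  ⟨F.proj_mem_primitives hx n, F.proj_mem n x⟩

theorem eq_zero_of_mem_prim_zero {x : H} (hx : x ∈ F.prim 0) : x = 0 := by
  rw [F.eq_algebraMap hx.2, Primitives.counit_eq_zero hx.1, map_zero]

/-- The span of the products of a primitive element and of a homogeneous element of degree at least
`s`, of total degree `n`. -/
def primMul (s n : ℕ) : Submodule K H :=
  Submodule.span K {z | ∃ i j p h, i + j = n ∧ s ≤ j ∧ p ∈ F.prim i ∧ h ∈ F.A j ∧ z = p * h}

theorem mul_mem_primMul {s i j : ℕ} (hs : s ≤ j) {p h : H} (hp : p ∈ F.prim i) (hh : h ∈ F.A j) :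
    p * h ∈ F.primMul s (i + j) :=
  Submodule.subset_span ⟨i, j, p, h, rfl, hs, hp, hh, rfl⟩

theorem proj_mul_mem_primMul {s : ℕ} {p h : H} (hp : p ∈ primitives K H)
    (hh : ∀ j < s, F.proj j h = 0) (n : ℕ) : F.proj n (p * h) ∈ F.primMul s n := by
  rw [proj_mul]
  refine sum_mem fun q hq => ?_
  rw [← Finset.HasAntidiagonal.mem_antidiagonal.1 hq]
  rcases Nat.lt_or_ge q.2 s with h1 | h1
  · rw [hh _ h1, mul_zero]
    exact zero_mem _
  · exact F.mul_mem_primMul h1 (F.proj_mem_prim hp _) (F.proj_mem _ _)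

/-- A homogeneous family of primitive elements that is a basis, degree by degree, of a complement
of the decomposable ones. -/
structure PrimFamily where
  /-- the index set -/
  I : Type v
  /-- the elements -/
  w : I → H
  /-- their degrees -/
  dg : I → ℕ
  mem : ∀ i, w i ∈ F.prim (dg i)
  pos : ∀ i, 0 < dg i
  exhaust : ∀ n, F.prim n ≤ Submodule.span K (w '' {i | dg i = n}) ⊔ (F.prim n ⊓ F.primMul 1 n)
  indep : ∀ n, ∀ c : I →₀ K, F.proj n (c.sum fun i r => r • w i) ∈ F.primMul 1 n →
    ∀ i, dg i = n → c i = 0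

theorem nonempty_primFamily : Nonempty F.PrimFamily := by
  classical
  have hex : ∀ n, ∃ W : Submodule K H, W ≤ F.prim n ∧ Disjoint W (F.prim n ⊓ F.primMul 1 n) ∧
      F.prim n ≤ W ⊔ (F.prim n ⊓ F.primMul 1 n) := by
    intro n
    -- A complement in all of `H` is cut down to `prim n`; the modular law keeps it a complement
    -- there.
    obtain ⟨C, hC⟩ := exists_isCompl (F.prim n ⊓ F.primMul 1 n)
    refine ⟨C ⊓ F.prim n, inf_le_right, hC.symm.disjoint.mono_left inf_le_left, ?_⟩
    rw [sup_comm, ← sup_inf_assoc_of_le _ inf_le_left, hC.sup_eq_top, top_inf_eq]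
  choose W hW hd hs using hex
  let b : ∀ n, Module.Basis (Module.Basis.ofVectorSpaceIndex K (W n)) K (W n) :=
    fun n => Module.Basis.ofVectorSpace K (W n)
  have hmem : ∀ n j, ((b n j : W n) : H) ∈ F.prim n := fun n j => hW n (b n j).2
  let s : ∀ n, Module.Basis.ofVectorSpaceIndex K (W n) →
    Σ n, Module.Basis.ofVectorSpaceIndex K (W n) := fun n j => ⟨n, j⟩
  have hsi : ∀ n, Function.Injective (s n) := fun n i j h => by
    simpa [s] using h
  refine ⟨⟨Σ n, Module.Basis.ofVectorSpaceIndex K (W n), fun i => (b i.1 i.2 : H), fun i => i.1,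
    fun i => hmem _ _, fun i => ?_, fun n => ?_, fun n c hc => ?_⟩⟩
  · rcases Nat.eq_zero_or_pos i.1 with h | h
    · obtain ⟨n, j⟩ := i
      dsimp only at h
      subst h
      exact absurd (Subtype.ext (F.eq_zero_of_mem_prim_zero (hmem 0 j))) ((b 0).ne_zero j)
    · exact h
  · refine (hs n).trans (sup_le_sup_right (fun x hx => ?_) _)
    have := Submodule.mem_map_of_mem (f := (W n).subtype) ((b n).mem_span ⟨x, hx⟩)
    rw [Submodule.map_span] at this
    refine Submodule.span_mono ?_ this
    rintro _ ⟨_, ⟨j, rfl⟩, rfl⟩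
    exact ⟨⟨n, j⟩, rfl, rfl⟩
  · have key : F.proj n (c.sum fun i r => r • (b i.1 i.2 : H)) =
        (Finsupp.linearCombination K (b n)
          (c.comapDomain (s n) (hsi n).injOn) : W n) := by
      clear hc
      induction c using Finsupp.induction_linear with
      | zero => simp
      | add x y hx hy =>
        rw [Finsupp.sum_add_index' (by simp) (by simp [add_smul]), map_add, hx, hy,
          Finsupp.comapDomain_add_of_injective (hsi n), map_add, Submodule.coe_add]
      | single i r =>
        obtain ⟨m, j⟩ := i
        rw [Finsupp.sum_single_index (by simp), map_smul]
        by_cases hmn : m = n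
        · subst hmn
          rw [show (Finsupp.single ⟨m, j⟩ r : (Σ n, Module.Basis.ofVectorSpaceIndex K (W n)) →₀ K) =
            Finsupp.single (s m j) r from rfl, Finsupp.comapDomain_single, F.proj_of_mem (hmem _ _).2]
          simp
        · have : (Finsupp.single ⟨m, j⟩ r : (Σ n, Module.Basis.ofVectorSpaceIndex K (W n)) →₀ K
              ).comapDomain (s n) (hsi n).injOn = 0 := by
            ext k
            simp [s, hmn]
          rw [this, F.proj_of_mem_ne hmn (hmem _ _).2]
          simp
    rw [key] at hc
    have h0 := (Submodule.disjoint_def.1 (hd n)) _ (Subtype.prop _) ⟨hW n (Subtype.prop _), hc⟩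
    have h1 := linearIndependent_iff.1 (b n).linearIndependent _ (Subtype.ext h0)
    rintro ⟨m, j⟩ hm
    dsimp only at hm
    subst hm
    exact DFunLike.congr_fun h1 j

/-! ### The Lie algebra of primitive elements is free -/

namespace PrimFamily

variable {F} (G : F.PrimFamily)

/-- A relation modulo the products of the family by the augmentation ideal is projected to one
degree, where it contradicts the choice of a complement of the decomposable primitives. -/
theorem right_independent {h : G.I →₀ H} (h0 : (h.sum fun i y => G.w i * y) = 0) : h = 0 := by
  refine F.right_independent (K := K) G.w (fun c hc => ?_) h0
  refine Finsupp.ext fun i => G.indep _ c ?_ i rfl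
  refine Submodule.span_induction (p := fun x _ => F.proj (G.dg i) x ∈ F.primMul 1 (G.dg i))
    ?_ (by simp) (fun x y _ _ hx hy => by rw [map_add]; exact add_mem hx hy)
    (fun r x _ hx => by rw [map_smul]; exact Submodule.smul_mem _ _ hx) hc
  rintro _ ⟨k, y, hy, rfl⟩
  refine F.proj_mul_mem_primMul (G.mem k).1 (fun j hj => ?_) _
  obtain rfl : j = 0 := by omega
  have h1 := F.proj_mem 0 y
  rw [F.eq_algebraMap h1]
  have h2 : counit (R := K) (F.proj 0 y) = counit y := by
    refine LinearMap.congr_fun (f := counit ∘ₗ F.proj 0) (F.hom_ext fun n x hx => ?_) y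
    rcases eq_or_ne n 0 with rfl | hn
    · rw [LinearMap.comp_apply, F.proj_of_mem hx]
    · rw [LinearMap.comp_apply, F.proj_of_mem_ne hn hx, F.counit_eq_zero hn hx, map_zero]
  rw [h2, hy, map_zero]

theorem lift_injective : Function.Injective (FreeAlgebra.lift K G.w) :=
  freeAlgebra_lift_injective G.w (fun i => Primitives.counit_eq_zero (G.mem i).1)
    fun _ => G.right_independent

/-- The elements of degree `n` of the right ideal generated by the family. -/
def ideal (s n : ℕ) : Submodule K H :=
  Submodule.span K {z | ∃ i j h, G.dg i + j = n ∧ s ≤ j ∧ h ∈ F.A j ∧ z = G.w i * h}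

theorem ideal_mul {s m j : ℕ} (hs : s ≤ j) {x h : H} (hx : x ∈ G.ideal 0 m) (hh : h ∈ F.A j) :
    x * h ∈ G.ideal s (m + j) := by
  refine Submodule.span_induction (p := fun x _ => x * h ∈ G.ideal s (m + j)) ?_ (by simp)
    (fun x y _ _ hx hy => by rw [add_mul]; exact add_mem hx hy)
    (fun r x _ hx => by rw [smul_mul_assoc]; exact Submodule.smul_mem _ _ hx) hx
  rintro _ ⟨i, e, y, hi, -, hy, rfl⟩
  exact Submodule.subset_span ⟨i, e + j, y * h, by omega, by omega, F.mul_mem hy hh, mul_assoc _ _ _⟩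

/-- A decomposable primitive is a sum of products `p * h` with `h` of positive degree, so `p` has
smaller degree and induction applies. The family therefore generates the right ideal of all
primitive elements. -/
theorem prim_le_ideal (n : ℕ) : F.prim n ≤ G.ideal 0 n := by
  induction n using Nat.strong_induction_on with
  | _ n ih =>
    refine (G.exhaust n).trans (sup_le (Submodule.span_le.2 ?_) (inf_le_right.trans
      (Submodule.span_le.2 ?_)))
    · rintro _ ⟨i, rfl, rfl⟩
      exact Submodule.subset_span ⟨i, 0, 1, by simp, le_rfl, F.one_mem, by simp⟩
    · rintro _ ⟨i, j, p, h, rfl, hj, hp, hh, rfl⟩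
      exact G.ideal_mul (Nat.zero_le _) (ih i (by omega) hp) hh

theorem primMul_le_ideal (s n : ℕ) : F.primMul s n ≤ G.ideal s n := by
  refine Submodule.span_le.2 ?_
  rintro _ ⟨i, j, p, h, rfl, hj, hp, hh, rfl⟩
  exact G.ideal_mul hj (G.prim_le_ideal i hp) hh

theorem exists_coeffs {s n : ℕ} {x : H} (hx : x ∈ F.primMul s n) :
    ∃ h : G.I →₀ H, (h.sum fun i y => G.w i * y) = x ∧
      ∀ i, h i = 0 ∨ ∃ j, G.dg i + j = n ∧ s ≤ j ∧ h i ∈ F.A j := by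
  classical
  refine Submodule.span_induction (p := fun x _ => ∃ h : G.I →₀ H,
    (h.sum fun i y => G.w i * y) = x ∧ ∀ i, h i = 0 ∨ ∃ j, G.dg i + j = n ∧ s ≤ j ∧ h i ∈ F.A j)
    ?_ ⟨0, by simp⟩ ?_ ?_ (G.primMul_le_ideal s n hx)
  · rintro _ ⟨i, j, y, hi, hj, hy, rfl⟩
    refine ⟨Finsupp.single i y, Finsupp.sum_single_index (by simp), fun k => ?_⟩
    by_cases hk : i = k
    · subst hk
      exact Or.inr ⟨j, hi, hj, by simpa using hy⟩
    · exact Or.inl (by simp [hk])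
  · rintro _ _ - - ⟨h, rfl, hh⟩ ⟨k, rfl, hk⟩
    refine ⟨h + k, Finsupp.sum_add_index' (by simp) (by simp [mul_add]), fun i => ?_⟩
    rcases hh i with h0 | ⟨j, hj⟩
    · simpa [h0] using hk i
    · rcases hk i with h0 | ⟨j', hj'⟩
      · exact Or.inr ⟨j, by simpa [h0] using hj⟩
      · obtain rfl : j = j' := by omega
        exact Or.inr ⟨j, hj.1, hj.2.1, add_mem hj.2.2 hj'.2.2⟩
  · rintro r _ - ⟨h, rfl, hh⟩
    refine ⟨r • h, ?_, fun i => ?_⟩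
    · rw [Finsupp.sum_smul_index' (by simp), Finsupp.smul_sum]
      simp
    · rcases hh i with h0 | ⟨j, hj⟩
      · simp [h0]
      · exact Or.inr ⟨j, hj.1, hj.2.1, Submodule.smul_mem _ _ hj.2.2⟩

variable (K H) in
/-- The linear forms that vanish on the right ideal generated by the primitive elements. -/
def forms : Submodule K (Module.Dual K H) :=
  (Submodule.span K {z : H | ∃ p ∈ primitives K H, ∃ h, z = p * h}).dualAnnihilator

theorem forms_apply {θ : Module.Dual K H} (hθ : θ ∈ forms K H) {p : H} (hp : p ∈ primitives K H)
    (h : H) : θ (p * h) = 0 :=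
  (Submodule.mem_dualAnnihilator _).1 hθ _ (Submodule.subset_span ⟨p, hp, h, rfl⟩)

/-- The contraction of the coproduct by a linear form. -/
noncomputable def tau (θ : Module.Dual K H) : H →ₗ[K] H :=
  (TensorProduct.rid K H).toLinearMap ∘ₗ θ.lTensor H ∘ₗ comul

/-- Applying the counit to the other tensor factor recovers `θ`, so the values of `θ` can be read
from the contraction. -/
theorem counit_tau (θ : Module.Dual K H) (h : H) : counit (R := K) (tau θ h) = θ h := by
  have e : ∀ t : H ⊗[K] H, counit (R := K) (TensorProduct.rid K H (θ.lTensor H t)) =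
      θ (TensorProduct.lid K H (counit.rTensor H t)) := by
    intro t
    induction t using TensorProduct.induction_on with
    | zero => simp
    | tmul x y => simp [mul_comm]
    | add a b ha hb => simp only [map_add, ha, hb]
  simp [tau, e]

/-- Of the two terms of the coproduct of `p`, the one that multiplies the right tensor factor by `p`
is killed by `θ`. Contraction is therefore linear over left multiplication by primitives. -/
theorem tau_mul {θ : Module.Dual K H} (hθ : θ ∈ forms K H) {p : H} (hp : p ∈ primitives K H)
    (h : H) : tau θ (p * h) = p * tau θ h := by
  have e : ∀ t : H ⊗[K] H, TensorProduct.rid K H (θ.lTensor H ((p ⊗ₜ 1 + 1 ⊗ₜ p) * t)) =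
      p * TensorProduct.rid K H (θ.lTensor H t) := by
    intro t
    induction t using TensorProduct.induction_on with
    | zero => simp
    | tmul x y => simp [add_mul, forms_apply hθ hp]
    | add a b ha hb => simp only [mul_add, map_add] at ha hb ⊢; rw [ha, hb]
  simp only [tau, LinearMap.comp_apply, LinearEquiv.coe_coe, Bialgebra.comul_mul,
    Primitives.mem_iff.1 hp, e]

theorem tau_primitive (θ : Module.Dual K H) {p : H} (hp : p ∈ primitives K H) :
    tau θ p = θ 1 • p + θ p • 1 := by
  simp [tau, Primitives.mem_iff.1 hp]

/-- `tau θ - θ 1` commutes with left multiplication by the family, so right independence carries its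
vanishing from `x` to each coefficient of `x`. -/
theorem coeffs_tau {h : G.I →₀ H} {x : H} (hx : (h.sum fun i y => G.w i * y) = x)
    {θ : Module.Dual K H} (hθ : θ ∈ forms K H) (ht : tau θ x = θ 1 • x) (i : G.I) :
    tau θ (h i) = θ 1 • h i := by
  let L : H →ₗ[K] H := tau θ - θ 1 • LinearMap.id
  have hL : ∀ y, L y = tau θ y - θ 1 • y := fun _ => rfl
  have := G.right_independent (h := h.mapRange L (map_zero L)) (by
    rw [Finsupp.sum_mapRange_index (by simp)]
    simp only [hL, mul_sub, mul_smul_comm, Finsupp.sum_sub]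
    rw [← Finsupp.smul_sum, hx, ← ht, ← hx, map_finsuppSum, sub_eq_zero]
    exact Finsupp.sum_congr fun k _ => (tau_mul hθ (G.mem k).1 _).symm)
  simpa [hL, sub_eq_zero] using DFunLike.congr_fun this i

variable (K H) in
/-- The span of the products of at least `m` primitive elements. -/
def products (m : ℕ) : Submodule K H :=
  Submodule.span K {z | ∃ l : List H, (∀ x ∈ l, x ∈ primitives K H) ∧ m ≤ l.length ∧ z = l.prod}

theorem mul_mem_products {m : ℕ} {p x : H} (hp : p ∈ primitives K H) (hx : x ∈ products K H m) :
    p * x ∈ products K H (m + 1) := by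
  refine Submodule.span_induction (p := fun x _ => p * x ∈ products K H (m + 1)) ?_ (by simp)
    (fun x y _ _ hx hy => by rw [mul_add]; exact add_mem hx hy)
    (fun r x _ hx => by rw [mul_smul_comm]; exact Submodule.smul_mem _ _ hx) hx
  rintro _ ⟨l, hl, hm, rfl⟩
  refine Submodule.subset_span ⟨p :: l, fun y hy => ?_, by simpa, by simp⟩
  rcases List.mem_cons.1 hy with rfl | hy
  exacts [hp, hl y hy]

theorem exists_mem_filt {x : H} (hx : x ∈ products K H 2) : ∃ k, x ∈ Primitives.filt K H k := by
  refine Submodule.span_induction (p := fun x _ => ∃ k, x ∈ Primitives.filt K H k) ?_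
    ⟨0, by simp⟩ ?_ ?_ hx
  · rintro _ ⟨l, hl, h2, rfl⟩
    exact ⟨_, Primitives.prod_mem_filt hl h2 le_rfl⟩
  · rintro _ _ - - ⟨i, hi⟩ ⟨j, hj⟩
    exact ⟨max i j, add_mem (Primitives.filt_mono (le_max_left _ _) hi)
      (Primitives.filt_mono (le_max_right _ _) hj)⟩
  · rintro r _ - ⟨i, hi⟩
    exact ⟨i, Submodule.smul_mem _ _ hi⟩

/-- The right ideal generated by the primitives equals its double annihilator; projection to degree
`n` then makes the factors homogeneous. -/
theorem mem_primMul_zero {n : ℕ} {h : H} (hn : h ∈ F.A n)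
    (h0 : ∀ θ ∈ forms K H, θ h = 0) : h ∈ F.primMul 0 n := by
  rw [← F.proj_of_mem hn]
  refine Submodule.span_induction (p := fun x _ => F.proj n x ∈ F.primMul 0 n) ?_ (by simp)
    (fun x y _ _ hx hy => by rw [map_add]; exact add_mem hx hy)
    (fun r x _ hx => by rw [map_smul]; exact Submodule.smul_mem _ _ hx)
    ((Subspace.forall_mem_dualAnnihilator_apply_eq_zero_iff _ h).1 h0)
  rintro _ ⟨p, hp, y, rfl⟩
  exact F.proj_mul_mem_primMul hp (by simp) n

/-- The counit turns the eigen-condition into `θ h = 0`, so `h` lies in the right ideal generated by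
the primitives. Its coefficients on the family inherit the condition and have smaller degree, so the
expansion continues until they are constants. -/
theorem mem_products (G : F.PrimFamily) (n : ℕ) {h : H} (hn : h ∈ F.A n) (hpos : 0 < n)
    (ht : ∀ θ ∈ forms K H, tau θ h = θ 1 • h) : h ∈ products K H 1 := by
  induction n using Nat.strong_induction_on generalizing h with
  | _ n ih =>
    obtain ⟨y, rfl, hy⟩ := G.exists_coeffs (mem_primMul_zero hn fun θ hθ => by
      rw [← counit_tau, ht θ hθ, map_smul, F.counit_eq_zero hpos.ne' hn, smul_zero])
    refine sum_mem fun i _ => ?_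
    rcases hy i with h0 | ⟨j, hj, -, hyj⟩
    · simp [h0]
    · rcases Nat.eq_zero_or_pos j with rfl | h
      · refine mul_mem_products (m := 0) (G.mem i).1 ?_
        rw [F.eq_algebraMap hyj, Algebra.algebraMap_eq_smul_one]
        exact Submodule.smul_mem _ _ (Submodule.subset_span ⟨[], by simp, by simp, by simp⟩)
      · have := G.pos i
        refine Submodule.span_mono ?_ (mul_mem_products (m := 1) (G.mem i).1
          (ih j (by omega) hyj h fun θ hθ => G.coeffs_tau rfl hθ (ht θ hθ) i))
        rintro _ ⟨l, hl, h2, rfl⟩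
        exact ⟨l, hl, by omega, rfl⟩

/-- For `θ` in `forms`, a primitive `x` in this ideal satisfies `tau θ x = θ 1 • x`. Its
coefficients, of positive degree, inherit this condition and are thus combinations of products of
primitives. So `x` is a combination of products of at least two primitives, and the eigenvalue
argument applies. -/
theorem mem_commutators (G : F.PrimFamily) [CharZero K] {n : ℕ} {x : H} (hx : x ∈ F.prim n)
    (h1 : x ∈ F.primMul 1 n) : x ∈ Primitives.commutators K H := by
  obtain ⟨y, hxy, hy⟩ := G.exists_coeffs h1
  suffices x ∈ products K H 2 by
    obtain ⟨k, hk⟩ := exists_mem_filt this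
    exact Primitives.mem_commutators hx.1 hk
  have ht : ∀ θ ∈ forms K H, tau θ x = θ 1 • x := by
    intro θ hθ
    have : θ x = 0 := by
      refine Submodule.span_induction (p := fun x _ => θ x = 0) ?_ (by simp)
        (fun x y _ _ hx hy => by rw [map_add, hx, hy, add_zero])
        (fun r x _ hx => by rw [map_smul, hx, smul_zero]) h1
      rintro _ ⟨i, j, p, h, -, -, hp, -, rfl⟩
      exact forms_apply hθ hp.1 h
    rw [tau_primitive θ hx.1, this, zero_smul, add_zero]
  have hc := fun i θ hθ => G.coeffs_tau hxy hθ (ht θ hθ) i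
  rw [← hxy]
  refine sum_mem fun i _ => ?_
  rcases hy i with h0 | ⟨j, hj, hj1, hyj⟩
  · simp [h0]
  · exact mul_mem_products (G.mem i).1 (G.mem_products j hyj (by omega) (hc i))

/-- The morphism of Lie algebras from the free Lie algebra to the Lie algebra of primitive
elements. -/
noncomputable def lieLift : FreeLieAlgebra K G.I →ₗ⁅K⁆ primitives K H :=
  FreeLieAlgebra.lift K fun i => ⟨G.w i, (G.mem i).1⟩

theorem lieLift_injective [CharZero K] : Function.Injective G.lieLift := by
  have e : (primitives K H).incl.comp G.lieLift = (FreeAlgebra.lift K G.w : _ →ₗ⁅K⁆ H).comp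
      (FreeLieAlgebra.lift K (FreeAlgebra.ι K : G.I → FreeAlgebra K G.I)) := by
    refine FreeLieAlgebra.hom_ext fun i => ?_
    simp [lieLift]
  have h : Function.Injective ((primitives K H).incl.comp G.lieLift) := by
    rw [e]
    exact G.lift_injective.comp FreeLieAlgebra.lift_ι_injective
  exact fun x y hxy => h (congrArg Subtype.val hxy)

/-- Primitives outside the span of the family are sums of commutators; taking homogeneous
components, these are brackets of primitives of smaller positive degrees, which lie in the range by
induction. -/
theorem prim_le_range [CharZero K] (n : ℕ) :
    F.prim n ≤ ((primitives K H).incl.comp G.lieLift).range.toSubmodule := by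
  induction n using Nat.strong_induction_on with
  | _ n ih =>
    refine (G.exhaust n).trans (sup_le (Submodule.span_le.2 ?_) fun x hx => ?_)
    · rintro _ ⟨i, -, rfl⟩
      exact ⟨FreeLieAlgebra.of K i, by simp [lieLift]⟩
    · rw [← F.proj_of_mem hx.1.2]
      refine Submodule.span_induction (p := fun x _ => F.proj n x ∈
        ((primitives K H).incl.comp G.lieLift).range.toSubmodule) ?_ (by simp)
        (fun x y _ _ hx hy => by rw [map_add]; exact add_mem hx hy)
        (fun r x _ hx => by rw [map_smul]; exact Submodule.smul_mem _ _ hx)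
        (G.mem_commutators hx.1 hx.2)
      rintro _ ⟨p, hp, q, hq, rfl⟩
      rw [map_sub, F.proj_mul n p q, F.proj_mul n q p, ← Finset.Nat.sum_antidiagonal_swap (n := n)
        (f := fun r => F.proj r.1 q * F.proj r.2 p), ← Finset.sum_sub_distrib]
      refine sum_mem fun r hr => ?_
      have hr := Finset.HasAntidiagonal.mem_antidiagonal.1 hr
      have h1 := F.proj_mem_prim hp r.1
      have h2 := F.proj_mem_prim hq r.2
      rcases Nat.eq_zero_or_pos r.1 with h | h
      · rw [h] at h1
        simp [h, F.eq_zero_of_mem_prim_zero h1]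
      rcases Nat.eq_zero_or_pos r.2 with h' | h'
      · rw [h'] at h2
        simp [h', F.eq_zero_of_mem_prim_zero h2]
      exact LieSubalgebra.lie_mem _ (ih r.1 (by omega) h1) (ih r.2 (by omega) h2)

theorem lieLift_surjective [CharZero K] : Function.Surjective G.lieLift := by
  rintro ⟨x, hx⟩
  obtain ⟨N, hN⟩ := F.exists_sum_proj x
  have : x ∈ ((primitives K H).incl.comp G.lieLift).range.toSubmodule := by
    rw [hN N le_rfl]
    exact sum_mem fun n _ => G.prim_le_range n (F.proj_mem_prim hx n)
  obtain ⟨y, hy⟩ := this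
  exact ⟨y, Subtype.ext hy⟩

end PrimFamily

/-- In characteristic zero, the Lie algebra of primitive elements of a graded connected bialgebra
whose underlying algebra is free is a free Lie algebra. -/
theorem isFreeLieAlgebra (F : FreeGrading K H X) [CharZero K] : IsFreeLieAlgebra K (primitives K H) := by
  obtain ⟨G⟩ := F.nonempty_primFamily
  exact ⟨G.I, ⟨(LieEquiv.ofBijective G.lieLift
    ⟨G.lieLift_injective, G.lieLift_surjective⟩).symm⟩⟩

end FreeGrading

/-! ### Monoids with Levi's property -/

section Levi

variable {M : Type*} [Monoid M]

/-- The atoms of a monoid: the elements other than `1` that are not products of two elements other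
than `1`. -/
def atoms (M : Type*) [Monoid M] : Set M := {a | a ≠ 1 ∧ ∀ x y, a = x * y → x = 1 ∨ y = 1}

/-- A monoid with Levi's property and an additive degree that is positive outside `1` is free on its
atoms. -/
theorem bijective_lift_atoms (d : M → ℕ) (hmul : ∀ x y, d (x * y) = d x + d y)
    (hd : ∀ x, d x = 0 → x = 1)
    (levi : ∀ a b x y : M, a * b = x * y → ∃ u, (a = x * u ∧ y = u * b) ∨ (x = a * u ∧ b = u * y)) :
    Function.Bijective (FreeMonoid.lift fun a : atoms M => (a : M)) := by
  have hone : ∀ x y : M, x * y = 1 → x = 1 := by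
    intro x y h
    have h1 := hmul 1 1
    rw [mul_one] at h1
    have h2 := hmul x y
    rw [h] at h2
    exact hd x (by omega)
  constructor
  · intro w
    induction w using FreeMonoid.inductionOn' with
    | one =>
      intro w' h
      induction w' using FreeMonoid.casesOn with
      | one => rfl
      | of_mul a l =>
        rw [map_one, map_mul, FreeMonoid.lift_eval_of] at h
        exact absurd (hone _ _ h.symm) a.2.1
    | of_mul a l ih =>
      intro w' h
      induction w' using FreeMonoid.casesOn with
      | one =>
        rw [map_one, map_mul, FreeMonoid.lift_eval_of] at h
        exact absurd (hone _ _ h) a.2.1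
      | of_mul c l' =>
        rw [map_mul, map_mul, FreeMonoid.lift_eval_of, FreeMonoid.lift_eval_of] at h
        -- Two atoms that begin the same product differ by a factor `u`, which must be 1 because an
        -- atom does not factor and neither atom is 1.
        obtain ⟨u, ⟨h1, h2⟩ | ⟨h1, h2⟩⟩ := levi _ _ _ _ h
        · obtain rfl : u = 1 := (a.2.2 _ _ h1).resolve_left c.2.1
          rw [mul_one] at h1
          rw [one_mul] at h2
          rw [Subtype.ext h1, ih h2.symm]
        · obtain rfl : u = 1 := (c.2.2 _ _ h1).resolve_left a.2.1
          rw [mul_one] at h1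
          rw [one_mul] at h2
          rw [Subtype.ext h1, ih h2]
  · intro x
    induction hn : d x using Nat.strong_induction_on generalizing x with
    | _ n ih =>
      by_cases h1 : x = 1
      · exact ⟨1, by rw [map_one, h1]⟩
      by_cases hx : x ∈ atoms M
      · exact ⟨FreeMonoid.of ⟨x, hx⟩, by rw [FreeMonoid.lift_eval_of]⟩
      · simp only [atoms, Set.mem_ofPred_eq, not_and, not_forall, not_or] at hx
        obtain ⟨y, z, rfl, hy, hz⟩ := hx h1
        have hy' : d y ≠ 0 := fun h => hy (hd y h)
        have hz' : d z ≠ 0 := fun h => hz (hd z h)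
        rw [hmul] at hn
        obtain ⟨v, rfl⟩ := ih _ (by omega) y rfl
        obtain ⟨w, rfl⟩ := ih _ (by omega) z rfl
        exact ⟨v * w, map_mul _ _ _⟩

end Levi

namespace DoublePoset

variable {α β γ δ : Type}

/-! ### Decompositions for the composition -/

/-- Every element of `A` is smaller than every element of `B` for the second order, and not
comparable to it for the first one. -/
def Precedes (T : DoublePoset α) (A B : Set α) : Prop :=
  ∀ x ∈ A, ∀ y ∈ B, T.le₂ x y ∧ ¬ T.le₁ x y ∧ ¬ T.le₁ y x

theorem Precedes.mono {T : DoublePoset α} {A B A' B' : Set α} (h : T.Precedes A B) (hA : A' ⊆ A)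
    (hB : B' ⊆ B) : T.Precedes A' B' := fun x hx y hy => h x (hA hx) y (hB hy)

theorem Precedes.disjoint {T : DoublePoset α} {A B : Set α} (h : T.Precedes A B) :
    Disjoint A B :=
  Set.disjoint_left.2 fun x hx hy => (h x hx x hy).2.1 (T.refl₁ x)

theorem restrict_union_iso {T : DoublePoset α} {A B : Set α} (h : T.Precedes A B) :
    (T.restrict (A ∪ B)).Iso ((T.restrict A).comp (T.restrict B)) := by
  let f : A ⊕ B → ↑(A ∪ B) := Sum.elim (fun x => ⟨x, Or.inl x.2⟩) fun x => ⟨x, Or.inr x.2⟩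
  have hne : ∀ x ∈ A, ∀ y ∈ B, x ≠ y := fun x hx y hy hxy => by
    subst hxy
    exact Set.disjoint_left.1 h.disjoint hx hy
  have hf : Function.Bijective f := by
    constructor
    · rintro (x | x) (y | y) hxy <;> replace hxy := congrArg Subtype.val hxy
      · exact congrArg Sum.inl (Subtype.ext hxy)
      · exact absurd hxy (hne _ x.2 _ y.2)
      · exact absurd hxy.symm (hne _ y.2 _ x.2)
      · exact congrArg Sum.inr (Subtype.ext hxy)
    · rintro ⟨x, hx | hx⟩
      exacts [⟨.inl ⟨x, hx⟩, rfl⟩, ⟨.inr ⟨x, hx⟩, rfl⟩]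
  refine Iso.symm ⟨Equiv.ofBijective f hf, ?_, ?_⟩
  · rintro (x | x) (y | y)
    · simp [comp, restrict, comap, f]
    · simpa [comp, restrict, comap, f] using (h _ x.2 _ y.2).2.1
    · simpa [comp, restrict, comap, f] using (h _ y.2 _ x.2).2.2
    · simp [comp, restrict, comap, f]
  · rintro (x | x) (y | y)
    · simp [comp, restrict, comap, f]
    · simpa [comp, restrict, comap, f] using (h _ x.2 _ y.2).1
    · simpa [comp, restrict, comap, f] using fun h' =>
        hne _ y.2 _ x.2 (T.antisymm₂ _ _ (h _ y.2 _ x.2).1 h')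
    · simp [comp, restrict, comap, f]

/-- Converse to `restrict_union_iso`: factorizations are read inside one fixed double poset as
subsets, so that two of them can be compared. -/
theorem exists_precedes {T : DoublePoset α} {P : DoublePoset β} {Q : DoublePoset γ}
    (h : T.Iso (P.comp Q)) :
    ∃ A : Set α, T.Precedes A Aᶜ ∧ (T.restrict A).Iso P ∧ (T.restrict Aᶜ).Iso Q := by
  obtain ⟨e, h₁, h₂⟩ := h.symm
  have hl : ∀ x, e (.inl x) ∈ Set.range (e ∘ Sum.inl) := fun x => ⟨x, rfl⟩
  have hr : ∀ x, e (.inr x) ∈ (Set.range (e ∘ Sum.inl))ᶜ := by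
    rintro x ⟨y, hy⟩
    exact absurd (e.injective hy) (by simp)
  refine ⟨Set.range (e ∘ Sum.inl), ?_, ?_, ?_⟩
  · rintro _ ⟨x, rfl⟩ y hy
    obtain ⟨y | y, rfl⟩ := e.surjective y
    · exact absurd (hl y) hy
    · rw [Function.comp_apply, ← h₁, ← h₂, ← h₁]
      simp [comp]
  · refine Iso.symm ⟨Equiv.ofBijective (fun x => ⟨e (.inl x), hl x⟩) ⟨fun x y hxy => ?_, ?_⟩, ?_, ?_⟩
    · simpa using hxy
    · rintro ⟨_, x, rfl⟩
      exact ⟨x, rfl⟩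
    · intro x y
      refine Iff.trans ?_ (h₁ (.inl x) (.inl y))
      simp [comp]
    · intro x y
      refine Iff.trans ?_ (h₂ (.inl x) (.inl y))
      simp [comp]
  · refine Iso.symm ⟨Equiv.ofBijective (fun x => ⟨e (.inr x), hr x⟩) ⟨fun x y hxy => ?_, ?_⟩, ?_, ?_⟩
    · simpa using hxy
    · rintro ⟨y, hy⟩
      obtain ⟨y | y, rfl⟩ := e.surjective y
      · exact absurd (hl y) hy
      · exact ⟨y, rfl⟩
    · intro x y
      refine Iff.trans ?_ (h₁ (.inr x) (.inr y))
      simp [comp]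
    · intro x y
      refine Iff.trans ?_ (h₂ (.inr x) (.inr y))
      simp [comp]

/-- Elements `x` of `A \ B` and `y` of `B \ A` would satisfy both `x ≤₂ y` and `y ≤₂ x`. -/
theorem Precedes.subset_or_subset {T : DoublePoset α} {A B : Set α} (hA : T.Precedes A Aᶜ)
    (hB : T.Precedes B Bᶜ) : A ⊆ B ∨ B ⊆ A := by
  by_contra! h
  obtain ⟨⟨x, hx, hx'⟩, y, hy, hy'⟩ := Set.not_subset.1 h.1, Set.not_subset.1 h.2
  have := T.antisymm₂ _ _ (hA x hx y hy').1 (hB y hy x hx').1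
  exact hx' (this ▸ hy)

/-! ### The second composition -/

/-- Exchange of the two orders. -/
def swap (P : DoublePoset α) : DoublePoset α where
  le₁ := P.le₂
  le₂ := P.le₁
  refl₁ := P.refl₂
  trans₁ := P.trans₂
  antisymm₁ := P.antisymm₂
  refl₂ := P.refl₁
  trans₂ := P.trans₁
  antisymm₂ := P.antisymm₁

theorem Iso.swap {P : DoublePoset α} {Q : DoublePoset β} (h : P.Iso Q) : P.swap.Iso Q.swap := by
  obtain ⟨e, h₁, h₂⟩ := h
  exact ⟨e, h₂, h₁⟩

/-- The second composition of `P` and `Q`: on the disjoint union, every `x ∈ P` and `y ∈ Q` satisfy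
`x ≤₁ y` and are not comparable for `≤₂`. -/
def stack (P : DoublePoset α) (Q : DoublePoset β) : DoublePoset (α ⊕ β) :=
  (P.swap.comp Q.swap).swap

theorem Iso.stack {P : DoublePoset α} {Q : DoublePoset β} {P' : DoublePoset γ}
    {Q' : DoublePoset δ} (h : P.Iso P') (k : Q.Iso Q') : (P.stack Q).Iso (P'.stack Q') :=
  (h.swap.comp k.swap).swap

theorem empty_stack_iso [IsEmpty α] (E : DoublePoset α) (P : DoublePoset β) :
    (E.stack P).Iso P := (empty_comp_iso E.swap P.swap).swap

theorem stack_empty_iso [IsEmpty α] (E : DoublePoset α) (P : DoublePoset β) :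
    (P.stack E).Iso P := (comp_empty_iso E.swap P.swap).swap

theorem restrict_stack_iso (P : DoublePoset α) (Q : DoublePoset β) (s : Set (α ⊕ β))
    (t : Set α) (u : Set β) (ht : t = Sum.inl ⁻¹' s) (hu : u = Sum.inr ⁻¹' s) :
    ((P.stack Q).restrict s).Iso ((P.restrict t).stack (Q.restrict u)) :=
  (restrict_comp_iso P.swap Q.swap s t u ht hu).swap

theorem IsPlane.swap {P : DoublePoset α} (h : P.IsPlane) : P.swap.IsPlane := by
  intro x y hxy
  have := h x y hxy
  change (P.le₂ x y ∨ P.le₂ y x) ↔ ¬ (P.le₁ x y ∨ P.le₁ y x)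
  tauto

theorem IsPlane.stack {P : DoublePoset α} {Q : DoublePoset β} (h : P.IsPlane) (k : Q.IsPlane) :
    (P.stack Q).IsPlane := (h.swap.comp k.swap).swap

theorem Contains.swap {P : DoublePoset α} {Q : DoublePoset β} (h : P.Contains Q) :
    P.swap.Contains Q.swap := by
  obtain ⟨s, hs⟩ := h
  exact ⟨s, hs.swap⟩

theorem Contains.congr_right {P : DoublePoset α} {Q : DoublePoset β} {R : DoublePoset γ}
    (h : P.Contains Q) (e : Q.Iso R) : P.Contains R := by
  obtain ⟨s, hs⟩ := h
  exact ⟨s, hs.trans e⟩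

/-- A double poset whose second order contains the pattern `a < c`, `a < d`, `b < d` can only be
contained in a second composition if it is contained in one of the two factors. -/
theorem Contains.of_stack {P : DoublePoset α} {Q : DoublePoset β} {R : DoublePoset (Fin 4)}
    (σ : Equiv.Perm (Fin 4)) (h02 : R.le₂ (σ 0) (σ 2)) (h03 : R.le₂ (σ 0) (σ 3))
    (h13 : R.le₂ (σ 1) (σ 3)) (h : (P.stack Q).Contains R) : P.Contains R ∨ Q.Contains R := by
  have e := comap_iso R.swap σ
  have h' : (P.swap.comp Q.swap).Contains (R.swap.comap σ.toEmbedding) :=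
    h.swap.congr_right e.symm
  exact (h'.of_comp h02 h03 h13).imp (fun c => (c.congr_right e).swap)
    (fun c => (c.congr_right e).swap)

/-- The letter N is self-complementary: the second order of each forbidden poset is again an N, up
to the relabelling given by the permutation, so the argument for the composition applies after
exchanging the orders. -/
theorem IsWN.stack {P : DoublePoset α} {Q : DoublePoset β} (h : P.IsWN) (k : Q.IsWN) :
    (P.stack Q).IsWN := by
  refine ⟨h.1.stack k.1, fun c => ?_, fun c => ?_⟩
  · rcases c.of_stack (⟨![2, 0, 3, 1], ![1, 3, 0, 2], by decide, by decide⟩ : Equiv.Perm (Fin 4))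
      (by simp [N₁]) (by simp [N₁]) (by simp [N₁]) with c | c
    exacts [h.2.1 c, k.2.1 c]
  · rcases c.of_stack (⟨![1, 3, 0, 2], ![2, 0, 3, 1], by decide, by decide⟩ : Equiv.Perm (Fin 4))
      (by simp [N₂]) (by simp [N₂]) (by simp [N₂]) with c | c
    exacts [h.2.2 c, k.2.2 c]

/-- The empty ideal. -/
def emptyIdeal (P : DoublePoset α) : P.Ideals := ⟨∅, fun _ h => h.elim⟩

theorem coe_emptyIdeal (P : DoublePoset α) : (emptyIdeal P).1 = ∅ := rfl

/-- An ideal of `Q` is an ideal of the second composition of `P` and `Q`. -/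
def idealRight (P : DoublePoset α) (Q : DoublePoset β) : Q.Ideals ↪ (P.stack Q).Ideals where
  toFun J := ⟨Sum.inr '' J.1, by
    rintro _ ⟨x, hx, rfl⟩ (y | y) hxy
    · simp [stack, comp, swap] at hxy
    · exact ⟨y, J.2 x hx y (by simpa [stack, comp, swap] using hxy), rfl⟩⟩
  inj' J J' h := Subtype.ext (Set.image_injective.2 Sum.inr_injective (congrArg Subtype.val h))

/-- The union of an ideal of `P` and of `Q` is an ideal of the second composition of `P` and
`Q`. -/
def idealLeft (P : DoublePoset α) (Q : DoublePoset β) : P.Ideals ↪ (P.stack Q).Ideals where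
  toFun J := ⟨Sum.inl '' J.1 ∪ Set.range Sum.inr, by
    rintro _ (⟨x, hx, rfl⟩ | ⟨x, rfl⟩) (y | y) hxy
    · exact Or.inl ⟨y, J.2 x hx y (by simpa [stack, comp, swap] using hxy), rfl⟩
    · exact Or.inr ⟨y, rfl⟩
    · simp [stack, comp, swap] at hxy
    · exact Or.inr ⟨y, rfl⟩⟩
  inj' J J' h := Subtype.ext (by
    have := congrArg (fun I : (P.stack Q).Ideals => Sum.inl ⁻¹' I.1) h
    ext x
    simpa using congrArg (x ∈ ·) this)

theorem coe_idealRight (P : DoublePoset α) (Q : DoublePoset β) (J : Q.Ideals) :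
    (idealRight P Q J).1 = Sum.inr '' J.1 := rfl

theorem coe_idealLeft (P : DoublePoset α) (Q : DoublePoset β) (J : P.Ideals) :
    (idealLeft P Q J).1 = Sum.inl '' J.1 ∪ Set.range Sum.inr := rfl

/-- An ideal that meets `P` contains all of `Q`, since `Q` lies above `P`; otherwise it is an ideal
of `Q`. The two kinds share only `Q` itself, whence the subtracted term. -/
theorem sum_ideals_stack [Finite α] [Finite β] (P : DoublePoset α) (Q : DoublePoset β)
    {M : Type*} [AddCommGroup M] (f : (P.stack Q).Ideals → M) :
    ∑ I, f I = ∑ J, f (idealRight P Q J) + ∑ J, f (idealLeft P Q J) -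
      f (idealLeft P Q P.emptyIdeal) := by
  classical
  have hunion : Finset.univ.map (idealRight P Q) ∪ Finset.univ.map (idealLeft P Q) =
      Finset.univ := by
    refine Finset.eq_univ_iff_forall.2 fun I => ?_
    rw [Finset.mem_union, Finset.mem_map, Finset.mem_map]
    by_cases h : ∃ x, Sum.inl x ∈ I.1
    · obtain ⟨x, hx⟩ := h
      have hQ : ∀ y, Sum.inr y ∈ I.1 := fun y => I.2 _ hx _ (by simp [stack, comp, swap])
      refine Or.inr ⟨⟨Sum.inl ⁻¹' I.1, fun y hy z hyz => I.2 _ hy _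
        (by simpa [stack, comp, swap] using hyz)⟩, Finset.mem_univ _, Subtype.ext ?_⟩
      refine (coe_idealLeft P Q _).trans ?_
      ext (y | y) <;> simp [hQ]
    · push Not at h
      refine Or.inl ⟨⟨Sum.inr ⁻¹' I.1, fun y hy z hyz => I.2 _ hy _
        (by simpa [stack, comp, swap] using hyz)⟩, Finset.mem_univ _, Subtype.ext ?_⟩
      refine (coe_idealRight P Q _).trans ?_
      ext (y | y) <;> simp [h]
  have hinter : Finset.univ.map (idealRight P Q) ∩ Finset.univ.map (idealLeft P Q) =
      {idealLeft P Q P.emptyIdeal} := by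
    ext I
    simp only [Finset.mem_inter, Finset.mem_map, Finset.mem_univ, true_and, Finset.mem_singleton]
    constructor
    · rintro ⟨⟨J, rfl⟩, J', h⟩
      rw [← h]
      congr 1
      refine Subtype.ext (Set.eq_empty_of_forall_notMem fun x hx => ?_)
      have : Sum.inl x ∈ (idealRight P Q J).1 := h ▸ (Or.inl ⟨x, hx, rfl⟩ : _ ∈ (idealLeft P Q J').1)
      simp [coe_idealRight] at this
    · rintro rfl
      refine ⟨⟨⟨Set.univ, fun _ _ _ _ => trivial⟩, Subtype.ext ?_⟩, _, rfl⟩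
      refine ((coe_idealRight P Q _).trans ?_).trans (coe_idealLeft P Q _).symm
      rw [coe_emptyIdeal]
      ext (y | y) <;> simp
  have := Finset.sum_union_inter (f := f) (s₁ := Finset.univ.map (idealRight P Q))
    (s₂ := Finset.univ.map (idealLeft P Q))
  rw [hunion, hinter, Finset.sum_singleton, Finset.sum_map, Finset.sum_map] at this
  rw [← this, add_sub_cancel_right]

end DoublePoset

namespace DP

open DoublePoset

theorem card_eq_zero {x : DP} (h : x.card = 0) : x = 1 := by
  have : IsEmpty (Fin (Quotient.out x).1) := by
    rw [show (Quotient.out x).1 = 0 from h]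
    infer_instance
  rw [← cls_rep x, cls_of_isEmpty]

theorem cls_restrict_union {α : Type} [Finite α] {T : DoublePoset α} {A B s : Set α}
    (h : T.Precedes A B) (hs : s = A ∪ B) :
    cls (T.restrict s) = cls (T.restrict A) * cls (T.restrict B) := by
  subst hs
  rw [cls_mul_cls, cls_eq_iff]
  exact restrict_union_iso h

/-- Levi's property for double posets. -/
theorem levi {a b x y : DP} (h : a * b = x * y) : ∃ (s : Set (Fin (Quotient.out (a * b)).1)),
    (a = x * cls ((a * b).rep.restrict s) ∧ y = cls ((a * b).rep.restrict s) * b) ∨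
    (x = a * cls ((a * b).rep.restrict s) ∧ b = cls ((a * b).rep.restrict s) * y) := by
  have h1 : (a * b).rep.Iso (a.rep.comp b.rep) := rep_cls_iso _
  have h2 : (a * b).rep.Iso (x.rep.comp y.rep) :=
    cls_eq_iff.1 ((cls_rep _).trans h)
  generalize (a * b).rep = T at h1 h2
  obtain ⟨A, hA, ha, hb⟩ := exists_precedes h1
  obtain ⟨B, hB, hx, hy⟩ := exists_precedes h2
  have ha := (cls_eq_iff.2 ha).trans (cls_rep a)
  have hb := (cls_eq_iff.2 hb).trans (cls_rep b)
  have hx := (cls_eq_iff.2 hx).trans (cls_rep x)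
  have hy := (cls_eq_iff.2 hy).trans (cls_rep y)
  have key : ∀ A B : Set (Fin (Quotient.out (a * b)).1), T.Precedes A Aᶜ → T.Precedes B Bᶜ →
      A ⊆ B → cls (T.restrict B) = cls (T.restrict A) * cls (T.restrict (B \ A)) ∧
        cls (T.restrict Aᶜ) = cls (T.restrict (B \ A)) * cls (T.restrict Bᶜ) := by
    intro A B hA hB hAB
    refine ⟨cls_restrict_union (hA.mono le_rfl fun z hz => hz.2)
      (Set.union_sdiff_cancel hAB).symm, cls_restrict_union (hB.mono Set.sdiff_subset le_rfl) ?_⟩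
    ext z
    have := @hAB z
    simp only [Set.mem_compl_iff, Set.mem_union, Set.mem_sdiff]
    tauto
  rcases hA.subset_or_subset hB with hAB | hAB
  · have := key A B hA hB hAB
    rw [ha, hb, hx, hy] at this
    exact ⟨B \ A, Or.inr this⟩
  · have := key B A hB hA hAB
    rw [ha, hb, hx, hy] at this
    exact ⟨A \ B, Or.inl this⟩

theorem finite_card (n : ℕ) : {x : DP | x.card = n}.Finite := by
  have : Finite (DoublePoset (Fin n)) :=
    Finite.of_injective (β := (Fin n → Fin n → Prop) × (Fin n → Fin n → Prop))
      (fun P => (P.le₁, P.le₂)) fun P Q h => by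
        cases P
        cases Q
        simp only [Prod.mk.injEq] at h
        obtain ⟨rfl, rfl⟩ := h
        rfl
  refine (Set.finite_range (cls : DoublePoset (Fin n) → DP)).subset ?_
  rintro x rfl
  exact ⟨x.rep, cls_rep x⟩

end DP

/-! ### The graded bialgebras of double posets -/

open DoublePoset DP

namespace PosetFamily

variable (C : PosetFamily)

theorem bijective_lift_atoms :
    Function.Bijective (FreeMonoid.lift fun a : atoms C.toSubmonoid => (a : C.toSubmonoid)) := by
  refine _root_.bijective_lift_atoms (fun x => x.1.card) (fun x y => HopfOf.card_mul x.1 y.1)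
    (fun x hx => Subtype.ext (card_eq_zero hx)) fun a b x y h => ?_
  -- The middle factor is a double subposet of the product, so stability under double subposets
  -- keeps it in `C`.
  obtain ⟨s, hs⟩ := levi (congrArg Subtype.val h)
  refine ⟨⟨_, C.restrict_rep_mem _ (mul_mem a.2 b.2) s⟩, ?_⟩
  exact hs.imp (fun h => ⟨Subtype.ext h.1, Subtype.ext h.2⟩)
    fun h => ⟨Subtype.ext h.1, Subtype.ext h.2⟩

/-- The monoid of the isoclasses in `C` is free. -/
noncomputable def freeMonoidEquiv :
    FreeMonoid (ULift.{u} (atoms C.toSubmonoid)) ≃* C.toSubmonoid :=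
  (FreeMonoid.freeMonoidCongr Equiv.ulift).trans (MulEquiv.ofBijective _ C.bijective_lift_atoms)

/-- `C` is stable under the second composition. -/
def IsStackClosed : Prop :=
  ∀ x ∈ C.toSubmonoid, ∀ y ∈ C.toSubmonoid, cls (x.rep.stack y.rep) ∈ C.toSubmonoid

theorem isStackClosed_all : all.IsStackClosed := fun _ _ _ _ => trivial

theorem isStackClosed_plane : plane.IsStackClosed :=
  fun _ h _ k => (rep_cls_iso _).symm.isPlane (IsPlane.stack h k)

theorem isStackClosed_wn : wn.IsStackClosed :=
  fun _ h _ k => (rep_cls_iso _).symm.isWN (IsWN.stack h k)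

variable {C}

theorem IsStackClosed.mem (hC : C.IsStackClosed) {α β : Type} [Finite α] [Finite β]
    {P : DoublePoset α} {Q : DoublePoset β} (h : cls P ∈ C.toSubmonoid)
    (k : cls Q ∈ C.toSubmonoid) : cls (P.stack Q) ∈ C.toSubmonoid := by
  rw [← cls_eq_iff.2 ((rep_cls_iso P).stack (rep_cls_iso Q))]
  exact hC _ h _ k

end PosetFamily

/-! ### The two structures on the Hopf algebras of double posets -/

namespace HopfOf

variable (K : Type u) [Field K] (C : PosetFamily)

theorem isFreeAlgebra : IsFreeAlgebra K (HopfOf K C) :=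
  ⟨ULift.{u} (atoms C.toSubmonoid), ⟨(MonoidAlgebra.domCongr K K C.freeMonoidEquiv.symm).trans
    FreeAlgebra.equivMonoidAlgebraFreeMonoid.symm⟩⟩

/-- The basis of isoclasses, indexed by words in the atoms. -/
noncomputable def wordBasis :
    Module.Basis (FreeMonoid (ULift.{u} (atoms C.toSubmonoid))) K (HopfOf K C) :=
  show Module.Basis _ K (MonoidAlgebra K C.toSubmonoid) from
    (MonoidAlgebra.basis C.toSubmonoid K).reindex C.freeMonoidEquiv.symm.toEquiv

theorem wordBasis_apply (w : FreeMonoid (ULift.{u} (atoms C.toSubmonoid))) :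
    wordBasis K C w = of K (C.freeMonoidEquiv w) :=
  (Module.Basis.reindex_apply (MonoidAlgebra.basis C.toSubmonoid K) _ w).trans
    (MonoidAlgebra.basis_apply K _)

theorem elt_eq_wordBasis {α : Type} [Finite α] {P : DoublePoset α} (h : cls P ∈ C.toSubmonoid) :
    elt K P h = wordBasis K C (C.freeMonoidEquiv.symm ⟨cls P, h⟩) := by
  rw [wordBasis_apply, MulEquiv.apply_symm_apply]
  rfl

/-- The grading of `H_C` by the cardinality, its underlying algebra being free on the atoms. -/
noncomputable def freeGrading :
    FreeGrading K (HopfOf K C) (ULift.{u} (atoms C.toSubmonoid)) where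
  basis := wordBasis K C
  deg :=
    { toFun := fun w => Multiplicative.ofAdd (C.freeMonoidEquiv w).1.card
      map_one' := by rw [map_one]; exact congrArg _ card_one
      map_mul' := fun v w => by rw [map_mul]; exact congrArg _ (card_mul _ _) }
  deg_of_pos x := by
    refine Nat.pos_of_ne_zero fun h => ?_
    have h1 : C.freeMonoidEquiv (FreeMonoid.of x) = 1 := Subtype.ext (card_eq_zero h)
    have h2 := (map_eq_one_iff _ C.freeMonoidEquiv.injective).1 h1
    exact FreeMonoid.of_ne_one x h2
  finite_deg n := (finite_card n).preimage
    (f := fun w => (C.freeMonoidEquiv w).1)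
    (Subtype.val_injective.comp C.freeMonoidEquiv.injective).injOn
  basis_one := by
    rw [wordBasis_apply, map_one]
    exact MonoidAlgebra.one_def.symm
  basis_mul v w := by
    rw [wordBasis_apply, wordBasis_apply, wordBasis_apply, map_mul]
    exact ((MonoidAlgebra.single_mul_single ..).trans (by rw [mul_one]; rfl)).symm
  counit_basis w hw := by
    rw [wordBasis_apply, of_eq_elt, counit_elt, if_neg]
    rw [Nat.card_fin]
    intro h
    have h1 : C.freeMonoidEquiv w = 1 := Subtype.ext (card_eq_zero h)
    exact hw ((map_eq_one_iff _ C.freeMonoidEquiv.injective).1 h1)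
  comul_basis w := by
    rw [wordBasis_apply, of_eq_elt, comul_elt]
    refine sum_mem fun I _ => Submodule.subset_span ⟨_, _, ?_,
      by rw [elt_eq_wordBasis, elt_eq_wordBasis]⟩
    change (C.freeMonoidEquiv (C.freeMonoidEquiv.symm _)).1.card +
      (C.freeMonoidEquiv (C.freeMonoidEquiv.symm _)).1.card = (C.freeMonoidEquiv w).1.card
    rw [MulEquiv.apply_symm_apply, MulEquiv.apply_symm_apply]
    dsimp only
    rw [card_cls, card_cls, Nat.card_coe_set_eq, Nat.card_coe_set_eq, add_comm,
      Set.ncard_add_ncard_compl, Nat.card_fin]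
    rfl

theorem freeGrading_A (n : ℕ) : (freeGrading K C).A n = degree K C n := by
  refine congrArg (Submodule.span K) (Set.ext fun y => ?_)
  constructor
  · rintro ⟨w, hw, rfl⟩
    exact ⟨_, hw, wordBasis_apply K C w⟩
  · rintro ⟨x, hx, rfl⟩
    obtain ⟨w, rfl⟩ := C.freeMonoidEquiv.surjective x
    exact ⟨w, hx, wordBasis_apply K C w⟩

variable {K C}

/-- The bilinear extension of the second composition. -/
noncomputable def stackMul (hC : C.IsStackClosed) :
    HopfOf K C →ₗ[K] HopfOf K C →ₗ[K] HopfOf K C :=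
  (MonoidAlgebra.basis C.toSubmonoid K).constr K fun x =>
    (MonoidAlgebra.basis C.toSubmonoid K).constr K fun y =>
      elt K (x.1.rep.stack y.1.rep) (hC _ x.2 _ y.2)

theorem constr_elt {M : Type*} [AddCommGroup M] [Module K M] (f : C.toSubmonoid → M) {α : Type}
    [Finite α] {P : DoublePoset α} (h : cls P ∈ C.toSubmonoid) :
    (show HopfOf K C →ₗ[K] M from (MonoidAlgebra.basis C.toSubmonoid K).constr K f) (elt K P h) =
      f ⟨cls P, h⟩ :=
  (congrArg ((MonoidAlgebra.basis C.toSubmonoid K).constr K f)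
    (MonoidAlgebra.basis_apply K _).symm).trans (Module.Basis.constr_basis _ K f _)

theorem stackMul_elt (hC : C.IsStackClosed) {α β : Type} [Finite α] [Finite β]
    {P : DoublePoset α} {Q : DoublePoset β} (h : cls P ∈ C.toSubmonoid)
    (k : cls Q ∈ C.toSubmonoid) :
    stackMul (K := K) hC (elt K P h) (elt K Q k) = elt K (P.stack Q) (hC.mem h k) := by
  refine (LinearMap.congr_fun (constr_elt (K := K) _ h) _).trans ((constr_elt _ k).trans ?_)
  exact elt_congr K _ _ ((rep_cls_iso P).stack (rep_cls_iso Q))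

/-- The sum over the ideals of the stack is matched term by term. An ideal `J` of `Q` leaves `P`
stacked with `Q \ J`; an ideal of `P` completed by `Q` leaves only a part of `P`. The ideal counted
twice, `Q`, gives `P ⊗ Q`. -/
theorem comul_stackMul (hC : C.IsStackClosed) {α β : Type} [Finite α] [Finite β]
    {P : DoublePoset α} {Q : DoublePoset β} (h : cls P ∈ C.toSubmonoid)
    (k : cls Q ∈ C.toSubmonoid) :
    Coalgebra.comul (R := K) (stackMul (K := K) hC (elt K P h) (elt K Q k)) =
      (stackMul hC (elt K P h)).rTensor _ (Coalgebra.comul (elt K Q k)) +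
      ((stackMul hC).flip (elt K Q k)).lTensor _ (Coalgebra.comul (elt K P h)) -
      elt K P h ⊗ₜ elt K Q k := by
  rw [stackMul_elt, comul_elt, sum_ideals_stack, comul_elt, comul_elt, map_sum, map_sum]
  congr 2
  · refine Finset.sum_congr rfl fun J _ => ?_
    rw [LinearMap.rTensor_tmul, stackMul_elt hC h (C.restrict_mem k _)]
    congr 1
    · refine elt_congr K _ _ ((restrict_stack_iso P Q _ Set.univ J.1ᶜ ?_ ?_).trans
        ((restrict_univ_iso P).stack (.refl _)))
      · rw [coe_idealRight]; ext x; simp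
      · rw [coe_idealRight]; ext x; simp
    · refine elt_congr K _ _ ((restrict_stack_iso P Q _ ∅ J.1 ?_ ?_).trans (empty_stack_iso _ _))
      · rw [coe_idealRight]; ext x; simp
      · rw [coe_idealRight]; ext x; simp
  · refine Finset.sum_congr rfl fun J _ => ?_
    rw [LinearMap.lTensor_tmul, LinearMap.flip_apply, stackMul_elt hC (C.restrict_mem h _) k]
    congr 1
    · refine elt_congr K _ _ ((restrict_stack_iso P Q _ J.1ᶜ ∅ ?_ ?_).trans (stack_empty_iso _ _))
      · rw [coe_idealLeft]; ext x; simp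
      · rw [coe_idealLeft]; ext x; simp
    · refine elt_congr K _ _ ((restrict_stack_iso P Q _ J.1 Set.univ ?_ ?_).trans
        ((Iso.refl _).stack (restrict_univ_iso Q)))
      · rw [coe_idealLeft]; ext x; simp
      · rw [coe_idealLeft]; ext x; simp
  · refine elt_congr K _ _ ((restrict_stack_iso P Q _ Set.univ ∅ ?_ ?_).trans
      ((stack_empty_iso _ _).trans (restrict_univ_iso P)))
    · rw [coe_idealLeft, coe_emptyIdeal]; ext x; simp
    · rw [coe_idealLeft, coe_emptyIdeal]; ext x; simp
  · refine elt_congr K _ _ ((restrict_stack_iso P Q _ ∅ Set.univ ?_ ?_).trans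
      ((empty_stack_iso _ _).trans (restrict_univ_iso Q)))
    · rw [coe_idealLeft, coe_emptyIdeal]; ext x; simp
    · rw [coe_idealLeft, coe_emptyIdeal]; ext x; simp

/-- The second composition makes `H_C` an infinitesimal bialgebra. -/
noncomputable def infProduct (hC : C.IsStackClosed) : (freeGrading K C).InfProduct where
  r := stackMul hC
  one_left x := by
    refine LinearMap.congr_fun (g := LinearMap.id) (linearMap_ext K fun n P hP => ?_) x
    rw [one_eq_elt K DoublePoset.empty (by rw [cls_of_isEmpty]; exact one_mem _), stackMul_elt]
    exact elt_congr K _ _ (empty_stack_iso _ _)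
  one_right x := by
    refine LinearMap.congr_fun (f := (stackMul hC).flip 1) (g := LinearMap.id)
      (linearMap_ext K fun n P hP => ?_) x
    rw [one_eq_elt K DoublePoset.empty (by rw [cls_of_isEmpty]; exact one_mem _),
      LinearMap.flip_apply, stackMul_elt]
    exact elt_congr K _ _ (stack_empty_iso _ _)
  mem {i j x y} hx hy := by
    rw [freeGrading_A] at hx hy ⊢
    refine Submodule.span_induction (p := fun x _ => stackMul hC x y ∈ degree K C (i + j)) ?_
      (by simp) (fun a b _ _ ha hb => by rw [map_add]; exact add_mem ha hb)
      (fun r a _ ha => by rw [map_smul]; exact Submodule.smul_mem _ _ ha) hx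
    rintro _ ⟨x, rfl, rfl⟩
    refine Submodule.span_induction
      (p := fun y _ => stackMul hC (of K x) y ∈ degree K C (x.1.card + j)) ?_
      (by simp) (fun a b _ _ ha hb => by rw [map_add]; exact add_mem ha hb)
      (fun r a _ ha => by rw [map_smul]; exact Submodule.smul_mem _ _ ha) hy
    rintro _ ⟨y, rfl, rfl⟩
    rw [of_eq_elt, of_eq_elt, stackMul_elt]
    refine Submodule.subset_span ⟨_, ?_, rfl⟩
    rw [card_cls, Nat.card_sum, Nat.card_fin, Nat.card_fin]
    rfl
  comul_r x y := by
    have key : (stackMul hC).compr₂ (Coalgebra.comul (R := K)) =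
        LinearMap.compl₂ (LinearMap.rTensorHom (HopfOf K C) ∘ₗ stackMul hC) Coalgebra.comul +
        (LinearMap.compl₂ (LinearMap.lTensorHom (HopfOf K C) ∘ₗ (stackMul hC).flip)
          Coalgebra.comul).flip - TensorProduct.mk K (HopfOf K C) (HopfOf K C) :=
      linearMap_ext K fun n P hP => linearMap_ext K fun m Q hQ => comul_stackMul hC hP hQ
    exact LinearMap.congr_fun₂ key x y

theorem isCofree (hC : C.IsStackClosed) : IsCofree K (HopfOf K C) :=
  FreeGrading.isCofree (infProduct hC)

theorem isSelfDual (hC : C.IsStackClosed) : IsSelfDual (degree K C) := by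
  have := (freeGrading K C).isSelfDual (infProduct hC)
  rwa [show (freeGrading K C).A = degree K C from funext (freeGrading_A K C)] at this

end HopfOf

theorem corollary29 (K : Type*) [Field K] :
    ((IsFreeAlgebra K (HDP K) ∧ IsCofree K (HDP K)) ∧
      (IsFreeAlgebra K (HPP K) ∧ IsCofree K (HPP K)) ∧
      (IsFreeAlgebra K (HWNP K) ∧ IsCofree K (HWNP K))) ∧
    (IsSelfDual (HopfOf.degree K PosetFamily.all) ∧
      IsSelfDual (HopfOf.degree K PosetFamily.plane) ∧
      IsSelfDual (HopfOf.degree K PosetFamily.wn)) ∧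
    (CharZero K →
      IsFreeLieAlgebra K (primitives K (HDP K)) ∧
      IsFreeLieAlgebra K (primitives K (HPP K)) ∧
      IsFreeLieAlgebra K (primitives K (HWNP K))) := by
  refine ⟨⟨⟨HopfOf.isFreeAlgebra K _, HopfOf.isCofree PosetFamily.isStackClosed_all⟩,
    ⟨HopfOf.isFreeAlgebra K _, HopfOf.isCofree PosetFamily.isStackClosed_plane⟩,
    ⟨HopfOf.isFreeAlgebra K _, HopfOf.isCofree PosetFamily.isStackClosed_wn⟩⟩,
    ⟨HopfOf.isSelfDual PosetFamily.isStackClosed_all,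
      HopfOf.isSelfDual PosetFamily.isStackClosed_plane,
      HopfOf.isSelfDual PosetFamily.isStackClosed_wn⟩, fun _ => ?_⟩
  exact ⟨(HopfOf.freeGrading K _).isFreeLieAlgebra, (HopfOf.freeGrading K _).isFreeLieAlgebra,
    (HopfOf.freeGrading K _).isFreeLieAlgebra⟩
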